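/- Fix $\gamma>0$, a number $V_0\ge 0$, the set $\Gamma:=(-\infty,0]\subset\mathbb R$, and a bounded Lebesgue-measurable function $u:\mathbb R\to\mathbb R$. **Definitions** (stated for this $\Gamma$). Let $\partial_*\Gamma$ be the measure theoretic boundary of $\Gamma$ (here $\partial_*\Gamma=\{0\}$), and write $L^\pm=\max(\pm L,0)$. Let $\mathcal Y$ be the set of $1$-Lipschitz paths $y:[0,\infty)\to\mathbb R$ with $\theta:=\inf\{t\ge 0: y_t\in\overline\Gamma\}<\infty$ and $y_t=y_\theta$ for $t\ge\theta$, with the metric $\|y-\hat y\|_\infty+|\theta-\hat\theta|$. For $T\in(0,\infty)$, an *equilibrium capped at $T$* is a triplet $(\kappa,\mathbb Q,L)$ of $\kappa\in(0,\infty)$, a Borel probability measure $\mathbb Q$ on $\mathcal Y\times[0,\infty)=\{(y,\beta)\}$ and an upper semicontinuous, locally integrable $L:\mathbb R\to\mathbb R\setminus\{0\}$ such that * $\mathbb Q$ minimizes $\mathbb E^{\hat{\mathbb Q}}[\int_0^\theta L^+(y_t)\,dt]$ over all Borel probability measures $\hat{\mathbb Q}$ with $\hat{\mathbb Q}\circ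 y_0^{-1}=\mathbb Q\circ y_0^{-1}$; * $\mathbb Q$-a.s. $\int_0^\theta L^+(y_t)\,dt\le T$ and $\beta\le\theta$, and $\mathbb Q$-a.s. on $\{\beta=\theta\}$ one has $y_\theta\in\partial_*\Gamma$; * for all $\phi\in C_c^\infty(\mathbb R)$: $\kappa\,\mathbb E^{\mathbb Q}[\int_0^\beta\phi(y_t)L^+(y_t)\,dt]=\int_{\mathbb R}\phi(x)(1+\gamma L(x))\,dx$ and $\mathbb E^{\mathbb Q}[\int_0^\beta\phi(y_t)L^-(y_t)\,dt]=0$. An *equilibrium* is an equilibrium capped at some $T\in(0,\infty)$. For an equilibrium and $t\ge0$ put $\iota(L,t):=\inf\{r\in[0,\theta]:\int_r^\theta L^+(y_z)\,dz<t\}$ (with $\inf\emptyset=\infty$), let $D_t$ be the union of $\Gamma$ and the support of the measure $\mathbb E^{\mathbb Q}[\int_{\iota(L,t)}^{\beta\vee\iota(L,t)}\mathbf 1_{\{y_r\in dx\}}\,dr]$ (which is zero for $t=0$), and set $$w^{\mathbb Q,L}(x):=\inf\{t\ge0:x\in D_t\}\in[0,\infty],$$ $$\mathbf e^{\kappa,\mathbb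 Q,L}(dx):=\kappa\,\mathbb Q(y_0\in dx,\theta=0)+\mathbf 1_{\{w^{\mathbb Q,L}<\infty\}\setminus\overline\Gamma}(x)\big(\kappa\,\mathbb Q(y_0\in dx)-\kappa\,\mathbb Q(y_\beta\in dx)-(1+u(x))\,dx\big),$$ $$\mathbf E^{\kappa,\mathbb Q,L}_t:=\mathbf e^{\kappa,\mathbb Q,L}(\{w^{\mathbb Q,L}\le t\}).$$ Let $\pi(dx):=(\gamma+V_0)\mathbf 1_{\partial_*\Gamma}(x)\,\mathcal H^0(dx)$. For finite measures write $P>P'$ if $P(A)>P'(A)$ for every measurable $A$ with $P(A)>0$. A measurable $w:\mathbb R\to[0,\infty]$ is a *minimal solution* with initial domain $\Gamma$ and initial velocity $V_0$ (to the cascade equation with surface tension coefficient $\gamma$ and temperature $u$) if there are equilibria $(\kappa^n,\mathbb Q^n,L^n)_{n\in\mathbb N}$ such that for every $T>0$: 1. $\kappa^n\mathbb Q^n(y_\theta\in dx,\beta=\theta)>\pi(dx)$ and $\mathbf e^{\kappa^n,\mathbb Q^n,L^n}\ge0$ for all $n$, $w^{\mathbb Q^n,L^n}\wedge T\to w\wedge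 T$ in $L^1_{\rm loc}(\mathbb R)$, and $\kappa^n\mathbb Q^n(\beta=\theta)\to\pi(\partial_*\Gamma)$; 2. for every sequence of equilibria $(\hat\kappa^n,\hat{\mathbb Q}^n,\hat L^n)_{n\in\mathbb N}$ such that, for all $n$, $\hat\kappa^n\hat{\mathbb Q}^n(y_\theta\in dx,\beta=\theta)=\kappa^n\mathbb Q^n(y_\theta\in dx,\beta=\theta)$, $\mathbf e^{\hat\kappa^n,\hat{\mathbb Q}^n,\hat L^n}\ge0$, and $\mathbf E^{\hat\kappa^n,\hat{\mathbb Q}^n,\hat L^n}_t\le\mathbf E^{\kappa^n,\mathbb Q^n,L^n}_t$ for all $t\in[0,T]$, one has $$\liminf_{n\to\infty}\big(\mathbf E^{\hat\kappa^n,\hat{\mathbb Q}^n,\hat L^n}_t-\mathbf E^{\kappa^n,\mathbb Q^n,L^n}_r\big)\ge0\qquad\text{for all }0\le r<t<T.$$ **Proposition.** Let $$x^*:=\inf\Big\{x>0:\int_0^x(u(z)+1)\,dz>V_0\Big\}\in[0,\infty]\quad(\inf\emptyset=\infty),$$ and let $w:\mathbb R\to[0,\infty]$ be $0$ on $(-\infty,0]$,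 $$w(x)=\int_0^x\frac{dz}{V_0-\int_0^z(u(r)+1)\,dr}\in[0,\infty]\quad\text{for }0<x\le x^*\ (\text{with }1/0:=\infty),\qquad w(x)=\infty\quad\text{for }x>x^*.$$ Then $w$ is a minimal solution with initial domain $\Gamma=(-\infty,0]$ and initial velocity $V_0$, and it is the only one: every minimal solution with this initial domain and initial velocity equals $w$ Lebesgue-almost everywhere. -/

import Mathlib

open MeasureTheory Set Filter Topology
open scoped NNReal ENNReal ContDiff

namespace Cascade

noncomputable section

/-- The measure theoretic boundary `∂_* E` of a set `E ⊆ ℝ`: the points at which neither `E` nor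
its complement has (one-dimensional) Lebesgue density zero. -/
def measureTheoreticBoundary (E : Set ℝ) : Set ℝ :=
  {x | 0 < limsup (fun r : ℝ => volume (Metric.closedBall x r ∩ E) / ENNReal.ofReal r) (𝓝[>] 0) ∧
    0 < limsup (fun r : ℝ => volume (Metric.closedBall x r \ E) / ENNReal.ofReal r) (𝓝[>] 0)}

/-- The first time `θ` at which a path `y : [0,∞) → ℝ` enters the closure of `Γ`
(used only for paths that do enter it). -/
def hittingTime (Γ : Set ℝ) (y : ℝ≥0 → ℝ) : ℝ≥0 := sInf {t | y t ∈ closure Γ}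

/-- The space `𝒴` of particle paths: `y : [0,∞) → ℝ` with `‖ẏ‖_∞ ≤ 1`, with a finite hitting time
`θ` of the closure of `Γ`, and with `y` constant from time `θ` on. -/
structure ParticlePath (Γ : Set ℝ) where
  toFun : ℝ≥0 → ℝ
  lipschitz : LipschitzWith 1 toFun
  hits : ∃ t, toFun t ∈ closure Γ
  stopped : ∀ t, hittingTime Γ toFun ≤ t → toFun t = toFun (hittingTime Γ toFun)

namespace ParticlePath

variable {Γ : Set ℝ}

instance : CoeFun (ParticlePath Γ) (fun _ => ℝ≥0 → ℝ) := ⟨ParticlePath.toFun⟩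

/-- The hitting time `θ` of the closure of `Γ` by the path. -/
def θ (y : ParticlePath Γ) : ℝ≥0 := hittingTime Γ y

theorem dist_hit_le (y : ParticlePath Γ) (t : ℝ≥0) : dist (y t) (y y.θ) ≤ y.θ := by
  rcases le_total y.θ t with h | h
  · have : y t = y y.θ := y.stopped t h
    rw [this, dist_self]
    exact y.θ.coe_nonneg
  · have h1 := y.lipschitz.dist_le_mul t y.θ
    have h2 : dist t y.θ ≤ y.θ := by
      rw [NNReal.dist_eq, abs_le]
      have h3 : (t : ℝ) ≤ y.θ := by exact_mod_cast h
      have h4 := t.coe_nonneg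
      constructor <;> linarith
    rw [NNReal.coe_one, one_mul] at h1
    exact h1.trans h2

/-- A path, seen as a bounded continuous function on `[0,∞)`. -/
def toBounded (y : ParticlePath Γ) : BoundedContinuousFunction ℝ≥0 ℝ :=
  BoundedContinuousFunction.mkOfBound ⟨y, y.lipschitz.continuous⟩ (y.θ + y.θ) (fun s t =>
    (dist_triangle_right (y s) (y t) (y y.θ)).trans (add_le_add (y.dist_hit_le s) (y.dist_hit_le t)))

theorem toBounded_injective : Function.Injective (toBounded (Γ := Γ)) := by
  intro y z h
  have h1 : y.toFun = z.toFun := by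
    funext t
    exact DFunLike.congr_fun h t
  cases y
  cases z
  simp only at h1
  subst h1
  rfl

/-- The metric `d(y, z) = ‖y - z‖_∞ + |θ(y) - θ(z)|` on the space of paths. -/
instance : MetricSpace (ParticlePath Γ) where
  dist y z := dist y.toBounded z.toBounded + dist y.θ z.θ
  dist_self y := by simp
  dist_comm y z := by rw [dist_comm y.toBounded, dist_comm y.θ]
  dist_triangle x y z := by
    have h1 := dist_triangle x.toBounded y.toBounded z.toBounded
    have h2 := dist_triangle x.θ y.θ z.θ
    linarith
  eq_of_dist_eq_zero := by
    intro y z h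
    have h' : dist y.toBounded z.toBounded + dist y.θ z.θ = 0 := h
    have h1 : 0 ≤ dist y.toBounded z.toBounded := dist_nonneg
    have h2 : 0 ≤ dist y.θ z.θ := dist_nonneg
    exact toBounded_injective (dist_eq_zero.mp (by linarith))

instance : MeasurableSpace (ParticlePath Γ) := borel _

instance : BorelSpace (ParticlePath Γ) := ⟨rfl⟩

/-- The cost `∫_s^θ L⁺(y_t) dt` that remains to be paid along the path from time `s` on. -/
def costFrom (L : ℝ → ℝ) (y : ParticlePath Γ) (s : ℝ≥0) : ℝ≥0∞ :=
  ∫⁻ t in Icc (s : ℝ) (y.θ : ℝ), ENNReal.ofReal (L (y t.toNNReal))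

/-- The total cost `∫_0^θ L⁺(y_t) dt` of the path. -/
def cost (L : ℝ → ℝ) (y : ParticlePath Γ) : ℝ≥0∞ := y.costFrom L 0

/-- `ι(L,t) = inf {r ∈ [0,θ] : ∫_r^θ L⁺(y_z) dz < t}`, with `inf ∅ = ∞` (relevant for `t = 0`). -/
def entryTime (L : ℝ → ℝ) (t : ℝ≥0) (y : ParticlePath Γ) : ℝ≥0∞ :=
  ⨅ (r : ℝ≥0) (_ : r ≤ y.θ ∧ y.costFrom L r < t), (r : ℝ≥0∞)

end ParticlePath

/-- A triplet `(κ, ℚ, L)`: a constant `κ`, a measure `ℚ` on pairs `(y, β)` of a path `y` and a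
killing time `β ∈ [0,∞)`, and a running cost `L`. -/
structure Triplet (Γ : Set ℝ) where
  κ : ℝ
  Q : Measure (ParticlePath Γ × ℝ≥0)
  L : ℝ → ℝ

/-- `(κ, ℚ, L)` is an equilibrium capped at `T`, i.e. it belongs to `𝓔_T`. -/
structure IsEquilibriumCapped (γ : ℝ) {Γ : Set ℝ} (T : ℝ≥0) (E : Triplet Γ) : Prop where
  κ_pos : 0 < E.κ
  isProbabilityMeasure : IsProbabilityMeasure E.Q
  L_ne_zero : ∀ x, E.L x ≠ 0
  upperSemicontinuous : UpperSemicontinuous E.L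
  /-- `ℚ` minimizes the expected cost among all probability measures with the same law of `y_0`. -/
  optimal : ∀ Q' : Measure (ParticlePath Γ × ℝ≥0), IsProbabilityMeasure Q' →
    Q'.map (fun p => p.1 0) = E.Q.map (fun p => p.1 0) →
    ∫⁻ p, p.1.cost E.L ∂E.Q ≤ ∫⁻ p, p.1.cost E.L ∂Q'
  cost_le : ∀ᵐ p ∂E.Q, p.1.cost E.L ≤ (T : ℝ≥0∞)
  killing_le : ∀ᵐ p ∂E.Q, p.2 ≤ p.1.θ
  /-- `ℚ(y_θ ∈ ∂_*Γ | β = θ) = 1`. -/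
  boundary : ∀ᵐ p ∂E.Q, p.2 = p.1.θ → p.1 p.1.θ ∈ measureTheoreticBoundary Γ
  /-- Local integrability of `L` is what makes `∫ φ (1 + γ L) dx` meaningful for all test
  functions `φ`. -/
  locallyIntegrable : LocallyIntegrable E.L
  /-- `κ 𝔼[∫_0^β φ(y_t) L⁺(y_t) dt] = ∫ φ (1 + γ L) dx` for all test functions `φ`. -/
  fixedPoint : ∀ φ : ℝ → ℝ, ContDiff ℝ ∞ φ → HasCompactSupport φ →
    E.κ * ∫ p, (∫ t in (0 : ℝ)..p.2, φ (p.1 t.toNNReal) * max (E.L (p.1 t.toNNReal)) 0) ∂E.Q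
      = ∫ x, φ x * (1 + γ * E.L x)
  /-- `𝔼[∫_0^β φ(y_t) L⁻(y_t) dt] = 0` for all test functions `φ`, where it suffices to test with
  `φ ≥ 0`; then the left-hand side makes sense in `[0,∞]`. -/
  fixedPoint_neg : ∀ φ : ℝ → ℝ, ContDiff ℝ ∞ φ → HasCompactSupport φ → (∀ x, 0 ≤ φ x) →
    ∫⁻ p, (∫⁻ t in Icc (0 : ℝ) p.2,
      ENNReal.ofReal (φ (p.1 t.toNNReal)) * ENNReal.ofReal (-E.L (p.1 t.toNNReal))) ∂E.Q = 0

/-- The set `𝓔` of all equilibria, the union of the `𝓔_T` over `T ∈ (0,∞)`. -/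
def IsEquilibrium (γ : ℝ) {Γ : Set ℝ} (E : Triplet Γ) : Prop :=
  ∃ T : ℝ≥0, 0 < T ∧ IsEquilibriumCapped γ T E

namespace Triplet

variable {Γ : Set ℝ}

/-- The occupation measure `𝔼[∫_{ι(L,t)}^{β ∨ ι(L,t)} 1_{y_r ∈ A} dr]` of a set `A`. -/
def occupation (E : Triplet Γ) (t : ℝ≥0) (A : Set ℝ) : ℝ≥0∞ :=
  ∫⁻ p, volume {r : ℝ | 0 ≤ r ∧ p.1.entryTime E.L t ≤ ENNReal.ofReal r ∧ r ≤ p.2 ∧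
    p.1 r.toNNReal ∈ A} ∂E.Q

/-- The time-`t` cascade `D_t`: the union of `Γ` and the support of the occupation measure. -/
def aggregate (E : Triplet Γ) (t : ℝ≥0) : Set ℝ :=
  Γ ∪ {x | ∀ ε > 0, 0 < E.occupation t (Metric.ball x ε)}

/-- The arrival time function `w^{ℚ,L}(x) = inf {t ≥ 0 : x ∈ D_t}`, with `inf ∅ = ∞`. -/
def arrivalTime (E : Triplet Γ) (x : ℝ) : ℝ≥0∞ :=
  ⨅ (t : ℝ≥0) (_ : x ∈ E.aggregate t), (t : ℝ≥0∞)

/-- The region `{w^{ℚ,L} < ∞}` outside the closure of `Γ`. -/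
def invaded (E : Triplet Γ) : Set ℝ := {x | E.arrivalTime x < (⊤ : ℝ≥0∞)} \ closure Γ

/-- The signed measure of excess energy loss, as a function of the (Borel) set `A`:
`κ ℚ(y_0 ∈ A, θ = 0) + (κ ℚ(y_0 ∈ ·) - κ ℚ(y_β ∈ ·) - (1 + u) dx)(A ∩ {w^{ℚ,L} < ∞} \ closure Γ)`.
For an equilibrium `{w^{ℚ,L} < ∞} \ closure Γ` has finite Lebesgue measure, so for bounded `u` all
terms are finite. -/
def excess (u : ℝ → ℝ) (E : Triplet Γ) (A : Set ℝ) : ℝ :=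
  E.κ * E.Q.real {p | p.1 0 ∈ A ∧ p.1.θ = 0}
    + (E.κ * E.Q.real {p | p.1 0 ∈ A ∩ E.invaded}
      - E.κ * E.Q.real {p | p.1 p.2 ∈ A ∩ E.invaded}
      - ∫ x in A ∩ E.invaded, (1 + u x))

/-- The excess energy loss is a non-negative measure. -/
def ExcessNonneg (u : ℝ → ℝ) (E : Triplet Γ) : Prop :=
  ∀ A : Set ℝ, MeasurableSet A → 0 ≤ E.excess u A

/-- The cumulative excess energy loss up to time `t`. -/
def cumulativeExcess (u : ℝ → ℝ) (E : Triplet Γ) (t : ℝ≥0) : ℝ :=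
  E.excess u {x | E.arrivalTime x ≤ t}

/-- The measure `κ ℚ(y_θ ∈ dx, β = θ)`. -/
def boundaryMeasure (E : Triplet Γ) : Measure ℝ :=
  ENNReal.ofReal E.κ • (E.Q.restrict {p | p.2 = p.1.θ}).map (fun p => p.1 p.1.θ)

end Triplet

/-- The measure `(γ + V₀(x)) 1_{∂_*Γ}(x) ℋ⁰(dx)` of initial boundary energy. -/
def initialEnergy (γ : ℝ) (Γ : Set ℝ) (V₀ : ℝ → ℝ) : Measure ℝ :=
  ((Measure.hausdorffMeasure 0 : Measure ℝ).restrict (measureTheoreticBoundary Γ)).withDensity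
    (fun x => ENNReal.ofReal (γ + V₀ x))

/-- The strict order `P > P'` of finite measures: `P(A) > P'(A)` whenever `P(A) > 0`. -/
def StrictlyDominates (P P' : Measure ℝ) : Prop :=
  ∀ A : Set ℝ, MeasurableSet A → 0 < P A → P' A < P A

/-- `w_n ∧ T → w ∧ T` in `L¹_loc(ℝ)`. -/
def TendstoCappedL1Loc (T : ℝ≥0) (wn : ℕ → ℝ → ℝ≥0∞) (w : ℝ → ℝ≥0∞) : Prop :=
  ∀ K : Set ℝ, IsCompact K →
    Tendsto (fun n => ∫⁻ x in K, ‖(min (wn n x) T).toReal - (min (w x) T).toReal‖ₑ) atTop (𝓝 0)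

/-- `w : ℝ → [0,∞]` is a minimal solution of the cascade equation with initial domain `Γ` and
initial velocity `V₀`. (Functions in `L¹_loc` are measurable, and identified if equal a.e.) -/
def IsMinimalSolution (γ : ℝ) (u : ℝ → ℝ) (Γ : Set ℝ) (V₀ : ℝ → ℝ) (w : ℝ → ℝ≥0∞) : Prop :=
  AEMeasurable w ∧
  ∃ E : ℕ → Triplet Γ, (∀ n, IsEquilibrium γ (E n)) ∧
    ∀ T : ℝ≥0, 0 < T →
      ((∀ n, StrictlyDominates (E n).boundaryMeasure (initialEnergy γ Γ V₀)) ∧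
        (∀ n, (E n).ExcessNonneg u) ∧
        TendstoCappedL1Loc T (fun n => (E n).arrivalTime) w ∧
        Tendsto (fun n => ENNReal.ofReal (E n).κ * (E n).Q {p | p.2 = p.1.θ}) atTop
          (𝓝 (∫⁻ x in measureTheoreticBoundary Γ, ENNReal.ofReal (γ + V₀ x)
            ∂(Measure.hausdorffMeasure 0 : Measure ℝ)))) ∧
      ∀ E' : ℕ → Triplet Γ, (∀ n, IsEquilibrium γ (E' n)) →
        (∀ n, (E' n).boundaryMeasure = (E n).boundaryMeasure) →
        (∀ n, (E' n).ExcessNonneg u) →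
        (∀ n, ∀ t : ℝ≥0, t ≤ T → (E' n).cumulativeExcess u t ≤ (E n).cumulativeExcess u t) →
        ∀ r t : ℝ≥0, r < t → t < T →
          (0 : EReal) ≤ liminf (fun n =>
            (((E' n).cumulativeExcess u t - (E n).cumulativeExcess u r : ℝ) : EReal)) atTop

/-- `x* = inf {x > 0 : ∫_0^x (u(z) + 1) dz > V₀} ∈ [0,∞]`, with `inf ∅ = ∞`. -/
def stoppingPoint (u : ℝ → ℝ) (V₀ : ℝ) : ℝ≥0∞ :=
  ⨅ (x : ℝ) (_ : 0 < x ∧ V₀ < ∫ z in (0 : ℝ)..x, (u z + 1)), ENNReal.ofReal x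

/-- The function that is `0` on `(-∞,0]`, equal to
`∫_0^x dz / (V₀ - ∫_0^z (u(r) + 1) dr) ∈ [0,∞]` (with `1/0 = ∞`) for `0 < x ≤ x*`, and `∞` for
`x > x*`. -/
def explicitArrivalTime (u : ℝ → ℝ) (V₀ : ℝ) (x : ℝ) : ℝ≥0∞ :=
  if x ≤ 0 then 0
  else if ENNReal.ofReal x ≤ stoppingPoint u V₀ then
    ∫⁻ z in Ioc 0 x, 1 / ENNReal.ofReal (V₀ - ∫ r in (0 : ℝ)..z, (u r + 1))
  else (⊤ : ℝ≥0∞)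

end

end Cascade

namespace Cascade

noncomputable section

/-! On a half-line an equilibrium is determined by one scalar function, the particle flux `F(x) = κ
ℚ(y_β < x ≤ y_0)`, and every condition in the definition of a minimal solution becomes a statement
about `F`.

Structure of equilibria. A 1-Lipschitz path sweeps every point between its start and the origin and
spends at least Lebesgue measure there, so it costs at least `∫_0^{y_0} L⁺`, which the straight path
attains. Optimality gives equality almost surely. Since live particles only see `L > 0`, equality
forces them to move straight until they are killed. By Fubini the fixed point equation becomes `F L⁺
= 1 + γ L` a.e. Hence, a.e. where `F > 0`, one has `F > γ` and `L = 1/(F - γ)` (`ae_of_flux_pos`).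

Geometry. `F` is left-continuous and its jump down at an invaded point `a > 0` is the excess of
`{a}`. If the excess is non-negative, `F` cannot jump from zero up to a value at least `γ`, so on
`(0,∞)` it is positive exactly on some `(0,b]` (`exists_front`). There the arrival time is `∫_0^x
1/(F - γ)`, and stopping at `b > 0` costs excess at least `γ` (`le_excess_singleton_front`).

Comparison. With `p = κ ℚ(β = θ)`, conservation of particles reads `F(x) = p - e((-∞,x)) - ∫_0^x
(u+1)` (`flux_eq`). Excess thus only slows the front. Conversely, if the excess up to time `r` is at
most some `η < min(γ, p)`, the front cannot stop before `r`, and until then it is at least as fast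
as a front without excess and with initial velocity `p - γ - η`. If `p → γ + V₀` and the cumulative
excess tends to zero, the arrival times converge to the explicit formula (`tendsto_arrivalTime`).

Existence and uniqueness. For each velocity `v > 0` a monotone coupling of starts and killing points
gives an equilibrium with `p = v + γ` and no excess up to any prescribed time
(`exists_equilibrium`). Velocities decreasing to `V₀` yield a minimal solution, because no
competitor has negative excess. In any approximating sequence, comparison with such equilibria of
the same boundary mass forces the excess to vanish in the limit, which identifies the limit. -/

/-- Particle paths stopped on entering the half-line `(-∞, 0]`. -/
abbrev HalfLinePath := ParticlePath (Iic (0 : ℝ))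

/-! ### Hitting times, continuity and measurability on the path space. -/

namespace HalfLinePath

theorem apply_θ_nonpos (y : HalfLinePath) : y y.θ ≤ 0 := by
  have hc : IsClosed {t : ℝ≥0 | y t ∈ closure (Iic (0 : ℝ))} :=
    isClosed_closure.preimage y.lipschitz.continuous
  have h : y.θ ∈ {t : ℝ≥0 | y t ∈ closure (Iic (0 : ℝ))} :=
    hc.csInf_mem y.hits (OrderBot.bddBelow _)
  simpa [isClosed_Iic.closure_eq] using h

theorem pos_of_lt_θ (y : HalfLinePath) {t : ℝ≥0} (h : t < y.θ) : 0 < y t := by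
  by_contra! h0
  refine absurd (csInf_le (OrderBot.bddBelow _) ?_ : y.θ ≤ t) (not_le.2 h)
  simpa [isClosed_Iic.closure_eq] using h0

theorem θ_eq_zero_iff (y : HalfLinePath) : y.θ = 0 ↔ y 0 ≤ 0 := by
  constructor
  · intro h
    simpa [h] using apply_θ_nonpos y
  · intro h
    by_contra h0
    exact absurd (pos_of_lt_θ y (pos_iff_ne_zero.2 h0)) (not_lt.2 h)

theorem dist_def (y z : HalfLinePath) :
    dist y z = dist y.toBounded z.toBounded + dist y.θ z.θ := rfl

theorem dist_apply_le (y z : HalfLinePath) (t : ℝ≥0) : dist (y t) (z t) ≤ dist y z := by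
  have h := BoundedContinuousFunction.dist_coe_le_dist (f := y.toBounded) (g := z.toBounded) t
  have h2 : 0 ≤ dist y.θ z.θ := dist_nonneg
  have h3 : dist (y t) (z t) ≤ dist y.toBounded z.toBounded := h
  rw [dist_def]
  linarith

theorem continuous_apply (t : ℝ≥0) : Continuous (fun y : HalfLinePath => y t) :=
  (LipschitzWith.of_dist_le_mul (K := 1) fun y z => by
    simpa using dist_apply_le y z t).continuous

theorem continuous_θ : Continuous (fun y : HalfLinePath => y.θ) :=
  (LipschitzWith.of_dist_le_mul (K := 1) fun y z => by
    have h2 : 0 ≤ dist y.toBounded z.toBounded := dist_nonneg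
    rw [dist_def]
    simp only [NNReal.coe_one, one_mul]
    linarith).continuous

theorem measurable_θ : Measurable (fun y : HalfLinePath => y.θ) := continuous_θ.measurable

theorem measurable_uncurry_apply : Measurable (fun p : HalfLinePath × ℝ≥0 => p.1 p.2) := by
  have h := measurable_uncurry_of_continuous_of_measurable
    (u := fun (t : ℝ≥0) (y : HalfLinePath) => y t)
    (fun y => y.lipschitz.continuous) (fun t => (continuous_apply t).measurable)
  exact h.comp measurable_swap

theorem measurable_apply (t : ℝ≥0) : Measurable (fun y : HalfLinePath => y t) :=
  (continuous_apply t).measurable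

theorem measurable_start : Measurable (fun p : HalfLinePath × ℝ≥0 => p.1 0) :=
  (measurable_apply 0).comp measurable_fst

theorem measurable_apply_θ : Measurable (fun p : HalfLinePath × ℝ≥0 => p.1 p.1.θ) :=
  measurable_uncurry_apply.comp (measurable_fst.prodMk (measurable_θ.comp measurable_fst))

/-- The path, extended to negative times as a constant. -/
def ext (y : HalfLinePath) (r : ℝ) : ℝ := y r.toNNReal

theorem lipschitz_ext (y : HalfLinePath) : LipschitzWith 1 (ext y) := by
  have h := y.lipschitz.comp Real.lipschitzWith_toNNReal
  rw [one_mul] at h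
  exact h

theorem measurable_ext : Measurable (fun p : HalfLinePath × ℝ => ext p.1 p.2) :=
  measurable_uncurry_apply.comp (measurable_fst.prodMk (measurable_real_toNNReal.comp measurable_snd))

theorem ext_coe (y : HalfLinePath) (t : ℝ≥0) : ext y t = y t := by simp [ext]

theorem ext_zero (y : HalfLinePath) : ext y 0 = y 0 := by simp [ext]

end HalfLinePath

/-! ### Straight paths and the lower bound for the cost. -/

/-- By the intermediate value theorem the path visits every point of the interval, and a 1-Lipschitz
map does not increase one-dimensional Hausdorff measure. This is why no path is cheaper than the
straight one. -/
theorem restrict_Icc_le_map_of_lipschitz {Y : ℝ → ℝ} (hY : LipschitzWith 1 Y) {s t : ℝ}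
    (hst : s ≤ t) :
    volume.restrict (Icc (Y t) (Y s)) ≤ (volume.restrict (Icc s t)).map Y := by
  refine Measure.le_iff.2 fun A hA => ?_
  rw [Measure.map_apply hY.continuous.measurable hA, Measure.restrict_apply hA,
    Measure.restrict_apply (hY.continuous.measurable hA)]
  have hsub : A ∩ Icc (Y t) (Y s) ⊆ Y '' (Y ⁻¹' A ∩ Icc s t) := by
    rintro z ⟨hz, hz'⟩
    obtain ⟨r, hr, rfl⟩ := intermediate_value_Icc' hst hY.continuous.continuousOn hz'
    exact ⟨r, ⟨hz, hr⟩, rfl⟩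
  refine (measure_mono hsub).trans ?_
  have h := hY.hausdorffMeasure_image_le (d := 1) zero_le_one (Y ⁻¹' A ∩ Icc s t)
  simpa [hausdorffMeasure_real] using h

theorem lintegral_Icc_le_of_lipschitz {Y : ℝ → ℝ} (hY : LipschitzWith 1 Y) {s t : ℝ}
    (hst : s ≤ t) {f : ℝ → ℝ≥0∞} (hf : Measurable f) :
    ∫⁻ z in Icc (Y t) (Y s), f z ≤ ∫⁻ r in Icc s t, f (Y r) := by
  rw [← lintegral_map hf hY.continuous.measurable]
  exact lintegral_mono' (restrict_Icc_le_map_of_lipschitz hY hst) le_rfl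

/-- The path that moves to the left at unit speed until it reaches `(-∞, 0]`. -/
def straightFun (x : ℝ) (t : ℝ≥0) : ℝ := x - min (t : ℝ) (max x 0)

theorem straightFun_nonpos_iff (x : ℝ) (t : ℝ≥0) : straightFun x t ≤ 0 ↔ x.toNNReal ≤ t := by
  have ht := t.coe_nonneg
  rw [Real.toNNReal_le_iff_le_coe, straightFun]
  rcases le_total x 0 with h | h
  · rw [max_eq_right h, min_eq_right ht]
    constructor <;> intro <;> linarith
  · rw [max_eq_left h]
    rcases le_total (t : ℝ) x with h1 | h1
    · rw [min_eq_left h1]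
      constructor <;> intro <;> linarith
    · rw [min_eq_right h1]
      constructor <;> intro <;> linarith

theorem hittingTime_straightFun (x : ℝ) : hittingTime (Iic 0) (straightFun x) = x.toNNReal := by
  have : {t | straightFun x t ∈ closure (Iic (0 : ℝ))} = Ici x.toNNReal := by
    ext t
    simp [isClosed_Iic.closure_eq, straightFun_nonpos_iff]
  rw [hittingTime, this, csInf_Ici]

/-- `straightFun` as a particle path. -/
def straight (x : ℝ) : HalfLinePath where
  toFun := straightFun x
  lipschitz := by
    refine LipschitzWith.of_dist_le_mul fun s t => ?_
    have h := abs_min_sub_min_le_max (s : ℝ) (max x 0) t (max x 0)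
    rw [Real.dist_eq, NNReal.dist_eq, straightFun, straightFun, NNReal.coe_one, one_mul]
    rw [sub_self, abs_zero, max_eq_left (abs_nonneg ((s : ℝ) - t))] at h
    rw [show x - min (s : ℝ) (max x 0) - (x - min (t : ℝ) (max x 0))
      = -(min (s : ℝ) (max x 0) - min (t : ℝ) (max x 0)) by ring, abs_neg]
    exact h
  hits := ⟨x.toNNReal, by simp [isClosed_Iic.closure_eq, straightFun_nonpos_iff]⟩
  stopped := by
    intro t ht
    rw [hittingTime_straightFun] at ht ⊢
    have h1 : max x 0 ≤ (t : ℝ) := by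
      have : ((x.toNNReal : ℝ≥0) : ℝ) ≤ t := by exact_mod_cast ht
      simpa using this
    rw [straightFun, straightFun, min_eq_right h1, Real.coe_toNNReal', min_self]

theorem straight_apply (x : ℝ) (t : ℝ≥0) : straight x t = x - min (t : ℝ) (max x 0) := rfl

theorem straight_θ (x : ℝ) : (straight x).θ = x.toNNReal := hittingTime_straightFun x

theorem straight_zero (x : ℝ) : straight x 0 = x := by simp [straight_apply]

theorem measurable_straight : Measurable straight := by
  -- The constant 3 is 2 for the uniform distance (starting point and stopping level) plus 1 for the
  -- hitting times.
  refine (LipschitzWith.of_dist_le_mul (K := 3) fun x x' => ?_).continuous.measurable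
  have h0 : |max x 0 - max x' 0| ≤ |x - x'| := by
    have h := abs_max_sub_max_le_max x 0 x' 0
    rwa [sub_self, abs_zero, max_eq_left (abs_nonneg (x - x'))] at h
  have h1 : dist (straight x).toBounded (straight x').toBounded ≤ 2 * |x - x'| := by
    rw [BoundedContinuousFunction.dist_le (by positivity)]
    intro t
    change |straight x t - straight x' t| ≤ _
    rw [straight_apply, straight_apply]
    have h := abs_min_sub_min_le_max (t : ℝ) (max x 0) t (max x' 0)
    rw [sub_self, abs_zero, max_eq_right (abs_nonneg (max x 0 - max x' 0))] at h
    calc _ = |(x - x') - (min (t : ℝ) (max x 0) - min (t : ℝ) (max x' 0))| := by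
          congr 1; ring
      _ ≤ |x - x'| + |min (t : ℝ) (max x 0) - min (t : ℝ) (max x' 0)| := abs_sub _ _
      _ ≤ _ := by linarith
  have h2 : dist (straight x).θ (straight x').θ ≤ |x - x'| := by
    rw [NNReal.dist_eq, straight_θ, straight_θ, Real.coe_toNNReal', Real.coe_toNNReal']
    exact h0
  rw [HalfLinePath.dist_def, Real.dist_eq]
  norm_num
  linarith

/-- The cost `∫_0^x L⁺` of moving straight from `x` to the origin. -/
def travel (L : ℝ → ℝ) (x : ℝ) : ℝ≥0∞ := ∫⁻ z in Ioc 0 x, ENNReal.ofReal (L z)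

theorem travel_mono (L : ℝ → ℝ) : Monotone (travel L) := fun _ _ h =>
  lintegral_mono_set (Ioc_subset_Ioc_right h)

theorem measurable_travel (L : ℝ → ℝ) : Measurable (travel L) := (travel_mono L).measurable

theorem travel_of_nonpos (L : ℝ → ℝ) {x : ℝ} (h : x ≤ 0) : travel L x = 0 := by
  simp [travel, Ioc_eq_empty (not_lt.2 h)]

namespace HalfLinePath

theorem costFrom_eq (L : ℝ → ℝ) (y : HalfLinePath) (s : ℝ≥0) :
    y.costFrom L s = ∫⁻ t in Icc (s : ℝ) y.θ, ENNReal.ofReal (L (ext y t)) := rfl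

theorem travel_le_costFrom {L : ℝ → ℝ} (hL : Measurable L) (y : HalfLinePath) {s : ℝ≥0}
    (hs : s ≤ y.θ) : travel L (y s) ≤ y.costFrom L s := by
  rw [costFrom_eq]
  refine le_trans ?_ (lintegral_Icc_le_of_lipschitz (lipschitz_ext y) (NNReal.coe_le_coe.2 hs)
    (f := fun z => ENNReal.ofReal (L z)) hL.ennreal_ofReal)
  rw [ext_coe, ext_coe]
  exact lintegral_mono_set fun z hz => ⟨(apply_θ_nonpos y).trans hz.1.le, hz.2⟩

theorem travel_le_cost {L : ℝ → ℝ} (hL : Measurable L) (y : HalfLinePath) :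
    travel L (y 0) ≤ y.cost L := travel_le_costFrom hL y zero_le

theorem lintegral_comp_sub (f : ℝ → ℝ≥0∞) (x a b : ℝ) :
    ∫⁻ r in Icc a b, f (x - r) = ∫⁻ z in Icc (x - b) (x - a), f z := by
  have h := (Measure.measurePreserving_sub_left (volume : Measure ℝ) x).setLIntegral_comp_preimage_emb
    (Homeomorph.subLeft x).measurableEmbedding f (Icc (x - b) (x - a))
  rw [← h]
  congr 2
  ext r
  simp only [mem_Icc, mem_preimage]
  constructor <;> rintro ⟨h1, h2⟩ <;> constructor <;> linarith

theorem cost_straight (L : ℝ → ℝ) (x : ℝ) : (straight x).cost L = travel L x := by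
  change (straight x).costFrom L 0 = _
  rw [costFrom_eq, straight_θ]
  rcases le_total x 0 with h | h
  · rw [travel_of_nonpos L h, Real.toNNReal_of_nonpos h]
    simp
  · rw [travel, Real.coe_toNNReal _ h]
    have : ∀ r ∈ Icc (0 : ℝ) x, ext (straight x) r = x - r := by
      intro r hr
      rw [ext, straight_apply, Real.coe_toNNReal _ hr.1, max_eq_left h, min_eq_left hr.2]
    rw [NNReal.coe_zero, setLIntegral_congr_fun measurableSet_Icc (fun r hr => by rw [this r hr]),
      lintegral_comp_sub (fun z => ENNReal.ofReal (L z)), sub_self, sub_zero,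
      setLIntegral_congr Ioc_ae_eq_Icc]

theorem measurable_cost {L : ℝ → ℝ} (hL : Measurable L) :
    Measurable (fun y : HalfLinePath => y.cost L) := by
  have h : ∀ y : HalfLinePath, y.cost L
      = ∫⁻ t, {p : HalfLinePath × ℝ | p.2 ∈ Icc (0 : ℝ) p.1.θ}.indicator
          (fun p => ENNReal.ofReal (L (ext p.1 p.2))) (y, t) := by
    intro y
    change y.costFrom L 0 = _
    rw [costFrom_eq, NNReal.coe_zero, ← lintegral_indicator measurableSet_Icc]
    rfl
  simp_rw [h]
  refine Measurable.lintegral_prod_right' (Measurable.indicator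
    (hL.comp measurable_ext).ennreal_ofReal ?_)
  exact (measurableSet_le measurable_const measurable_snd).inter
    (measurableSet_le measurable_snd (measurable_θ.comp measurable_fst).coe_nnreal_real)

/-- Along a path of minimal cost, both the time-`s` past and the time-`s` future are of minimal
cost, and the past charges the space like a straight path does. -/
theorem minimal_cost_split {L : ℝ → ℝ} (hL : Measurable L) (y : HalfLinePath)
    (hc : y.cost L = travel L (y 0)) (hfin : y.cost L ≠ ⊤) {s : ℝ≥0} (hs : s ≤ y.θ) :
    y.costFrom L s = travel L (y s) ∧
      ∀ f : ℝ → ℝ≥0∞, Measurable f →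
        ∫⁻ r in Icc (0 : ℝ) s, ENNReal.ofReal (L (ext y r)) * f (ext y r)
          = ∫⁻ z in Icc (y s) (y 0), ENNReal.ofReal (L z) * f z := by
  have hℓ : Measurable fun z => ENNReal.ofReal (L z) := hL.ennreal_ofReal
  have hY := lipschitz_ext y
  have hYm : Measurable (ext y) := hY.continuous.measurable
  have hb := travel_le_costFrom hL y hs
  -- Here `n` is the cost charged to space by a straight passage from `y 0` to `y s`, and `m` is the
  -- cost that the actual path charges up to time `s`.
  set n := (volume.restrict (Icc (y s) (y 0))).withDensity fun z => ENNReal.ofReal (L z) with hn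
  set m := ((volume.restrict (Icc (0 : ℝ) s)).map (ext y)).withDensity
    fun z => ENNReal.ofReal (L z) with hm
  have hle : n ≤ m := by
    have h := restrict_Icc_le_map_of_lipschitz hY s.coe_nonneg
    rw [ext_coe, ext_zero] at h
    refine Measure.le_iff.2 fun A hA => ?_
    rw [withDensity_apply _ hA, withDensity_apply _ hA]
    exact lintegral_mono' (Measure.restrict_mono le_rfl h) le_rfl
  have hmu : m univ = ∫⁻ r in Icc (0 : ℝ) s, ENNReal.ofReal (L (ext y r)) := by
    rw [hm, withDensity_apply _ MeasurableSet.univ, Measure.restrict_univ, lintegral_map hℓ hYm]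
  have hnu : n univ = ∫⁻ z in Icc (y s) (y 0), ENNReal.ofReal (L z) := by
    rw [hn, withDensity_apply _ MeasurableSet.univ, Measure.restrict_univ]
  have hcost : y.cost L = m univ + y.costFrom L s := by
    have hsθ : (s : ℝ) ≤ y.θ := NNReal.coe_le_coe.2 hs
    change y.costFrom L 0 = _
    rw [hmu, costFrom_eq, costFrom_eq, NNReal.coe_zero, ← Icc_union_Ioc_eq_Icc s.coe_nonneg hsθ,
      lintegral_union measurableSet_Ioc, setLIntegral_congr Ioc_ae_eq_Icc]
    exact Set.disjoint_left.2 fun z h1 h2 => absurd h1.2 (not_le.2 h2.1)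
  have htr : y.cost L ≤ n univ + travel L (y s) := by
    rw [hc, hnu, add_comm]
    refine (lintegral_mono_set ?_).trans (lintegral_union_le _ _ _)
    intro z hz
    rcases le_total z (y s) with h | h
    · exact Or.inl ⟨hz.1, h⟩
    · exact Or.inr ⟨h, hz.2⟩
  have hmfin : m univ ≠ ⊤ := fun h => hfin (by rw [hcost, h, top_add])
  have hcfin : y.costFrom L s ≠ ⊤ := fun h => hfin (by rw [hcost, h, add_top])
  rw [hcost] at htr
  have h1 : m univ ≤ n univ := by
    have : m univ + y.costFrom L s ≤ n univ + y.costFrom L s := htr.trans (by gcongr)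
    exact ENNReal.le_of_add_le_add_right hcfin this
  have h2 : y.costFrom L s ≤ travel L (y s) := by
    have : m univ + y.costFrom L s ≤ m univ + travel L (y s) := htr.trans (by gcongr)
    exact ENNReal.le_of_add_le_add_left hmfin this
  refine ⟨le_antisymm h2 hb, fun f hf => ?_⟩
  have : IsFiniteMeasure n := ⟨((hle univ).trans_lt hmfin.lt_top)⟩
  -- The total cost is minimal, so neither the past nor the future can exceed its lower bound; `n ≤
  -- m` with equal finite mass forces equality of measures.
  have hnm : n = m := Measure.eq_of_le_of_measure_univ_eq hle (le_antisymm (hle _) h1)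
  have h3 : ∫⁻ z, f z ∂m = ∫⁻ z, f z ∂n := by rw [hnm]
  rw [hm, hn, lintegral_withDensity_eq_lintegral_mul _ hℓ hf,
    lintegral_withDensity_eq_lintegral_mul _ hℓ hf, lintegral_map (hℓ.mul hf) hYm] at h3
  exact h3

/-- A path of minimal cost moves straight as long as it stays where the running cost is
positive. -/
theorem straight_of_minimal_cost {L : ℝ → ℝ} (hL : Measurable L) (y : HalfLinePath)
    (hc : y.cost L = travel L (y 0)) (hfin : y.cost L ≠ ⊤) {s : ℝ≥0} (hs : s ≤ y.θ)
    (hpos : ∀ᵐ r ∂(volume.restrict (Icc (0 : ℝ) s)), 0 < L (ext y r)) {r : ℝ≥0} (hr : r ≤ s) :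
    y r = y 0 - r := by
  have hℓ : Measurable fun z => ENNReal.ofReal (L z) := hL.ennreal_ofReal
  have hdist : ∀ a b : ℝ≥0, |y a - y b| ≤ |(a : ℝ) - b| := fun a b => by
    simpa [Real.dist_eq, NNReal.dist_eq] using y.lipschitz.dist_le_mul a b
  have hsub : (s : ℝ) ≤ y 0 - y s := by
    rcases eq_or_lt_of_le (zero_le : (0 : ℝ≥0) ≤ s) with h0 | h0
    · simp [← h0]
    -- Testing with `1 / L⁺` cancels the cost: the left side becomes the elapsed time and the right
    -- side is at most the distance travelled.
    have h := (minimal_cost_split hL y hc hfin hs).2 _ hℓ.inv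
    rw [lintegral_congr_ae (g := fun _ => (1 : ℝ≥0∞))] at h
    · have h1 : ∫⁻ z in Icc (y s) (y 0), ENNReal.ofReal (L z) * (ENNReal.ofReal (L z))⁻¹
          ≤ ∫⁻ z in Icc (y s) (y 0), 1 :=
        lintegral_mono fun z => ENNReal.mul_inv_le_one _
      change _ = ∫⁻ z in Icc (y s) (y 0), ENNReal.ofReal (L z) * (ENNReal.ofReal (L z))⁻¹ at h
      rw [← h] at h1
      simp only [lintegral_const, one_mul, Measure.restrict_apply_univ, Real.volume_Icc,
        sub_zero] at h1
      rw [ENNReal.ofReal_le_ofReal_iff'] at h1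
      have : ¬ (s : ℝ) ≤ 0 := not_le.2 h0
      tauto
    · filter_upwards [hpos] with r hr
      exact ENNReal.mul_inv_cancel (by simpa using hr) ENNReal.ofReal_ne_top
  have h1 : |y 0 - y r| ≤ r := by simpa using hdist 0 r
  have h2 := hdist r s
  have hr' : (r : ℝ) ≤ s := hr
  have hr0 := r.coe_nonneg
  rw [abs_of_nonpos (a := (r : ℝ) - s) (by linarith)] at h2
  have h3 := le_abs_self (y 0 - y r)
  have h4 := le_abs_self (y r - y s)
  have h5 := neg_abs_le (y 0 - y r)
  linarith

end HalfLinePath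

/-! ### Almost sure behaviour of particles in an equilibrium. -/

open HalfLinePath

/-- The regularity that almost every path has in an equilibrium. -/
structure IsRegularPath (L : ℝ → ℝ) (T : ℝ≥0) (p : HalfLinePath × ℝ≥0) : Prop where
  killing_le : p.2 ≤ p.1.θ
  apply_eq : ∀ r : ℝ≥0, r ≤ p.2 → p.1 r = p.1 0 - r
  costFrom_eq : ∀ r : ℝ≥0, r ≤ p.2 → p.1.costFrom L r = travel L (p.1 r)
  travel_le : travel L (p.1 0) ≤ T
  pos : ∀ᵐ r ∂(volume.restrict (Icc (0 : ℝ) p.2)), 0 < L (ext p.1 r)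

namespace IsRegularPath

variable {L : ℝ → ℝ} {T : ℝ≥0} {p : HalfLinePath × ℝ≥0}

theorem end_eq (h : IsRegularPath L T p) : p.1 p.2 = p.1 0 - p.2 := h.apply_eq _ le_rfl

theorem end_le (h : IsRegularPath L T p) : p.1 p.2 ≤ p.1 0 := by
  rw [h.end_eq]
  linarith [p.2.coe_nonneg]

theorem ext_eq (h : IsRegularPath L T p) {r : ℝ} (hr : r ∈ Icc (0 : ℝ) p.2) :
    ext p.1 r = p.1 0 - r := by
  lift r to ℝ≥0 using hr.1
  rw [ext_coe, h.apply_eq r (NNReal.coe_le_coe.1 hr.2)]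

theorem lintegral_ext (h : IsRegularPath L T p) (f : ℝ → ℝ≥0∞) :
    ∫⁻ r in Icc (0 : ℝ) p.2, f (ext p.1 r) = ∫⁻ z in Ioc (p.1 p.2) (p.1 0), f z := by
  rw [setLIntegral_congr_fun measurableSet_Icc (fun r hr => by rw [h.ext_eq hr]),
    lintegral_comp_sub, sub_zero, ← h.end_eq, setLIntegral_congr Ioc_ae_eq_Icc]

theorem ae_pos (h : IsRegularPath L T p) (hL : Measurable L) :
    ∀ᵐ z ∂(volume.restrict (Ioc (p.1 p.2) (p.1 0))), 0 < L z := by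
  have h1 : ∫⁻ r in Icc (0 : ℝ) p.2, {z | L z ≤ 0}.indicator (1 : ℝ → ℝ≥0∞) (ext p.1 r) = 0 := by
    rw [lintegral_congr_ae (g := fun _ => (0 : ℝ≥0∞)), lintegral_zero]
    filter_upwards [h.pos] with r hr
    have h2 : ext p.1 r ∉ {z | L z ≤ 0} := not_le.2 hr
    exact indicator_of_notMem h2 1
  have hm : MeasurableSet {z | L z ≤ 0} := measurableSet_le hL measurable_const
  rw [h.lintegral_ext, lintegral_indicator_one hm] at h1
  rw [ae_iff]
  simpa using h1

end IsRegularPath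

/-- An equilibrium for the half-line `(-∞, 0]`. -/
abbrev HalfLineTriplet := Triplet (Iic (0 : ℝ))

variable {γ : ℝ} {T : ℝ≥0} {E : HalfLineTriplet} {u : ℝ → ℝ}

namespace IsEquilibriumCapped

theorem measurable_L (hE : IsEquilibriumCapped γ T E) : Measurable E.L :=
  hE.upperSemicontinuous.measurable

/-- The competitor replaces every path by the straight path from the same start. It attains the
pathwise lower bound, and the cap makes the expected cost finite, so equal expectations imply
equality almost surely. -/
theorem ae_cost_eq (hE : IsEquilibriumCapped γ T E) :
    ∀ᵐ p ∂E.Q, p.1.cost E.L = travel E.L (p.1 0) := by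
  have := hE.isProbabilityMeasure
  have hL := hE.measurable_L
  have hs : Measurable fun p : HalfLinePath × ℝ≥0 => (straight (p.1 0), p.2) :=
    (measurable_straight.comp measurable_start).prodMk measurable_snd
  have hcm : Measurable fun p : HalfLinePath × ℝ≥0 => p.1.cost E.L :=
    (measurable_cost hL).comp measurable_fst
  have h := hE.optimal (E.Q.map fun p => (straight (p.1 0), p.2))
    (Measure.isProbabilityMeasure_map hs.aemeasurable) (by
      rw [Measure.map_map measurable_start hs]
      congr 1
      funext p
      simp [straight_zero])
  rw [lintegral_map hcm hs] at h
  simp only [cost_straight] at h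
  have hfin : ∫⁻ p, p.1.cost E.L ∂E.Q ≠ ⊤ := by
    refine ne_top_of_le_ne_top (b := (T : ℝ≥0∞)) ENNReal.coe_ne_top ?_
    refine (lintegral_mono_ae hE.cost_le).trans ?_
    simp
  have hle : (fun p : HalfLinePath × ℝ≥0 => travel E.L (p.1 0)) ≤ᵐ[E.Q] fun p => p.1.cost E.L :=
    ae_of_all _ fun p => travel_le_cost hL p.1
  have := ae_eq_of_ae_le_of_lintegral_le hle
    (ne_top_of_le_ne_top hfin (lintegral_mono_ae hle)) hcm.aemeasurable h
  filter_upwards [this] with p hp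
  exact hp.symm

/-- Testing the negative part of the fixed point equation with bumps equal to one on `[-k, k]`
removes the times at which `L < 0`; the value zero is excluded by definition. -/
theorem ae_L_pos (hE : IsEquilibriumCapped γ T E) :
    ∀ᵐ p ∂E.Q, ∀ᵐ r ∂(volume.restrict (Icc (0 : ℝ) p.2)), 0 < E.L (ext p.1 r) := by
  have := hE.isProbabilityMeasure
  have hL := hE.measurable_L
  have hbump : ∀ k : ℕ, ∃ φ : ℝ → ℝ, ContDiff ℝ ∞ φ ∧ HasCompactSupport φ ∧ (∀ x, 0 ≤ φ x) ∧
      ∀ x : ℝ, |x| ≤ k → φ x = 1 := by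
    intro k
    let f : ContDiffBump (0 : ℝ) := ⟨(k : ℝ) + 1, (k : ℝ) + 2, by positivity, by linarith⟩
    refine ⟨f, f.contDiff, f.hasCompactSupport, fun x => f.nonneg, fun x hx => ?_⟩
    refine f.one_of_mem_closedBall ?_
    rw [Metric.mem_closedBall, Real.dist_eq, sub_zero]
    exact hx.trans (by change (k : ℝ) ≤ k + 1; linarith)
  choose φ hφ1 hφ2 hφ3 hφ4 using hbump
  have hae : ∀ᵐ p ∂E.Q, ∀ k, ∫⁻ t in Icc (0 : ℝ) p.2,
      ENNReal.ofReal (φ k (ext p.1 t)) * ENNReal.ofReal (-E.L (ext p.1 t)) = 0 := by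
    rw [ae_all_iff]
    intro k
    have h := hE.fixedPoint_neg (φ k) (hφ1 k) (hφ2 k) (hφ3 k)
    rw [lintegral_eq_zero_iff] at h
    · exact h
    · have h2 : ∀ p : HalfLinePath × ℝ≥0, ∫⁻ t in Icc (0 : ℝ) p.2,
          ENNReal.ofReal (φ k (p.1 t.toNNReal)) * ENNReal.ofReal (-E.L (p.1 t.toNNReal))
          = ∫⁻ t, {q : (HalfLinePath × ℝ≥0) × ℝ | q.2 ∈ Icc (0 : ℝ) q.1.2}.indicator
          (fun q => ENNReal.ofReal (φ k (ext q.1.1 q.2)) * ENNReal.ofReal (-E.L (ext q.1.1 q.2)))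
          (p, t) := by
        intro p
        rw [← lintegral_indicator measurableSet_Icc]
        rfl
      simp_rw [h2]
      have h3 : Measurable fun q : (HalfLinePath × ℝ≥0) × ℝ => ext q.1.1 q.2 :=
        measurable_ext.comp ((measurable_fst.comp measurable_fst).prodMk measurable_snd)
      refine Measurable.lintegral_prod_right' (Measurable.indicator
        (((hφ1 k).continuous.measurable.comp h3).ennreal_ofReal.mul
          (hL.comp h3).neg.ennreal_ofReal) ?_)
      exact (measurableSet_le measurable_const measurable_snd).inter
        (measurableSet_le measurable_snd (measurable_snd.comp measurable_fst).coe_nnreal_real)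
  filter_upwards [hae] with p hp
  have hm := (lipschitz_ext p.1).continuous.measurable
  have h1 : ∀ᵐ r ∂(volume.restrict (Icc (0 : ℝ) p.2)), ∀ k,
      ENNReal.ofReal (φ k (ext p.1 r)) * ENNReal.ofReal (-E.L (ext p.1 r)) = 0 := by
    rw [ae_all_iff]
    intro k
    exact (lintegral_eq_zero_iff (((hφ1 k).continuous.measurable.comp hm).ennreal_ofReal.mul
      (hL.comp hm).neg.ennreal_ofReal)).1 (hp k)
  filter_upwards [h1] with r hr
  obtain ⟨k, hk⟩ := exists_nat_ge |ext p.1 r|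
  have h2 := hr k
  rw [hφ4 k _ hk, ENNReal.ofReal_one, one_mul, ENNReal.ofReal_eq_zero] at h2
  exact lt_of_le_of_ne (by linarith) (hE.L_ne_zero _).symm

theorem ae_isRegularPath (hE : IsEquilibriumCapped γ T E) :
    ∀ᵐ p ∂E.Q, IsRegularPath E.L T p := by
  filter_upwards [hE.ae_cost_eq, hE.ae_L_pos, hE.killing_le, hE.cost_le] with p hc hpos hk hT
  have hfin : p.1.cost E.L ≠ ⊤ := ne_top_of_le_ne_top ENNReal.coe_ne_top hT
  exact ⟨hk, fun r hr => straight_of_minimal_cost hE.measurable_L p.1 hc hfin hk hpos hr,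
    fun r hr => (minimal_cost_split hE.measurable_L p.1 hc hfin (hr.trans hk)).1,
    hc ▸ hT, hpos⟩

end IsEquilibriumCapped

/-! ### The particle flux and the pointwise equation for the running cost. -/

/-- The particle flux `κ ℚ(y_β < x ≤ y_0)` through `x`. -/
def flux (E : HalfLineTriplet) (x : ℝ) : ℝ :=
  E.κ * E.Q.real {p | p.1 p.2 < x ∧ x ≤ p.1 0}

/-- The right limit `κ ℚ(y_β ≤ x < y_0)` of the particle flux at `x`. -/
def fluxRight (E : HalfLineTriplet) (x : ℝ) : ℝ :=
  E.κ * E.Q.real {p | p.1 p.2 ≤ x ∧ x < p.1 0}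

theorem measurable_end : Measurable (fun p : HalfLinePath × ℝ≥0 => p.1 p.2) :=
  measurable_uncurry_apply

theorem measurableSet_crossing :
    MeasurableSet {z : (HalfLinePath × ℝ≥0) × ℝ | z.1.1 z.1.2 < z.2 ∧ z.2 ≤ z.1.1 0} :=
  (measurableSet_lt (measurable_end.comp measurable_fst) measurable_snd).inter
    (measurableSet_le measurable_snd (measurable_start.comp measurable_fst))

theorem measurableSet_crossing_left (x : ℝ) :
    MeasurableSet {p : HalfLinePath × ℝ≥0 | p.1 p.2 < x ∧ x ≤ p.1 0} :=
  (measurableSet_lt measurable_end measurable_const).inter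
    (measurableSet_le measurable_const measurable_start)

theorem integral_crossing [IsProbabilityMeasure E.Q] {g : ℝ → ℝ} (hg : Integrable g) :
    E.κ * ∫ p, (∫ z in Ioc (p.1 p.2) (p.1 0), g z) ∂E.Q = ∫ x, flux E x * g x := by
  have h1 : ∀ p : HalfLinePath × ℝ≥0, ∫ z in Ioc (p.1 p.2) (p.1 0), g z
      = ∫ z, {z : (HalfLinePath × ℝ≥0) × ℝ | z.1.1 z.1.2 < z.2 ∧ z.2 ≤ z.1.1 0}.indicator
        (fun z => g z.2) (p, z) := fun p => by
    rw [← integral_indicator measurableSet_Ioc]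
    rfl
  simp_rw [h1]
  rw [integral_integral_swap (f := fun p z => {z : (HalfLinePath × ℝ≥0) × ℝ |
      z.1.1 z.1.2 < z.2 ∧ z.2 ≤ z.1.1 0}.indicator (fun z => g z.2) (p, z))
    ((hg.comp_snd E.Q).indicator measurableSet_crossing)]
  have h2 : ∀ x : ℝ, ∫ p, {z : (HalfLinePath × ℝ≥0) × ℝ | z.1.1 z.1.2 < z.2 ∧
      z.2 ≤ z.1.1 0}.indicator (fun z => g z.2) (p, x) ∂E.Q
      = E.Q.real {p | p.1 p.2 < x ∧ x ≤ p.1 0} * g x := fun x => by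
    have : ∀ p : HalfLinePath × ℝ≥0, {z : (HalfLinePath × ℝ≥0) × ℝ | z.1.1 z.1.2 < z.2 ∧
      z.2 ≤ z.1.1 0}.indicator (fun z => g z.2) (p, x)
      = {p : HalfLinePath × ℝ≥0 | p.1 p.2 < x ∧ x ≤ p.1 0}.indicator (fun _ => g x) p :=
      fun p => rfl
    simp_rw [this]
    rw [integral_indicator_const _ (measurableSet_crossing_left x), smul_eq_mul]
  simp_rw [h2, flux, mul_assoc]
  rw [integral_const_mul]

/-- Along a path that moves straight until the killing time, time integrals are space integrals. -/
theorem intervalIntegral_ext {p : HalfLinePath × ℝ≥0}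
    (h : ∀ r : ℝ≥0, r ≤ p.2 → p.1 r = p.1 0 - r) (g : ℝ → ℝ) :
    ∫ t in (0 : ℝ)..p.2, g (p.1 t.toNNReal) = ∫ z in Ioc (p.1 p.2) (p.1 0), g z := by
  have h1 : ∫ t in (0 : ℝ)..p.2, g (p.1 t.toNNReal) = ∫ t in (0 : ℝ)..p.2, g (p.1 0 - t) := by
    refine intervalIntegral.integral_congr fun t ht => ?_
    rw [uIcc_of_le p.2.coe_nonneg] at ht
    have := h t.toNNReal (Real.toNNReal_le_iff_le_coe.2 ht.2)
    rw [Real.coe_toNNReal _ ht.1] at this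
    simp only [this]
  have h2 := h p.2 le_rfl
  rw [h1, intervalIntegral.integral_comp_sub_left g (p.1 0), sub_zero, ← h2,
    intervalIntegral.integral_of_le (by rw [h2]; linarith [p.2.coe_nonneg])]

namespace IsEquilibriumCapped

theorem flux_nonneg (hE : IsEquilibriumCapped γ T E) (x : ℝ) : 0 ≤ flux E x :=
  mul_nonneg hE.κ_pos.le measureReal_nonneg

theorem flux_le (hE : IsEquilibriumCapped γ T E) (x : ℝ) : flux E x ≤ E.κ := by
  have := hE.isProbabilityMeasure
  calc flux E x ≤ E.κ * 1 := mul_le_mul_of_nonneg_left measureReal_le_one hE.κ_pos.le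
    _ = E.κ := mul_one _

theorem ofReal_flux (hE : IsEquilibriumCapped γ T E) (x : ℝ) :
    ENNReal.ofReal (flux E x)
      = ENNReal.ofReal E.κ * E.Q {p | p.1 p.2 < x ∧ x ≤ p.1 0} := by
  have := hE.isProbabilityMeasure
  rw [flux, ENNReal.ofReal_mul hE.κ_pos.le, ofReal_measureReal]

theorem measurable_crossing (hE : IsEquilibriumCapped γ T E) :
    Measurable fun x : ℝ => E.Q {p | p.1 p.2 < x ∧ x ≤ p.1 0} := by
  have := hE.isProbabilityMeasure
  exact measurable_measure_prodMk_right measurableSet_crossing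

theorem measurable_flux (hE : IsEquilibriumCapped γ T E) : Measurable (flux E) :=
  hE.measurable_crossing.ennreal_toReal.const_mul E.κ

theorem lintegral_lintegral_crossing (hE : IsEquilibriumCapped γ T E) {g : ℝ → ℝ≥0∞}
    (hg : Measurable g) :
    ENNReal.ofReal E.κ * ∫⁻ p, (∫⁻ z in Ioc (p.1 p.2) (p.1 0), g z) ∂E.Q
      = ∫⁻ x, ENNReal.ofReal (flux E x) * g x := by
  have := hE.isProbabilityMeasure
  have h1 : ∀ p : HalfLinePath × ℝ≥0, ∫⁻ z in Ioc (p.1 p.2) (p.1 0), g z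
      = ∫⁻ z, {z : (HalfLinePath × ℝ≥0) × ℝ | z.1.1 z.1.2 < z.2 ∧ z.2 ≤ z.1.1 0}.indicator
        (fun z => g z.2) (p, z) := fun p => by
    rw [← lintegral_indicator measurableSet_Ioc]
    rfl
  simp_rw [h1]
  rw [lintegral_lintegral_swap (f := fun p z => {z : (HalfLinePath × ℝ≥0) × ℝ |
      z.1.1 z.1.2 < z.2 ∧ z.2 ≤ z.1.1 0}.indicator (fun z => g z.2) (p, z))
    (((hg.comp measurable_snd).indicator measurableSet_crossing).aemeasurable)]
  have h2 : ∀ x : ℝ, ∫⁻ p, {z : (HalfLinePath × ℝ≥0) × ℝ | z.1.1 z.1.2 < z.2 ∧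
      z.2 ≤ z.1.1 0}.indicator (fun z => g z.2) (p, x) ∂E.Q
      = E.Q {p | p.1 p.2 < x ∧ x ≤ p.1 0} * g x := fun x => by
    have : ∀ p : HalfLinePath × ℝ≥0, {z : (HalfLinePath × ℝ≥0) × ℝ | z.1.1 z.1.2 < z.2 ∧
      z.2 ≤ z.1.1 0}.indicator (fun z => g z.2) (p, x)
      = {p : HalfLinePath × ℝ≥0 | p.1 p.2 < x ∧ x ≤ p.1 0}.indicator (fun _ => g x) p :=
      fun p => rfl
    simp_rw [this]
    rw [lintegral_indicator_const (measurableSet_crossing_left x), mul_comm]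
  simp_rw [h2, hE.ofReal_flux]
  simp_rw [mul_assoc]
  exact (lintegral_const_mul _ (hE.measurable_crossing.mul hg)).symm

/-- Since live particles move straight, time integrals are integrals over the swept interval, and
Fubini turns their expectation into an integral against the flux. The fundamental lemma of the
calculus of variations then gives the pointwise identity. -/
theorem ae_flux_mul (hE : IsEquilibriumCapped γ T E) :
    ∀ᵐ x, flux E x * max (E.L x) 0 = 1 + γ * E.L x := by
  have := hE.isProbabilityMeasure
  have hL := hE.measurable_L
  have hLp : LocallyIntegrable fun x => max (E.L x) 0 := by
    intro x
    obtain ⟨s, hs, hi⟩ := hE.locallyIntegrable x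
    exact ⟨s, hs, hi.pos_part⟩
  refine ae_eq_of_integral_contDiff_smul_eq ?_ ?_ fun φ hφ hφc => ?_
  · intro x
    obtain ⟨s, hs, hi⟩ := hLp x
    refine ⟨s, hs, hi.bdd_mul (c := E.κ) hE.measurable_flux.aestronglyMeasurable
      (ae_of_all _ fun z => ?_)⟩
    rw [Real.norm_of_nonneg (hE.flux_nonneg z)]
    exact hE.flux_le z
  · exact (locallyIntegrable_const 1).add (hE.locallyIntegrable.smul γ)
  · have hint : Integrable fun x => φ x * max (E.L x) 0 :=
      hLp.integrable_smul_left_of_hasCompactSupport hφ.continuous hφc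
    have h := hE.fixedPoint φ hφ hφc
    simp only [smul_eq_mul]
    rw [← h]
    calc ∫ x, φ x * (flux E x * max (E.L x) 0)
        = ∫ x, flux E x * (φ x * max (E.L x) 0) := by
          congr 1; funext x; ring
      _ = E.κ * ∫ p, (∫ z in Ioc (p.1 p.2) (p.1 0), φ z * max (E.L z) 0) ∂E.Q :=
          (integral_crossing hint).symm
      _ = _ := by
          congr 1
          refine integral_congr_ae ?_
          filter_upwards [hE.ae_isRegularPath] with p hp
          exact (intervalIntegral_ext hp.apply_eq fun z => φ z * max (E.L z) 0).symm

/-- The indicator of `{L ≤ 0}` integrates to zero along almost every live path, hence also against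
the flux. -/
theorem ae_pos_of_flux_pos (hE : IsEquilibriumCapped γ T E) :
    ∀ᵐ x, 0 < flux E x → 0 < E.L x := by
  have hL := hE.measurable_L
  have hm : MeasurableSet {z | E.L z ≤ 0} := measurableSet_le hL measurable_const
  have hg : Measurable ({z | E.L z ≤ 0}.indicator (1 : ℝ → ℝ≥0∞)) := measurable_one.indicator hm
  have h := hE.lintegral_lintegral_crossing hg
  rw [lintegral_congr_ae (g := fun _ => (0 : ℝ≥0∞)), lintegral_zero, mul_zero] at h
  · have h1 := (lintegral_eq_zero_iff (hE.measurable_flux.ennreal_ofReal.mul hg)).1 h.symm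
    filter_upwards [h1] with x hx hpos
    by_contra! h0
    have h2 : x ∈ {z | E.L z ≤ 0} := h0
    simp [indicator_of_mem h2] at hx
    exact absurd hx (not_le.2 hpos)
  · filter_upwards [hE.ae_isRegularPath] with p hp
    rw [lintegral_indicator_one hm]
    have := ae_iff.1 (hp.ae_pos hL)
    simpa using this

/-- Where `L > 0` the equation reads `(F - γ) L = 1`, which determines both the sign of `F - γ` and
the value of `L`. -/
theorem ae_of_flux_pos (hE : IsEquilibriumCapped γ T E) :
    ∀ᵐ x, 0 < flux E x → γ < flux E x ∧ ENNReal.ofReal (E.L x) = 1 / ENNReal.ofReal (flux E x - γ) := by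
  filter_upwards [hE.ae_flux_mul, hE.ae_pos_of_flux_pos] with x h1 h2 hpos
  have hL := h2 hpos
  rw [max_eq_left hL.le] at h1
  have h3 : (flux E x - γ) * E.L x = 1 := by linarith
  have h4 : 0 < flux E x - γ := by
    by_contra! h
    nlinarith
  refine ⟨by linarith, ?_⟩
  rw [← ENNReal.ofReal_one, ← ENNReal.ofReal_div_of_pos h4]
  congr 1
  rw [eq_div_iff h4.ne']
  linarith

theorem travel_le_of_flux_pos (hE : IsEquilibriumCapped γ T E) {x : ℝ} (hx : 0 < flux E x) :
    travel E.L x ≤ T := by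
  by_contra! h
  have h0 : E.Q {p | p.1 p.2 < x ∧ x ≤ p.1 0} = 0 := by
    rw [measure_eq_zero_iff_ae_notMem]
    filter_upwards [hE.ae_isRegularPath] with p hp hmem
    exact absurd ((travel_mono E.L hmem.2).trans hp.travel_le) (not_le.2 h)
  rw [flux, measureReal_def, h0] at hx
  simp at hx

end IsEquilibriumCapped

/-! ### Occupation measures and arrival times. -/

theorem costFrom_antitone (L : ℝ → ℝ) (y : HalfLinePath) {r s : ℝ≥0} (h : r ≤ s) :
    y.costFrom L s ≤ y.costFrom L r :=
  lintegral_mono_set (Icc_subset_Icc_left (NNReal.coe_le_coe.2 h))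

/-- Exhaust `(0, x)` by the intervals `(0, u n]`; this monotone limit also covers an infinite
integral. -/
theorem exists_lt_lintegral_Ioc {f : ℝ → ℝ≥0∞} {x : ℝ} {t : ℝ≥0∞}
    (h : t < ∫⁻ z in Ioc 0 x, f z) : ∃ b, 0 < b ∧ b < x ∧ t < ∫⁻ z in Ioc 0 b, f z := by
  have hx : 0 < x := by
    by_contra! h0
    simp [Ioc_eq_empty (not_lt.2 h0)] at h
  obtain ⟨u, hu, hu', hlim⟩ := exists_seq_strictMono_tendsto' hx
  have hU : Ioo 0 x = ⋃ n, Ioc 0 (u n) := by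
    ext z
    simp only [mem_Ioo, mem_iUnion, mem_Ioc]
    constructor
    · rintro ⟨h1, h2⟩
      obtain ⟨n, hn⟩ := (hlim.eventually (lt_mem_nhds h2)).exists
      exact ⟨n, h1, hn.le⟩
    · rintro ⟨n, h1, h2⟩
      exact ⟨h1, h2.trans_lt (hu' n).2⟩
  rw [← setLIntegral_congr Ioo_ae_eq_Ioc, hU, setLIntegral_iUnion_of_directed] at h
  · obtain ⟨n, hn⟩ := lt_iSup_iff.1 h
    exact ⟨u n, (hu' n).1, (hu' n).2, hn⟩
  · exact Monotone.directed_le fun m n hmn => Ioc_subset_Ioc_right (hu.monotone hmn)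

theorem occupation_mono (t : ℝ≥0) {A B : Set ℝ} (h : A ⊆ B) :
    E.occupation t A ≤ E.occupation t B :=
  lintegral_mono fun _ => measure_mono fun _ hr => ⟨hr.1, hr.2.1, hr.2.2.1, h hr.2.2.2⟩

namespace IsEquilibriumCapped

theorem lintegral_occupation (hE : IsEquilibriumCapped γ T E) {A : Set ℝ} (hA : MeasurableSet A) :
    ENNReal.ofReal E.κ * ∫⁻ p, volume {r : ℝ | r ∈ Icc (0 : ℝ) p.2 ∧ p.1 r.toNNReal ∈ A} ∂E.Q
      = ∫⁻ x in A, ENNReal.ofReal (flux E x) := by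
  have h := hE.lintegral_lintegral_crossing (g := A.indicator 1) (measurable_one.indicator hA)
  have h1 : ∫⁻ x, ENNReal.ofReal (flux E x) * A.indicator 1 x
      = ∫⁻ x in A, ENNReal.ofReal (flux E x) := by
    rw [← lintegral_indicator hA]
    congr 1
    funext x
    by_cases hx : x ∈ A <;> simp [hx]
  rw [← h1, ← h]
  congr 1
  refine lintegral_congr_ae ?_
  filter_upwards [hE.ae_isRegularPath] with p hp
  rw [← hp.lintegral_ext]
  have hm := (lipschitz_ext p.1).continuous.measurable
  change _ = ∫⁻ r in Icc (0 : ℝ) p.2, (HalfLinePath.ext p.1 ⁻¹' A).indicator 1 r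
  rw [lintegral_indicator_one (hm hA), Measure.restrict_apply (hm hA), inter_comm]
  rfl

theorem occupation_eq_zero_of_flux (hE : IsEquilibriumCapped γ T E) (t : ℝ≥0) {A : Set ℝ}
    (hA : MeasurableSet A) (h : ∀ x ∈ A, flux E x = 0) : E.occupation t A = 0 := by
  have h1 := hE.lintegral_occupation hA
  rw [setLIntegral_congr_fun (g := fun _ => 0) hA (fun x hx => by simp [h x hx]),
    lintegral_zero] at h1
  have h2 : ENNReal.ofReal E.κ ≠ 0 := by simpa using hE.κ_pos
  refine le_antisymm (le_trans ?_ ((mul_eq_zero.1 h1).resolve_left h2).le) zero_le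
  exact lintegral_mono fun _ => measure_mono fun _ hr => ⟨⟨hr.1, hr.2.2.1⟩, hr.2.2.2⟩

/-- A live particle to the right of `z` still has to pay more than `t`, so its entry time has not
yet come. -/
theorem occupation_eq_zero_of_travel (hE : IsEquilibriumCapped γ T E) {t : ℝ≥0} {z : ℝ}
    (h : t < travel E.L z) {A : Set ℝ} (hA : A ⊆ Ioi z) : E.occupation t A = 0 := by
  have : ∀ᵐ p ∂E.Q, volume {r : ℝ | 0 ≤ r ∧ p.1.entryTime E.L t ≤ ENNReal.ofReal r ∧ r ≤ p.2 ∧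
      p.1 r.toNNReal ∈ A} = 0 := by
    filter_upwards [hE.ae_isRegularPath] with p hp
    -- The killing time itself is discarded as a null set, so that at every other time the particle
    -- survives a little longer.
    refine measure_mono_null (t := {(p.2 : ℝ)}) ?_ (measure_singleton _)
    rintro r ⟨hr0, hent, hr1, hrA⟩
    by_contra hne
    have hlt : r < p.2 := lt_of_le_of_ne hr1 hne
    lift r to ℝ≥0 using hr0
    rw [Real.toNNReal_coe] at hrA
    rw [ENNReal.ofReal_coe_nnreal] at hent
    have hrβ : r < p.2 := hlt
    have hrz : z < p.1 0 - r := by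
      rw [← hp.apply_eq r hrβ.le]
      exact hA hrA
    -- The time at which the particle reaches `z` or is killed, whichever is first; up to `s` its
    -- remaining cost is more than `t`.
    obtain ⟨s, hs⟩ : ∃ s : ℝ≥0, s = min p.2 (p.1 0 - z).toNNReal := ⟨_, rfl⟩
    have hrs : r < s := by
      rw [hs, lt_min_iff, Real.lt_toNNReal_iff_coe_lt]
      exact ⟨hrβ, by linarith⟩
    have hsβ : s ≤ p.2 := hs ▸ min_le_left _ _
    have hsz : z ≤ p.1 s := by
      rw [hp.apply_eq s hsβ]
      have : s ≤ (p.1 0 - z).toNNReal := hs ▸ min_le_right _ _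
      rw [← NNReal.coe_le_coe, Real.coe_toNNReal _ (by linarith [r.coe_nonneg])] at this
      linarith
    have h1 : p.1.entryTime E.L t < s := hent.trans_lt (ENNReal.coe_lt_coe.2 hrs)
    rw [ParticlePath.entryTime] at h1
    simp only [iInf_lt_iff] at h1
    obtain ⟨q, ⟨-, hq⟩, hqs⟩ := h1
    have h2 := costFrom_antitone E.L p.1 (ENNReal.coe_lt_coe.1 hqs).le
    rw [hp.costFrom_eq s hsβ] at h2
    exact absurd ((h.trans_le (travel_mono E.L hsz)).trans_le h2) (not_lt.2 hq.le)
  rw [Triplet.occupation, lintegral_congr_ae (g := fun _ => 0) this, lintegral_zero]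

theorem occupation_pos (hE : IsEquilibriumCapped γ T E) {t : ℝ≥0} {c d : ℝ} (hcd : c < d)
    (hf : ∀ x ∈ Ioo c d, 0 < flux E x) (ht : ∀ x ∈ Ioo c d, travel E.L x < t) :
    0 < E.occupation t (Ioo c d) := by
  have h1 := hE.lintegral_occupation (A := Ioo c d) measurableSet_Ioo
  have h2 : 0 < ∫⁻ x in Ioo c d, ENNReal.ofReal (flux E x) := by
    rw [setLIntegral_pos_iff hE.measurable_flux.ennreal_ofReal]
    have : Function.support (fun x => ENNReal.ofReal (flux E x)) ∩ Ioo c d = Ioo c d := by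
      rw [inter_eq_right]
      intro x hx
      simpa using hf x hx
    rw [this]
    simpa using hcd
  rw [← h1] at h2
  have h3 : 0 < ∫⁻ p, volume {r : ℝ | r ∈ Icc (0 : ℝ) p.2 ∧ p.1 r.toNNReal ∈ Ioo c d} ∂E.Q :=
    pos_iff_ne_zero.2 fun h0 => by
      rw [h0, mul_zero] at h2
      exact lt_irrefl _ h2
  refine h3.trans_le (lintegral_mono_ae ?_)
  filter_upwards [hE.ae_isRegularPath] with p hp
  refine measure_mono ?_
  rintro r ⟨hr, hrA⟩
  refine ⟨hr.1, ?_, hr.2, hrA⟩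
  obtain ⟨h0, hβ⟩ := hr
  lift r to ℝ≥0 using h0
  rw [Real.toNNReal_coe] at hrA
  rw [ENNReal.ofReal_coe_nnreal]
  have hrβ : r ≤ p.2 := hβ
  refine iInf₂_le r ⟨hrβ.trans hp.killing_le, ?_⟩
  rw [hp.costFrom_eq r hrβ]
  exact ht _ hrA

theorem mem_aggregate (hE : IsEquilibriumCapped γ T E) {t : ℝ≥0} {x : ℝ}
    (h : ∀ ε > 0, ∃ c d, c < d ∧ Ioo c d ⊆ Metric.ball x ε ∧ ∀ z ∈ Ioo c d,
      0 < flux E z ∧ travel E.L z < t) : x ∈ E.aggregate t := by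
  refine Or.inr fun ε hε => ?_
  obtain ⟨c, d, hcd, hsub, hz⟩ := h ε hε
  exact (hE.occupation_pos hcd (fun z hz' => (hz z hz').1) (fun z hz' => (hz z hz').2)).trans_le
    (occupation_mono t hsub)

theorem arrivalTime_of_nonpos {x : ℝ} (hx : x ≤ 0) : E.arrivalTime x = 0 := by
  refine le_antisymm ?_ zero_le
  exact iInf₂_le (0 : ℝ≥0) (Or.inl hx)

theorem travel_le_arrivalTime (hE : IsEquilibriumCapped γ T E) (x : ℝ) :
    travel E.L x ≤ E.arrivalTime x := by
  rcases le_or_gt x 0 with hx | hx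
  · rw [travel_of_nonpos E.L hx]
    exact zero_le
  refine le_iInf₂ fun t ht => ?_
  by_contra! h
  obtain ⟨z, -, hzx, hz⟩ := exists_lt_lintegral_Ioc h
  rcases ht with ht | ht
  · exact absurd ht (not_le.2 hx)
  · refine (ht (x - z) (by linarith)).ne' (hE.occupation_eq_zero_of_travel hz ?_)
    intro r hr
    rw [Metric.mem_ball, Real.dist_eq, abs_lt] at hr
    change z < r
    linarith [hr.1]

/-- The entry time asks for a remaining cost strictly below `t`, so each `t > s` is admissible
although `s` itself may not be; the infimum closes the gap. -/
theorem arrivalTime_le (hE : IsEquilibriumCapped γ T E) {x : ℝ} {s : ℝ≥0∞}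
    (h : ∀ ε > 0, ∃ c d, c < d ∧ Ioo c d ⊆ Metric.ball x ε ∧ ∀ z ∈ Ioo c d,
      0 < flux E z ∧ travel E.L z ≤ s) : E.arrivalTime x ≤ s := by
  by_contra! hlt
  obtain ⟨t, ht, ht'⟩ := ENNReal.lt_iff_exists_nnreal_btwn.1 hlt
  refine absurd (iInf₂_le t (hE.mem_aggregate fun ε hε => ?_)) (not_le.2 ht')
  obtain ⟨c, d, h1, h2, h3⟩ := h ε hε
  exact ⟨c, d, h1, h2, fun z hz => ⟨(h3 z hz).1, (h3 z hz).2.trans_lt ht⟩⟩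

section Interval

variable {b : ℝ}

theorem arrivalTime_eq_travel (hE : IsEquilibriumCapped γ T E)
    (hpos : ∀ x ∈ Ioc 0 b, 0 < flux E x) {x : ℝ} (hx : x ∈ Ioc 0 b) :
    E.arrivalTime x = travel E.L x := by
  refine le_antisymm (hE.arrivalTime_le fun ε hε => ?_) (hE.travel_le_arrivalTime x)
  -- The interval lies to the left of `x`: there the travel cost is at most that of `x`, and this
  -- choice also works at the endpoint `b`.
  refine ⟨max (x - ε) 0, x, max_lt (by linarith) hx.1, ?_, ?_⟩
  · intro z hz
    rw [Metric.mem_ball, Real.dist_eq, abs_lt]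
    have := (le_max_left _ _).trans_lt hz.1
    constructor <;> linarith [hz.2]
  · intro z hz
    exact ⟨hpos z ⟨(le_max_right _ _).trans_lt hz.1, hz.2.le.trans hx.2⟩, travel_mono _ hz.2.le⟩

theorem arrivalTime_eq_top (hE : IsEquilibriumCapped γ T E) (hb : 0 ≤ b)
    (hzero : ∀ x, b < x → flux E x = 0) {x : ℝ} (hx : b < x) : E.arrivalTime x = ⊤ := by
  refine iInf₂_eq_top.2 fun t ht => ?_
  exfalso
  rcases ht with ht | ht
  · exact absurd ht (not_le.2 (hb.trans_lt hx))
  · refine (ht (x - b) (by linarith)).ne' (hE.occupation_eq_zero_of_flux t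
      Metric.isOpen_ball.measurableSet fun z hz => hzero z ?_)
    rw [Metric.mem_ball, Real.dist_eq, abs_lt] at hz
    linarith [hz.1]

theorem invaded_eq (hE : IsEquilibriumCapped γ T E) (hb : 0 ≤ b)
    (hpos : ∀ x ∈ Ioc 0 b, 0 < flux E x) (hzero : ∀ x, b < x → flux E x = 0) :
    E.invaded = Ioc 0 b := by
  ext x
  rw [Triplet.invaded, isClosed_Iic.closure_eq]
  simp only [Set.mem_sdiff, mem_ofPred_eq, mem_Iic, not_le, mem_Ioc]
  constructor
  · rintro ⟨h1, h2⟩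
    refine ⟨h2, not_lt.1 fun h3 => ?_⟩
    rw [hE.arrivalTime_eq_top hb hzero h3] at h1
    exact lt_irrefl _ h1
  · rintro ⟨h1, h2⟩
    refine ⟨?_, h1⟩
    rw [hE.arrivalTime_eq_travel hpos ⟨h1, h2⟩]
    exact (hE.travel_le_of_flux_pos (hpos x ⟨h1, h2⟩)).trans_lt ENNReal.coe_lt_top

theorem travel_eq_lintegral_flux (hE : IsEquilibriumCapped γ T E)
    (hpos : ∀ x ∈ Ioc 0 b, 0 < flux E x) {x : ℝ} (hx : x ≤ b) :
    travel E.L x = ∫⁻ z in Ioc 0 x, 1 / ENNReal.ofReal (flux E z - γ) := by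
  refine setLIntegral_congr_fun_ae measurableSet_Ioc ?_
  filter_upwards [hE.ae_of_flux_pos] with z hz hzx
  exact (hz (hpos z ⟨hzx.1, hzx.2.trans hx⟩)).2

theorem monotone_arrivalTime (hE : IsEquilibriumCapped γ T E) (hb : 0 ≤ b)
    (hpos : ∀ x ∈ Ioc 0 b, 0 < flux E x) (hzero : ∀ x, b < x → flux E x = 0) :
    Monotone E.arrivalTime := by
  intro x z hxz
  rcases le_or_gt x 0 with hx | hx
  · rw [arrivalTime_of_nonpos hx]
    exact zero_le
  rcases le_or_gt z b with hz | hz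
  · rw [hE.arrivalTime_eq_travel hpos ⟨hx, hxz.trans hz⟩,
      hE.arrivalTime_eq_travel hpos ⟨hx.trans_le hxz, hz⟩]
    exact travel_mono _ hxz
  · rw [hE.arrivalTime_eq_top hb hzero hz]
    exact le_top

end Interval

end IsEquilibriumCapped

/-! ### Jumps of the flux and the shape of the invaded region. -/

theorem locallyIntegrable_of_bounded (hu : AEMeasurable u) (hb : ∃ C : ℝ, ∀ x, |u x| ≤ C) :
    LocallyIntegrable u := by
  obtain ⟨C, hC⟩ := hb
  have h := (locallyIntegrable_const (C : ℝ) : LocallyIntegrable (fun _ : ℝ => C) volume)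
  exact h.mono hu.aestronglyMeasurable (ae_of_all _ fun x => by
    rw [Real.norm_eq_abs, Real.norm_eq_abs]
    exact (hC x).trans (le_abs_self C))

theorem flux_eq_sub [IsProbabilityMeasure E.Q] (h : ∀ᵐ p ∂E.Q, p.1 p.2 ≤ p.1 0) (x : ℝ) :
    flux E x = E.κ * E.Q.real {p | x ≤ p.1 0} - E.κ * E.Q.real {p | x ≤ p.1 p.2} := by
  have h' : E.Q.real {p | x ≤ p.1 0} = E.Q.real {p | p.1 p.2 < x ∧ x ≤ p.1 0}
      + E.Q.real {p | x ≤ p.1 p.2} := by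
    have hm : MeasurableSet {p : HalfLinePath × ℝ≥0 | x ≤ p.1 p.2} :=
      measurableSet_le measurable_const measurable_end
    have hd : Disjoint {p : HalfLinePath × ℝ≥0 | p.1 p.2 < x ∧ x ≤ p.1 0} {p | x ≤ p.1 p.2} :=
      Set.disjoint_left.2 fun p h1 h2 => absurd h1.1 (not_lt.2 h2)
    rw [← measureReal_union hd hm]
    refine measureReal_congr ?_
    filter_upwards [h] with p hp
    refine propext ⟨fun h1 => ?_, ?_⟩
    · rcases lt_or_ge (p.1 p.2) x with h2 | h2
      · exact Or.inl ⟨h2, h1⟩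
      · exact Or.inr h2
    · rintro (h1 | h1)
      · exact h1.2
      · exact le_trans h1 hp
  rw [flux, h']
  ring

namespace IsEquilibriumCapped

/-- For each particle the condition `y_β < x ≤ y_0` is eventually constant as `x` increases to `a`,
so continuity of the finite measure applies. -/
theorem tendsto_flux_left (hE : IsEquilibriumCapped γ T E) (a : ℝ) :
    Tendsto (flux E) (𝓝[≤] a) (𝓝 (flux E a)) := by
  have := hE.isProbabilityMeasure
  refine Tendsto.const_mul _ ((ENNReal.tendsto_toReal (measure_ne_top _ _)).comp ?_)
  refine tendsto_measure_of_tendsto_indicator_of_isFiniteMeasure _ E.Q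
    measurableSet_crossing_left fun p => ?_
  by_cases h : p.1 p.2 < a
  · by_cases h' : a ≤ p.1 0
    · filter_upwards [self_mem_nhdsWithin, nhdsWithin_le_nhds (lt_mem_nhds h)] with z hz hz'
      exact ⟨fun _ => ⟨h, h'⟩, fun _ => ⟨hz', le_trans hz h'⟩⟩
    · filter_upwards [nhdsWithin_le_nhds (lt_mem_nhds (not_le.1 h'))] with z hz
      exact ⟨fun hp => absurd hp.2 (not_le.2 hz), fun hp => absurd hp.2 h'⟩
  · filter_upwards [self_mem_nhdsWithin] with z hz
    exact ⟨fun hp => absurd (hp.1.trans_le hz) h, fun hp => absurd hp.1 h⟩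

theorem tendsto_flux_right (hE : IsEquilibriumCapped γ T E) (a : ℝ) :
    Tendsto (flux E) (𝓝[>] a) (𝓝 (fluxRight E a)) := by
  have := hE.isProbabilityMeasure
  refine Tendsto.const_mul _ ((ENNReal.tendsto_toReal (measure_ne_top _ _)).comp ?_)
  refine tendsto_measure_of_tendsto_indicator_of_isFiniteMeasure _ E.Q
    measurableSet_crossing_left fun p => ?_
  by_cases h' : a < p.1 0
  · by_cases h : p.1 p.2 ≤ a
    · filter_upwards [self_mem_nhdsWithin, nhdsWithin_le_nhds (gt_mem_nhds h')] with z hz hz'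
      exact ⟨fun _ => ⟨h, h'⟩, fun _ => ⟨lt_of_le_of_lt h hz, le_of_lt hz'⟩⟩
    · filter_upwards [nhdsWithin_le_nhds (gt_mem_nhds (not_le.1 h))] with z hz
      exact ⟨fun hp => absurd hp.1 (not_lt.2 (le_of_lt hz)), fun hp => absurd hp.1 h⟩
  · filter_upwards [self_mem_nhdsWithin] with z hz
    exact ⟨fun hp => absurd (lt_of_lt_of_le hz hp.2) h', fun hp => absurd hp.2 h'⟩

theorem exists_flux_gt (hE : IsEquilibriumCapped γ T E) {c d : ℝ} (hcd : c < d)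
    (h : ∀ x ∈ Ioo c d, 0 < flux E x) : ∃ x ∈ Ioo c d, γ < flux E x := by
  by_contra! hcon
  have h0 : volume (Ioo c d) = 0 := by
    rw [measure_eq_zero_iff_ae_notMem]
    filter_upwards [hE.ae_of_flux_pos] with x hx hmem
    exact absurd (hx (h x hmem)).1 (not_lt.2 (hcon x hmem))
  simp at h0
  linarith

/-- Positive flux exceeds `γ` almost everywhere, hence at points arbitrarily close to `a` on the
left, and left continuity passes the bound to `a`. -/
theorem le_flux (hE : IsEquilibriumCapped γ T E) {c a : ℝ} (hca : c < a)
    (h : ∀ x ∈ Ioo c a, 0 < flux E x) : γ ≤ flux E a := by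
  refine ge_of_tendsto_of_frequently (hE.tendsto_flux_left a) ?_
  intro hev
  obtain ⟨l, hl, hsub⟩ := (mem_nhdsLE_iff_exists_Ioc_subset' hca).1 hev
  obtain ⟨x, hx, hγ⟩ := hE.exists_flux_gt (c := max l c) (max_lt hl hca) fun x hx =>
    h x ⟨(le_max_right _ _).trans_lt hx.1, hx.2⟩
  exact hsub ⟨(le_max_left _ _).trans_lt hx.1, hx.2.le⟩ hγ.le

theorem le_fluxRight (hE : IsEquilibriumCapped γ T E) {a d : ℝ} (had : a < d)
    (h : ∀ x ∈ Ioo a d, 0 < flux E x) : γ ≤ fluxRight E a := by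
  refine ge_of_tendsto_of_frequently (hE.tendsto_flux_right a) ?_
  intro hev
  obtain ⟨l, hl, hsub⟩ := (mem_nhdsGT_iff_exists_Ioo_subset' had).1 hev
  obtain ⟨x, hx, hγ⟩ := hE.exists_flux_gt (d := min l d) (lt_min hl had) fun x hx =>
    h x ⟨hx.1, hx.2.trans_le (min_le_right _ _)⟩
  exact hsub ⟨hx.1, hx.2.trans_le (min_le_left _ _)⟩ hγ.le

theorem ae_end_le (hE : IsEquilibriumCapped γ T E) : ∀ᵐ p ∂E.Q, p.1 p.2 ≤ p.1 0 := by
  filter_upwards [hE.ae_isRegularPath] with p hp using hp.end_le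

theorem fluxRight_eq_sub (hE : IsEquilibriumCapped γ T E) (x : ℝ) :
    fluxRight E x = E.κ * E.Q.real {p | x < p.1 0} - E.κ * E.Q.real {p | x < p.1 p.2} := by
  have := hE.isProbabilityMeasure
  have h : E.Q.real {p | x < p.1 0} = E.Q.real {p | p.1 p.2 ≤ x ∧ x < p.1 0}
      + E.Q.real {p | x < p.1 p.2} := by
    have hm : MeasurableSet {p : HalfLinePath × ℝ≥0 | x < p.1 p.2} :=
      measurableSet_lt measurable_const measurable_end
    have hd : Disjoint {p : HalfLinePath × ℝ≥0 | p.1 p.2 ≤ x ∧ x < p.1 0} {p | x < p.1 p.2} :=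
      Set.disjoint_left.2 fun p h1 h2 => absurd h1.1 (not_le.2 h2)
    rw [← measureReal_union hd hm]
    refine measureReal_congr ?_
    filter_upwards [hE.ae_isRegularPath] with p hp
    refine propext ⟨fun h1 => ?_, ?_⟩
    · rcases le_or_gt (p.1 p.2) x with h2 | h2
      · exact Or.inl ⟨h2, h1⟩
      · exact Or.inr h2
    · rintro (h1 | h1)
      · exact h1.2
      · exact lt_of_lt_of_le h1 hp.end_le
  rw [fluxRight, h]
  ring

/-- A single point has no Lebesgue mass and particles starting at `a > 0` have `θ > 0`; what is left
of the excess of `{a}` is the mass started minus the mass killed there. -/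
theorem flux_eq_fluxRight_add (hE : IsEquilibriumCapped γ T E) {a : ℝ} (ha : 0 < a)
    (hinv : a ∈ E.invaded) : flux E a = fluxRight E a + E.excess u {a} := by
  have := hE.isProbabilityMeasure
  have h1 : ({a} : Set ℝ) ∩ E.invaded = {a} := by simpa using hinv
  have h2 : {p : HalfLinePath × ℝ≥0 | p.1 0 ∈ ({a} : Set ℝ) ∧ p.1.θ = 0} = ∅ := by
    ext p
    simp only [mem_singleton_iff, mem_ofPred_eq, mem_empty_iff_false, iff_false]
    rintro ⟨h, hθ⟩
    have := (θ_eq_zero_iff p.1).1 hθ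
    linarith
  have h3 : ∀ f : HalfLinePath × ℝ≥0 → ℝ, Measurable f →
      E.Q.real {p | a ≤ f p} = E.Q.real {p | f p ∈ ({a} : Set ℝ)} + E.Q.real {p | a < f p} := by
    intro f hf
    rw [← measureReal_union (Set.disjoint_left.2 fun p h1 h2 => by
      rw [mem_ofPred_eq, mem_singleton_iff] at h1
      exact absurd h2 (by simp [h1])) (measurableSet_lt measurable_const hf)]
    congr 1
    ext p
    simp [le_iff_eq_or_lt, eq_comm]
  rw [flux_eq_sub hE.ae_end_le, hE.fluxRight_eq_sub, h3 _ measurable_start, h3 _ measurable_end,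
    Triplet.excess, h1, h2]
  simp
  ring

/-- Otherwise let `a` be the last zero of the flux in `[z, x]`, a zero by left continuity. To the
right of `a` the flux is positive, so its right limit is at least `γ`, and the upward jump is an
excess of at most `-γ` at `a`. -/
theorem flux_pos_of_le (hE : IsEquilibriumCapped γ T E) (hγ : 0 < γ) (hex : E.ExcessNonneg u)
    {x z : ℝ} (hx : 0 < flux E x) (hz : 0 < z) (hzx : z ≤ x) : 0 < flux E z := by
  by_contra! h0
  obtain ⟨S, hS⟩ : ∃ S : Set ℝ, S = {r | r ∈ Icc z x ∧ flux E r ≤ 0} := ⟨_, rfl⟩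
  have hzS : z ∈ S := hS ▸ ⟨⟨le_rfl, hzx⟩, h0⟩
  have hbdd : BddAbove S := ⟨x, fun r hr => by rw [hS] at hr; exact hr.1.2⟩
  obtain ⟨a, ha⟩ : ∃ a, a = sSup S := ⟨_, rfl⟩
  have hza : z ≤ a := ha ▸ le_csSup hbdd hzS
  have hax : a ≤ x := ha ▸ csSup_le ⟨z, hzS⟩ fun r hr => by rw [hS] at hr; exact hr.1.2
  have hfa : flux E a ≤ 0 := by
    refine le_of_tendsto_of_frequently (hE.tendsto_flux_left a) ?_
    intro hev
    have hlub : IsLUB S a := ha ▸ isLUB_csSup ⟨z, hzS⟩ hbdd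
    have hfreq : ∃ᶠ r in 𝓝[≤] a, r ∈ S := hlub.frequently_mem ⟨z, hzS⟩
    obtain ⟨r, hr, hr'⟩ := (hfreq.and_eventually hev).exists
    rw [hS] at hr
    exact hr' hr.2
  have hax' : a < x := lt_of_le_of_ne hax fun h => by rw [h] at hfa; linarith
  have hpos : ∀ r ∈ Ioo a x, 0 < flux E r := by
    intro r hr
    by_contra! h1
    have : r ≤ a := ha ▸ le_csSup hbdd (hS ▸ ⟨⟨hza.trans hr.1.le, hr.2.le⟩, h1⟩)
    exact absurd this (not_le.2 hr.1)
  have ha0 : 0 < a := hz.trans_le hza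
  have hinv : a ∈ E.invaded := by
    refine ⟨?_, by simpa [isClosed_Iic.closure_eq] using ha0⟩
    refine lt_of_le_of_lt (hE.arrivalTime_le (s := T) fun ε hε => ?_) ENNReal.coe_lt_top
    refine ⟨a, min x (a + ε), lt_min hax' (by linarith), ?_, fun r hr => ?_⟩
    · intro r hr
      rw [Metric.mem_ball, Real.dist_eq, abs_lt]
      have := hr.2.trans_le (min_le_right _ _)
      constructor <;> linarith [hr.1]
    · have h1 := hpos r ⟨hr.1, hr.2.trans_le (min_le_left _ _)⟩
      exact ⟨h1, hE.travel_le_of_flux_pos h1⟩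
  have h1 := hE.flux_eq_fluxRight_add (u := u) ha0 hinv
  have h2 := hex {a} (measurableSet_singleton a)
  have h3 := hE.le_fluxRight hax' hpos
  linarith

/-- The front speed `F - γ` is at most `κ`, while the travel time is capped by `T`. -/
theorem le_of_flux_pos (hE : IsEquilibriumCapped γ T E) (hγ : 0 < γ) (hex : E.ExcessNonneg u)
    {x : ℝ} (hx : 0 < flux E x) : x ≤ E.κ * T := by
  have hpos : ∀ z ∈ Ioc 0 x, 0 < flux E z := fun z hz => hE.flux_pos_of_le hγ hex hx hz.1 hz.2
  have h1 := hE.travel_le_of_flux_pos hx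
  have h2 : ENNReal.ofReal (1 / E.κ) * ENNReal.ofReal x ≤ travel E.L x := by
    have : ∫⁻ _ in Ioc 0 x, ENNReal.ofReal (1 / E.κ) ≤ travel E.L x := by
      refine setLIntegral_mono_ae' measurableSet_Ioc ?_
      filter_upwards [hE.ae_of_flux_pos] with z hz hzx
      obtain ⟨h3, h4⟩ := hz (hpos z hzx)
      rw [h4, ENNReal.ofReal_div_of_pos hE.κ_pos, ENNReal.ofReal_one]
      refine ENNReal.div_le_div_left (ENNReal.ofReal_le_ofReal ?_) 1
      linarith [hE.flux_le z]
    simpa using this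
  have h3 := h2.trans h1
  rw [← ENNReal.ofReal_mul (by have := hE.κ_pos; positivity), ← ENNReal.ofReal_coe_nnreal,
    ENNReal.ofReal_le_ofReal_iff T.coe_nonneg, one_div, inv_mul_le_iff₀ hE.κ_pos] at h3
  exact h3

/-- The set of positive flux in `(0,∞)` is bounded and closed under moving left. It contains its
supremum because the flux there is at least `γ`, not merely non-negative. -/
theorem exists_front (hE : IsEquilibriumCapped γ T E) (hγ : 0 < γ) (hex : E.ExcessNonneg u) :
    ∃ b, 0 ≤ b ∧ (∀ x ∈ Ioc 0 b, 0 < flux E x) ∧ ∀ x, b < x → flux E x = 0 := by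
  obtain ⟨S, hS⟩ : ∃ S : Set ℝ, S = {x | 0 < x ∧ 0 < flux E x} := ⟨_, rfl⟩
  have hnp : ∀ x, 0 < x → x ∉ S → flux E x = 0 := fun x hx h => by
    refine le_antisymm (not_lt.1 fun h1 => h ?_) (hE.flux_nonneg x)
    rw [hS]
    exact ⟨hx, h1⟩
  rcases S.eq_empty_or_nonempty with h | hne
  · exact ⟨0, le_rfl, fun x hx => absurd hx.1 (not_lt.2 hx.2),
      fun x hx => hnp x hx (by simp [h])⟩
  have hbdd : BddAbove S := ⟨E.κ * T, fun x hx => by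
    rw [hS] at hx
    exact hE.le_of_flux_pos hγ hex hx.2⟩
  have hlt : ∀ x ∈ Ioo 0 (sSup S), 0 < flux E x := by
    intro x hx
    obtain ⟨z, hz, hxz⟩ := exists_lt_of_lt_csSup hne hx.2
    rw [hS] at hz
    exact hE.flux_pos_of_le hγ hex hz.2 hx.1 hxz.le
  have hb0 : 0 < sSup S := by
    obtain ⟨z, hz⟩ := hne
    have hz' := hz
    rw [hS] at hz'
    exact hz'.1.trans_le (le_csSup hbdd hz)
  refine ⟨sSup S, hb0.le, fun x hx => ?_, fun x hx => hnp x (hb0.trans hx) fun h =>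
    absurd (le_csSup hbdd h) (not_le.2 hx)⟩
  rcases hx.2.lt_or_eq with h | h
  · exact hlt x ⟨hx.1, h⟩
  · rw [h]
    exact hγ.trans_le (hE.le_flux hb0 hlt)

section Front

variable {b : ℝ}

/-- At `b` the flux falls from at least `γ` to zero, and the whole drop is excess. This price for
stopping makes the upper bound on arrival times possible. -/
theorem le_excess_singleton_front (hE : IsEquilibriumCapped γ T E) (hb : 0 < b)
    (hpos : ∀ x ∈ Ioc 0 b, 0 < flux E x) (hzero : ∀ x, b < x → flux E x = 0) :
    γ ≤ E.excess u {b} := by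
  have h0 : fluxRight E b = 0 := by
    refine tendsto_nhds_unique (hE.tendsto_flux_right b) ?_
    refine tendsto_const_nhds.congr' ?_
    filter_upwards [self_mem_nhdsWithin] with x hx
    exact (hzero x hx).symm
  have h1 := hE.flux_eq_fluxRight_add (u := u) hb
    (by rw [hE.invaded_eq hb.le hpos hzero]; exact ⟨hb, le_rfl⟩)
  have h2 := hE.le_flux hb fun x hx => hpos x ⟨hx.1, hx.2.le⟩
  linarith

end Front

end IsEquilibriumCapped

/-! ### Additivity of the excess and the balance law for the flux. -/

theorem excess_union [IsFiniteMeasure E.Q] (hu : LocallyIntegrable u) {b : ℝ}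
    (hinv : E.invaded = Ioc 0 b) {A B : Set ℝ} (hB : MeasurableSet B) (hAB : Disjoint A B) :
    E.excess u (A ∪ B) = E.excess u A + E.excess u B := by
  have hBi : MeasurableSet (B ∩ Ioc 0 b) := hB.inter measurableSet_Ioc
  have hint : ∀ C : Set ℝ, IntegrableOn (fun x => 1 + u x) (C ∩ Ioc 0 b) := fun C =>
    ((((locallyIntegrable_const 1).add hu).integrableOn_isCompact
      (isCompact_Icc (a := 0) (b := b))).mono_set (inter_subset_right.trans Ioc_subset_Icc_self))
  have h1 : E.Q.real {p | p.1 0 ∈ A ∪ B ∧ p.1.θ = 0}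
      = E.Q.real {p | p.1 0 ∈ A ∧ p.1.θ = 0} + E.Q.real {p | p.1 0 ∈ B ∧ p.1.θ = 0} := by
    have hm : MeasurableSet {p : HalfLinePath × ℝ≥0 | p.1 0 ∈ B ∧ p.1.θ = 0} :=
      (measurable_start hB).inter ((measurable_θ.comp measurable_fst) (measurableSet_singleton 0))
    have hd : Disjoint {p : HalfLinePath × ℝ≥0 | p.1 0 ∈ A ∧ p.1.θ = 0}
        {p | p.1 0 ∈ B ∧ p.1.θ = 0} :=
      Set.disjoint_left.2 fun p h1 h2 => Set.disjoint_left.1 hAB h1.1 h2.1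
    rw [← measureReal_union hd hm]
    congr 1
    ext p
    simp only [mem_union, mem_ofPred_eq]
    tauto
  have h2 : ∀ f : HalfLinePath × ℝ≥0 → ℝ, Measurable f →
      E.Q.real {p | f p ∈ A ∩ Ioc 0 b ∪ B ∩ Ioc 0 b}
        = E.Q.real {p | f p ∈ A ∩ Ioc 0 b} + E.Q.real {p | f p ∈ B ∩ Ioc 0 b} := fun f hf =>
    measureReal_union (Set.disjoint_left.2 fun p h1 h2 => Set.disjoint_left.1 hAB h1.1 h2.1)
      (hf hBi)
  rw [Triplet.excess, Triplet.excess, Triplet.excess, hinv, union_inter_distrib_right, h1,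
    h2 _ measurable_start, h2 _ measurable_end,
    setIntegral_union (hAB.mono inter_subset_left inter_subset_left) hBi (hint A) (hint B)]
  ring

theorem excess_mono [IsFiniteMeasure E.Q] (hu : LocallyIntegrable u) {b : ℝ}
    (hinv : E.invaded = Ioc 0 b) (hex : E.ExcessNonneg u) {A B : Set ℝ} (hA : MeasurableSet A)
    (hB : MeasurableSet B) (hAB : A ⊆ B) : E.excess u A ≤ E.excess u B := by
  have h := excess_union hu hinv (A := A) (hB.diff hA) disjoint_sdiff_right
  rw [union_sdiff_cancel hAB] at h
  linarith [hex _ (hB.diff hA)]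

theorem excess_Iic_zero : E.excess u (Iic 0) = E.κ * E.Q.real {p | p.1 0 ≤ 0} := by
  have h1 : Iic 0 ∩ E.invaded = ∅ := by
    ext x
    simp only [Triplet.invaded, isClosed_Iic.closure_eq, mem_inter_iff, mem_empty_iff_false,
      iff_false]
    exact fun h => h.2.2 h.1
  have h2 : {p : HalfLinePath × ℝ≥0 | p.1 0 ∈ Iic (0 : ℝ) ∧ p.1.θ = 0} = {p | p.1 0 ≤ 0} := by
    ext p
    simp [θ_eq_zero_iff]
  rw [Triplet.excess, h1, h2]
  simp

namespace IsEquilibriumCapped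

theorem real_killing_eq (hE : IsEquilibriumCapped γ T E) :
    E.Q.real {p | p.2 = p.1.θ} = E.Q.real {p | p.1 p.2 ≤ 0} := by
  refine measureReal_congr ?_
  filter_upwards [hE.ae_isRegularPath] with p hp
  refine propext ⟨fun h => ?_, fun h => ?_⟩
  · have h : p.2 = p.1.θ := h
    change p.1 p.2 ≤ 0
    rw [h]
    exact apply_θ_nonpos _
  · by_contra hne
    exact absurd (pos_of_lt_θ p.1 (lt_of_le_of_ne hp.killing_le hne)) (not_lt.2 h)

theorem fluxRight_zero (hE : IsEquilibriumCapped γ T E) :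
    fluxRight E 0 = E.κ * E.Q.real {p | p.2 = p.1.θ} - E.excess u (Iic 0) := by
  have := hE.isProbabilityMeasure
  have h : ∀ f : HalfLinePath × ℝ≥0 → ℝ, Measurable f →
      E.Q.real {p | 0 < f p} = 1 - E.Q.real {p | f p ≤ 0} := fun f hf => by
    rw [← probReal_compl_eq_one_sub (measurableSet_le hf measurable_const)]
    congr 1
    ext p
    simp
  rw [hE.fluxRight_eq_sub, h _ measurable_start, h _ measurable_end, hE.real_killing_eq,
    excess_Iic_zero]
  ring

/-- Conservation of particles: those crossing `x` either reach `Γ` or are killed in `(0, x)`,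
corrected for those started to the left of `x`. The excess is by definition the resulting balance
apart from the `1 + u` term. -/
theorem flux_eq (hE : IsEquilibriumCapped γ T E) {b : ℝ}
    (hinv : E.invaded = Ioc 0 b) {x : ℝ} (hx : x ∈ Ioc 0 b) :
    flux E x = E.κ * E.Q.real {p | p.2 = p.1.θ} - E.excess u (Iio x)
      - ∫ z in (0 : ℝ)..x, (u z + 1) := by
  have := hE.isProbabilityMeasure
  have h1 : {p : HalfLinePath × ℝ≥0 | p.1 0 ∈ Iio x ∧ p.1.θ = 0} = {p | p.1 0 ≤ 0} := by
    ext p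
    simp only [θ_eq_zero_iff, mem_Iio, mem_ofPred_eq]
    exact ⟨fun h => h.2, fun h => ⟨h.trans_lt hx.1, h⟩⟩
  have h2 : Iio x ∩ Ioc 0 b = Ioo 0 x := by
    ext z
    simp only [mem_inter_iff, mem_Iio, mem_Ioc, mem_Ioo]
    exact ⟨fun h => ⟨h.2.1, h.1⟩, fun h => ⟨h.2, h.1, h.2.le.trans hx.2⟩⟩
  have h3 : ∀ f : HalfLinePath × ℝ≥0 → ℝ, Measurable f →
      E.Q.real {p | f p ∈ Ioo 0 x} = 1 - E.Q.real {p | f p ≤ 0} - E.Q.real {p | x ≤ f p} := by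
    intro f hf
    have hle := measurableSet_le hf (measurable_const (a := (0 : ℝ)))
    have hge := measurableSet_le (measurable_const (a := x)) hf
    have hd : Disjoint {p | f p ≤ 0} {p | x ≤ f p} := Set.disjoint_left.2 fun p h h' =>
      absurd (hx.1.trans_le (le_trans h' h)) (lt_irrefl _)
    have h4 := measureReal_union hd hge (μ := E.Q)
    rw [sub_sub, ← h4, ← probReal_compl_eq_one_sub (hle.union hge)]
    congr 1
    ext p
    simp
  rw [flux_eq_sub hE.ae_end_le, hE.real_killing_eq, Triplet.excess, h1, hinv, h2, h3 _ measurable_start,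
    h3 _ measurable_end, intervalIntegral.integral_of_le hx.1.le, ← setIntegral_congr_set Ioo_ae_eq_Ioc]
  simp_rw [add_comm (1 : ℝ)]
  ring

end IsEquilibriumCapped

/-! ### Analysis of the explicit front time. -/

/-- The time `∫_0^x dz / (v - ∫_0^z (u(r) + 1) dr)` at which a front with initial velocity `v` and
without excess energy loss reaches `x`. -/
def frontTime (u : ℝ → ℝ) (v x : ℝ) : ℝ≥0∞ :=
  ∫⁻ z in Ioc 0 x, 1 / ENNReal.ofReal (v - ∫ r in (0 : ℝ)..z, (u r + 1))

theorem frontTime_of_nonpos (u : ℝ → ℝ) (v : ℝ) {x : ℝ} (hx : x ≤ 0) : frontTime u v x = 0 := by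
  simp [frontTime, Ioc_eq_empty (not_lt.2 hx)]

theorem frontTime_mono (u : ℝ → ℝ) (v : ℝ) : Monotone (frontTime u v) := fun _ _ h =>
  lintegral_mono_set (Ioc_subset_Ioc_right h)

theorem intervalIntegrable_of_locallyIntegrable {f : ℝ → ℝ} (hf : LocallyIntegrable f) (a b : ℝ) :
    IntervalIntegrable f volume a b :=
  (intervalIntegrable_iff').2 (hf.integrableOn_isCompact isCompact_uIcc)

theorem continuous_velocity (hu : LocallyIntegrable u) (v : ℝ) :
    Continuous fun z => v - ∫ r in (0 : ℝ)..z, (u r + 1) := by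
  refine continuous_const.sub (intervalIntegral.continuous_primitive (fun a b => ?_) 0)
  exact intervalIntegrable_of_locallyIntegrable (hu.add (locallyIntegrable_const 1)) a b

theorem measurable_inv_velocity (hu : LocallyIntegrable u) (v : ℝ) :
    Measurable fun z => 1 / ENNReal.ofReal (v - ∫ r in (0 : ℝ)..z, (u r + 1)) :=
  measurable_const.div (continuous_velocity hu v).measurable.ennreal_ofReal

theorem velocity_le_add (hu : LocallyIntegrable u) {C : ℝ} (hC : ∀ x, |u x| ≤ C) (v a z : ℝ) :
    v - ∫ r in (0 : ℝ)..z, (u r + 1)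
      ≤ (v - ∫ r in (0 : ℝ)..a, (u r + 1)) + (C + 1) * |z - a| := by
  have hi : ∀ a b, IntervalIntegrable (fun r => u r + 1) volume a b := fun a b =>
    intervalIntegrable_of_locallyIntegrable (hu.add (locallyIntegrable_const 1)) a b
  have h1 := intervalIntegral.integral_add_adjacent_intervals (hi 0 a) (hi a z)
  have h2 : ‖∫ r in a..z, (u r + 1)‖ ≤ (C + 1) * |z - a| :=
    intervalIntegral.norm_integral_le_of_norm_le_const fun r _ => by
      rw [Real.norm_eq_abs]
      exact (abs_add_le _ _).trans (by rw [abs_one]; linarith [hC r])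
  rw [Real.norm_eq_abs] at h2
  linarith [neg_abs_le (∫ r in a..z, (u r + 1))]

/-- The velocity is Lipschitz with constant `C + 1`, so it is at most `(C + 1) |z - a|`, and `1 / |z
- a|` is not integrable on an interval containing `a`. -/
theorem frontTime_eq_top (hu : LocallyIntegrable u) (hb : ∃ C : ℝ, ∀ x, |u x| ≤ C) {v x a : ℝ}
    (hx : 0 < x) (ha : a ∈ Icc 0 x) (hva : v - ∫ r in (0 : ℝ)..a, (u r + 1) ≤ 0) :
    frontTime u v x = ⊤ := by
  obtain ⟨C, hC⟩ := hb
  have hC0 : 0 < C + 1 := by linarith [abs_nonneg (u 0), hC 0]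
  by_contra hfin
  have hle : ∀ z, ‖(z - a)⁻¹‖ₑ ≤ ENNReal.ofReal (C + 1) *
      (1 / ENNReal.ofReal (v - ∫ r in (0 : ℝ)..z, (u r + 1))) := by
    intro z
    -- At `z = a` the real inverse is zero by convention and the bound is trivial.
    rcases eq_or_ne z a with h | h
    · simp [h]
    have hpos : 0 < |z - a| := abs_pos.2 (sub_ne_zero.2 h)
    have h1 : ENNReal.ofReal (v - ∫ r in (0 : ℝ)..z, (u r + 1))
        ≤ ENNReal.ofReal (C + 1) * ENNReal.ofReal |z - a| := by
      rw [← ENNReal.ofReal_mul hC0.le]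
      exact ENNReal.ofReal_le_ofReal (by linarith [velocity_le_add hu hC v a z])
    have h2 : ‖(z - a)⁻¹‖ₑ = (ENNReal.ofReal |z - a|)⁻¹ := by
      rw [← ofReal_norm, norm_inv, Real.norm_eq_abs, ENNReal.ofReal_inv_of_pos hpos]
    have hc0 : ENNReal.ofReal (C + 1) ≠ 0 := by simpa using hC0
    have hct : ENNReal.ofReal (C + 1) ≠ ⊤ := ENNReal.ofReal_ne_top
    calc ‖(z - a)⁻¹‖ₑ = ENNReal.ofReal (C + 1) *
          (1 / (ENNReal.ofReal (C + 1) * ENNReal.ofReal |z - a|)) := by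
          rw [h2, one_div, ENNReal.mul_inv (Or.inl hc0) (Or.inl hct), ← mul_assoc,
            ENNReal.mul_inv_cancel hc0 hct, one_mul]
      _ ≤ _ := by gcongr
  have hint : IntervalIntegrable (fun z => (z - a)⁻¹) volume 0 x := by
    rw [intervalIntegrable_iff_integrableOn_Ioc_of_le hx.le]
    refine ⟨(measurable_id.sub_const a).inv.aestronglyMeasurable, ?_⟩
    refine (lintegral_mono hle).trans_lt ?_
    rw [lintegral_const_mul _ (measurable_inv_velocity hu v)]
    exact ENNReal.mul_lt_top ENNReal.ofReal_lt_top (Ne.lt_top hfin)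
  rw [intervalIntegrable_sub_inv_iff, uIcc_of_le hx.le] at hint
  rcases hint with h | h
  · exact hx.ne h
  · exact h ha

/-- To the right of `x*` the integral is infinite anyway, since the velocity has become negative on
the way; the case distinction in the formula is thus redundant. -/
theorem explicitArrivalTime_eq (hu : LocallyIntegrable u) (hb : ∃ C : ℝ, ∀ x, |u x| ≤ C)
    (v x : ℝ) : explicitArrivalTime u v x = frontTime u v x := by
  rw [explicitArrivalTime]
  split_ifs with h1 h2
  · rw [frontTime_of_nonpos u v h1]
  · rfl
  · rw [not_le] at h1 h2
    rw [stoppingPoint] at h2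
    simp only [iInf_lt_iff] at h2
    obtain ⟨a, ⟨ha, hva⟩, hax⟩ := h2
    rw [ENNReal.ofReal_lt_ofReal_iff h1] at hax
    exact (frontTime_eq_top hu hb h1 ⟨ha.le, hax.le⟩ (by linarith)).symm

/-- The velocity grows at most linearly, so its reciprocal dominates a multiple of `1 / z` at
infinity. -/
theorem not_bddAbove_frontTime (hu : LocallyIntegrable u) (hb : ∃ C : ℝ, ∀ x, |u x| ≤ C)
    {v : ℝ} (hv : 0 < v) (hpos : ∀ z, 0 ≤ z → 0 < v - ∫ r in (0 : ℝ)..z, (u r + 1)) (N : ℝ≥0) :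
    ∃ b, 0 < b ∧ N < frontTime u v b := by
  by_contra! hcon
  obtain ⟨C, hC⟩ := hb
  have hC0 : 0 < C + 1 := by linarith [abs_nonneg (u 0), hC 0]
  have hU : Ioi (0 : ℝ) = ⋃ n : ℕ, Ioc (0 : ℝ) (n + 1) := by
    ext z
    simp only [mem_Ioi, mem_iUnion, mem_Ioc]
    constructor
    · intro h
      obtain ⟨n, hn⟩ := exists_nat_ge z
      exact ⟨n, h, by linarith⟩
    · rintro ⟨n, h, -⟩
      exact h
  have h1 : ∫⁻ z in Ioi 0, 1 / ENNReal.ofReal (v - ∫ r in (0 : ℝ)..z, (u r + 1)) ≤ N := by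
    rw [hU, setLIntegral_iUnion_of_directed]
    · exact iSup_le fun n => hcon _ (by positivity)
    · refine Monotone.directed_le fun m n hmn => Ioc_subset_Ioc_right ?_
      have : (m : ℝ) ≤ n := by exact_mod_cast hmn
      linarith
  refine not_integrableOn_Ioi_inv (a := (1 : ℝ)) ⟨measurable_inv.aestronglyMeasurable, ?_⟩
  have hle : ∀ z ∈ Ioi (1 : ℝ), ‖z⁻¹‖ₑ ≤ ENNReal.ofReal (v + C + 1) *
      (1 / ENNReal.ofReal (v - ∫ r in (0 : ℝ)..z, (u r + 1))) := by
    intro z hz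
    have hz1 : 1 < z := hz
    have hz0 : 0 < z := by linarith
    have hvz := hpos z hz0.le
    have h2 := velocity_le_add hu hC v 0 z
    rw [intervalIntegral.integral_same, sub_zero, sub_zero, abs_of_pos hz0] at h2
    rw [← ofReal_norm, norm_inv, Real.norm_eq_abs, abs_of_pos hz0, ← ENNReal.ofReal_one,
      ← ENNReal.ofReal_div_of_pos hvz, ← ENNReal.ofReal_mul (by linarith)]
    refine ENNReal.ofReal_le_ofReal ?_
    rw [mul_one_div, inv_eq_one_div, div_le_div_iff₀ hz0 hvz]
    nlinarith
  refine (setLIntegral_mono' measurableSet_Ioi hle).trans_lt ?_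
  rw [lintegral_const_mul _ (measurable_inv_velocity hu v)]
  refine ENNReal.mul_lt_top ENNReal.ofReal_lt_top ?_
  exact ((lintegral_mono_set (Ioi_subset_Ioi zero_le_one)).trans h1).trans_lt ENNReal.coe_lt_top

/-- If the velocity has a first zero, the front time there is infinite and `b` is chosen slightly to
its left; otherwise linear growth of the velocity makes the front time unbounded. -/
theorem exists_lt_frontTime (hu : LocallyIntegrable u) (hb : ∃ C : ℝ, ∀ x, |u x| ≤ C)
    {v : ℝ} (hv : 0 < v) (N : ℝ≥0) :
    ∃ b, 0 < b ∧ (∀ z ∈ Icc 0 b, 0 < v - ∫ r in (0 : ℝ)..z, (u r + 1)) ∧ N < frontTime u v b := by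
  obtain ⟨S, hS⟩ : ∃ S : Set ℝ, S = {z | 0 ≤ z} ∩ {z | v - ∫ r in (0 : ℝ)..z, (u r + 1) ≤ 0} :=
    ⟨_, rfl⟩
  rcases S.eq_empty_or_nonempty with h | hne
  · have hpos : ∀ z, 0 ≤ z → 0 < v - ∫ r in (0 : ℝ)..z, (u r + 1) := by
      intro z hz
      by_contra! h1
      have : z ∈ S := hS ▸ ⟨hz, h1⟩
      rw [h] at this
      exact this
    obtain ⟨b, hb0, hN⟩ := not_bddAbove_frontTime hu hb hv hpos N
    exact ⟨b, hb0, fun z hz => hpos z hz.1, hN⟩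
  · have hcl : IsClosed S := by
      rw [hS]
      exact isClosed_Ici.inter (isClosed_le (continuous_velocity hu v) continuous_const)
    have hbdd : BddBelow S := ⟨0, fun z hz => by rw [hS] at hz; exact hz.1⟩
    have hmem := hcl.csInf_mem hne hbdd
    have hmin : ∀ z ∈ Ico 0 (sInf S), 0 < v - ∫ r in (0 : ℝ)..z, (u r + 1) := by
      intro z hz
      by_contra! h1
      exact absurd (csInf_le hbdd (hS ▸ ⟨hz.1, h1⟩)) (not_le.2 hz.2)
    have hmem' : ∀ z ∈ S, 0 ≤ z ∧ v - ∫ r in (0 : ℝ)..z, (u r + 1) ≤ 0 := fun z hz => by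
      rw [hS] at hz
      exact hz
    replace hmem' := hmem' _ hmem
    have h0 : 0 < sInf S := by
      refine lt_of_le_of_ne hmem'.1 fun h => ?_
      have := hmem'.2
      rw [← h, intervalIntegral.integral_same] at this
      linarith
    have htop := frontTime_eq_top hu hb h0 ⟨h0.le, le_rfl⟩ hmem'.2
    obtain ⟨b, hb0, hbS, hN⟩ := exists_lt_lintegral_Ioc (t := (N : ℝ≥0∞))
      (htop.symm ▸ ENNReal.coe_lt_top : (N : ℝ≥0∞) < frontTime u v (sInf S))
    exact ⟨b, hb0, fun z hz => hmin z ⟨hz.1, hz.2.trans_lt hbS⟩, hN⟩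

/-- Fatou's lemma; extended values take care of zeros of the velocity. -/
theorem le_liminf_frontTime (hu : LocallyIntegrable u) {v : ℝ} {vs : ℕ → ℝ}
    (hvs : Tendsto vs atTop (𝓝 v)) (x : ℝ) :
    frontTime u v x ≤ liminf (fun n => frontTime u (vs n) x) atTop := by
  refine le_trans (lintegral_mono fun z => ?_)
    (lintegral_liminf_le fun n => measurable_inv_velocity hu (vs n))
  refine ge_of_eq (Tendsto.liminf_eq ?_)
  simp_rw [one_div]
  exact ((ENNReal.continuous_ofReal.tendsto _).comp (hvs.sub_const _)).inv

/-- A finite front time forces the velocity to have a positive minimum `δ` on `[0, x]`; nearby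
velocities stay above `δ / 2`, which gives a constant majorant. -/
theorem tendsto_frontTime (hu : LocallyIntegrable u) (hb : ∃ C : ℝ, ∀ x, |u x| ≤ C) {v : ℝ}
    {vs : ℕ → ℝ} (hvs : Tendsto vs atTop (𝓝 v)) {x : ℝ} (hfin : frontTime u v x ≠ ⊤) :
    Tendsto (fun n => frontTime u (vs n) x) atTop (𝓝 (frontTime u v x)) := by
  rcases le_or_gt x 0 with hx | hx
  · simp [frontTime_of_nonpos u _ hx]
  obtain ⟨a, ha, hmin⟩ := isCompact_Icc.exists_isMinOn (nonempty_Icc.2 hx.le)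
    (continuous_velocity hu v).continuousOn
  obtain ⟨δ, hδ⟩ : ∃ δ, δ = v - ∫ r in (0 : ℝ)..a, (u r + 1) := ⟨_, rfl⟩
  have hδ0 : 0 < δ := by
    rw [hδ]
    by_contra! h
    exact hfin (frontTime_eq_top hu hb hx ha h)
  refine tendsto_lintegral_filter_of_dominated_convergence (fun _ => 1 / ENNReal.ofReal (δ / 2))
    (Eventually.of_forall fun n => measurable_inv_velocity hu (vs n)) ?_ ?_
    (ae_of_all _ fun z => ?_)
  · filter_upwards [hvs.eventually (lt_mem_nhds (show v - δ / 2 < v by linarith))] with n hn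
    filter_upwards [ae_restrict_mem measurableSet_Ioc] with z hz
    refine ENNReal.div_le_div_left (ENNReal.ofReal_le_ofReal ?_) 1
    have h1 : v - ∫ r in (0 : ℝ)..a, (u r + 1) ≤ v - ∫ r in (0 : ℝ)..z, (u r + 1) :=
      hmin ⟨hz.1.le, hz.2⟩
    linarith
  · rw [lintegral_const]
    refine ENNReal.mul_ne_top ?_ (by simp)
    simp [hδ0]
  · simp_rw [one_div]
    exact ((ENNReal.continuous_ofReal.tendsto _).comp (hvs.sub_const _)).inv

/-! ### Comparison of arrival times with front times. -/

namespace IsEquilibriumCapped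

theorem continuous_travel_toReal (hE : IsEquilibriumCapped γ T E) :
    ContinuousOn (fun x => (travel E.L x).toReal) (Ici 0) := by
  have hLp : LocallyIntegrable fun x => max (E.L x) 0 := by
    intro x
    obtain ⟨s, hs, hi⟩ := hE.locallyIntegrable x
    exact ⟨s, hs, hi.pos_part⟩
  have h := intervalIntegral.continuous_primitive (f := fun x => max (E.L x) 0) (μ := volume)
    (intervalIntegrable_of_locallyIntegrable hLp) 0
  refine h.continuousOn.congr fun x hx => ?_
  change _ = ∫ z in (0 : ℝ)..x, max (E.L z) 0
  rw [intervalIntegral.integral_of_le hx, integral_eq_lintegral_of_nonneg_ae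
    (f := fun z => max (E.L z) 0) (ae_of_all _ fun z => le_max_right _ _)
    (hE.measurable_L.max measurable_const).aestronglyMeasurable, travel]
  congr 1
  refine lintegral_congr fun z => ?_
  rcases le_total (E.L z) 0 with h | h
  · rw [max_eq_right h, ENNReal.ofReal_of_nonpos h, ENNReal.ofReal_zero]
  · rw [max_eq_left h]

theorem travel_ne_top (hE : IsEquilibriumCapped γ T E) (x : ℝ) : travel E.L x ≠ ⊤ := by
  rcases le_total x 0 with h | h
  · simp [travel_of_nonpos E.L h]
  have hi : IntegrableOn E.L (Ioc 0 x) := (hE.locallyIntegrable.integrableOn_isCompact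
    (isCompact_Icc (a := 0) (b := x))).mono_set Ioc_subset_Icc_self
  exact hi.lintegral_lt_top.ne

/-- Non-negative excess can only lower the flux in the balance law, and beyond the front the arrival
time is infinite. -/
theorem frontTime_le_arrivalTime (hE : IsEquilibriumCapped γ T E) (hγ : 0 < γ)
    (hex : E.ExcessNonneg u) (x : ℝ) :
    frontTime u (E.κ * E.Q.real {p | p.2 = p.1.θ} - γ) x ≤ E.arrivalTime x := by
  obtain ⟨b, hb, hpos, hzero⟩ := hE.exists_front hγ hex
  have hinv := hE.invaded_eq hb hpos hzero
  rcases le_or_gt x 0 with hx | hx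
  · rw [frontTime_of_nonpos u _ hx]
    exact zero_le
  rcases le_or_gt x b with hxb | hxb
  · rw [hE.arrivalTime_eq_travel hpos ⟨hx, hxb⟩, hE.travel_eq_lintegral_flux hpos hxb]
    refine setLIntegral_mono' measurableSet_Ioc fun z hz => ?_
    refine ENNReal.div_le_div_left (ENNReal.ofReal_le_ofReal ?_) 1
    rw [hE.flux_eq (u := u) hinv ⟨hz.1, hz.2.trans hxb⟩]
    linarith [hex (Iio z) measurableSet_Iio]
  · rw [hE.arrivalTime_eq_top hb hzero hxb]
    exact le_top

/-- Up to time `r` the excess lowers the velocity by at most `η`. The bound `η < p` guarantees that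
the front starts, and `η < γ` that it does not stop before reaching `x`. -/
theorem arrivalTime_le_frontTime (hE : IsEquilibriumCapped γ T E) (hγ : 0 < γ)
    (hu : LocallyIntegrable u) (hex : E.ExcessNonneg u) {r : ℝ≥0} {η x : ℝ}
    (hη : E.cumulativeExcess u r ≤ η) (hηγ : η < γ)
    (hηp : η < E.κ * E.Q.real {p | p.2 = p.1.θ})
    (hr : frontTime u (E.κ * E.Q.real {p | p.2 = p.1.θ} - γ - η) x < r) :
    E.arrivalTime x ≤ frontTime u (E.κ * E.Q.real {p | p.2 = p.1.θ} - γ - η) x := by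
  have := hE.isProbabilityMeasure
  obtain ⟨b, hb, hpos, hzero⟩ := hE.exists_front hγ hex
  have hinv := hE.invaded_eq hb hpos hzero
  have hmeas : MeasurableSet {x | E.arrivalTime x ≤ r} :=
    measurableSet_le (hE.monotone_arrivalTime hb hpos hzero).measurable measurable_const
  have hsub : ∀ A : Set ℝ, MeasurableSet A → A ⊆ {x | E.arrivalTime x ≤ r} → E.excess u A ≤ η :=
    fun A hA h => (excess_mono hu hinv hex hA hmeas h).trans hη
  -- A front that never leaves the origin would put the whole boundary mass into the excess on `(-∞,
  -- 0]`.
  have hb0 : 0 < b := by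
    refine lt_of_le_of_ne hb fun h0 => ?_
    have h1 : fluxRight E 0 = 0 := by
      refine tendsto_nhds_unique (hE.tendsto_flux_right 0) (tendsto_const_nhds.congr' ?_)
      filter_upwards [self_mem_nhdsWithin] with x hx
      exact (hzero x (h0 ▸ hx)).symm
    have h2 := hE.fluxRight_zero (u := u)
    have h3 := hsub (Iic 0) measurableSet_Iic fun z hz => by
      change E.arrivalTime z ≤ r
      rw [arrivalTime_of_nonpos hz]
      exact zero_le
    linarith
  rcases le_or_gt x 0 with hx | hx
  · rw [arrivalTime_of_nonpos hx]
    exact zero_le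
  -- Everything to the left of a point with travel time at most `r` is invaded by time `r`, so the
  -- bound `η` applies in the balance law.
  have hstep : ∀ z, z ≤ b → travel E.L z ≤ r →
      travel E.L z ≤ frontTime u (E.κ * E.Q.real {p | p.2 = p.1.θ} - γ - η) z := by
    intro z hzb hz
    rw [hE.travel_eq_lintegral_flux hpos hzb]
    refine setLIntegral_mono' measurableSet_Ioc fun s hs => ?_
    refine ENNReal.div_le_div_left (ENNReal.ofReal_le_ofReal ?_) 1
    rw [hE.flux_eq (u := u) hinv ⟨hs.1, hs.2.trans hzb⟩]
    have := hsub (Iio s) measurableSet_Iio fun q hq => by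
      change E.arrivalTime q ≤ r
      rcases le_or_gt q 0 with hq0 | hq0
      · rw [arrivalTime_of_nonpos hq0]
        exact zero_le
      · have hqs : q < s := hq
        rw [hE.arrivalTime_eq_travel hpos ⟨hq0, hqs.le.trans (hs.2.trans hzb)⟩]
        exact (travel_mono E.L (hqs.le.trans hs.2)).trans hz
    linarith
  obtain ⟨m, hm⟩ : ∃ m, m = min x b := ⟨_, rfl⟩
  have hm0 : 0 < m := hm ▸ lt_min hx hb0
  have hmx : m ≤ x := hm ▸ min_le_left _ _
  have hmb : m ≤ b := hm ▸ min_le_right _ _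
  have hmr : travel E.L m ≤ r := by
    by_contra! h
    -- If the travel time to `m` exceeded `r`, it would equal `r` at some `z ≤ m`; there the
    -- previous bound gives `r ≤` the front time of `x`, contrary to assumption.
    have hivt := intermediate_value_Icc hm0.le
      (hE.continuous_travel_toReal.mono (Icc_subset_Ici_self : Icc 0 m ⊆ Ici 0))
    obtain ⟨z, hz, hzr⟩ := hivt (show (r : ℝ) ∈ _ from ⟨by
      simp [travel_of_nonpos], by
      rw [← ENNReal.coe_toReal]
      exact ENNReal.toReal_mono (hE.travel_ne_top m) h.le⟩)
    have hzr' : travel E.L z = r := by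
      have h1 : (travel E.L z).toReal = r := hzr
      rw [← ENNReal.coe_toReal] at h1
      exact (ENNReal.toReal_eq_toReal_iff' (hE.travel_ne_top z) ENNReal.coe_ne_top).1 h1
    have h1 := hstep z (hz.2.trans hmb) hzr'.le
    rw [hzr'] at h1
    exact absurd (h1.trans (frontTime_mono u _ (hz.2.trans hmx))) (not_le.2 hr)
  have hmf := (hstep m hmb hmr).trans (frontTime_mono u _ hmx)
  rcases lt_or_ge x b with hxb | hxb
  · rw [min_eq_left hxb.le] at hm
    rw [hE.arrivalTime_eq_travel hpos ⟨hx, hxb.le⟩, ← hm]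
    exact hm ▸ hmf
  · rw [min_eq_right hxb] at hm
    -- Here the front stops at `b ≤ x` no later than time `r`, which would cost an excess of at
    -- least `γ > η`.
    have h1 := hE.le_excess_singleton_front (u := u) hb0 hpos hzero
    have h2 := hsub {b} (measurableSet_singleton b) (by
      rw [singleton_subset_iff]
      change E.arrivalTime b ≤ r
      rw [hE.arrivalTime_eq_travel hpos ⟨hb0, le_rfl⟩]
      exact hm ▸ hmr)
    linarith

end IsEquilibriumCapped

/-! ### The measure theoretic boundary and the boundary energy. -/

theorem limsup_density_eq_zero {f : ℝ → Set ℝ} {a : ℝ} (ha : 0 < a)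
    (h : ∀ r, 0 < r → r < a → f r = ∅) :
    limsup (fun r : ℝ => volume (f r) / ENNReal.ofReal r) (𝓝[>] 0) = 0 := by
  rw [limsup_congr (v := fun _ => (0 : ℝ≥0∞)), limsup_const]
  filter_upwards [Ioo_mem_nhdsGT ha] with r hr
  simp [h r hr.1 hr.2]

theorem limsup_density_eq_one {f : ℝ → Set ℝ} (h : ∀ r, 0 < r → volume (f r) = ENNReal.ofReal r) :
    limsup (fun r : ℝ => volume (f r) / ENNReal.ofReal r) (𝓝[>] 0) = 1 := by
  rw [limsup_congr (v := fun _ => (1 : ℝ≥0∞)), limsup_const]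
  filter_upwards [self_mem_nhdsWithin] with r hr
  have hr : 0 < r := hr
  rw [h r hr]
  exact ENNReal.div_self (by simpa using hr) ENNReal.ofReal_ne_top

theorem measureTheoreticBoundary_Iic_zero : measureTheoreticBoundary (Iic (0 : ℝ)) = {0} := by
  ext x
  rw [measureTheoreticBoundary, mem_ofPred_eq, mem_singleton_iff]
  rcases lt_trichotomy x 0 with hx | rfl | hx
  · refine iff_of_false (fun h => h.2.ne' ?_) hx.ne
    refine limsup_density_eq_zero (a := -x) (by linarith) fun r _ hr => ?_
    rw [Real.closedBall_eq_Icc]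
    ext z
    simp only [Set.mem_sdiff, mem_Icc, mem_Iic, mem_empty_iff_false, iff_false]
    rintro ⟨⟨-, h1⟩, h2⟩
    linarith
  · refine iff_of_true ⟨?_, ?_⟩ rfl
    · rw [limsup_density_eq_one]
      · exact one_pos
      · intro r hr
        have : Metric.closedBall (0 : ℝ) r ∩ Iic 0 = Icc (-r) 0 := by
          rw [Real.closedBall_eq_Icc]
          ext z
          simp only [mem_inter_iff, mem_Icc, mem_Iic]
          constructor
          · rintro ⟨⟨h1, -⟩, h2⟩
            exact ⟨by linarith, h2⟩
          · rintro ⟨h1, h2⟩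
            exact ⟨⟨by linarith, by linarith⟩, h2⟩
        rw [this, Real.volume_Icc]
        simp
    · rw [limsup_density_eq_one]
      · exact one_pos
      · intro r hr
        have : Metric.closedBall (0 : ℝ) r \ Iic 0 = Ioc 0 r := by
          rw [Real.closedBall_eq_Icc]
          ext z
          simp only [Set.mem_sdiff, mem_Icc, mem_Iic, mem_Ioc, not_le]
          constructor
          · rintro ⟨⟨-, h1⟩, h2⟩
            exact ⟨h2, by linarith⟩
          · rintro ⟨h1, h2⟩
            exact ⟨⟨by linarith, by linarith⟩, h1⟩
        rw [this, Real.volume_Ioc]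
        simp
  · refine iff_of_false (fun h => h.1.ne' ?_) hx.ne'
    refine limsup_density_eq_zero (a := x) hx fun r _ hr => ?_
    rw [Real.closedBall_eq_Icc]
    ext z
    simp only [mem_inter_iff, mem_Icc, mem_Iic, mem_empty_iff_false, iff_false]
    rintro ⟨⟨h1, -⟩, h2⟩
    linarith

theorem initialEnergy_eq (γ V₀ : ℝ) :
    initialEnergy γ (Iic 0) (fun _ => V₀) = ENNReal.ofReal (γ + V₀) • Measure.dirac 0 := by
  rw [initialEnergy, measureTheoreticBoundary_Iic_zero, Measure.restrict_singleton,
    Measure.hausdorffMeasure_zero_singleton, one_smul, withDensity_const]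

theorem lintegral_initialEnergy (γ V₀ : ℝ) :
    ∫⁻ _ in measureTheoreticBoundary (Iic (0 : ℝ)), ENNReal.ofReal (γ + V₀)
      ∂(Measure.hausdorffMeasure 0 : Measure ℝ) = ENNReal.ofReal (γ + V₀) := by
  rw [measureTheoreticBoundary_Iic_zero, lintegral_const, Measure.restrict_apply_univ,
    Measure.hausdorffMeasure_zero_singleton, mul_one]

/-- Particles with `β = θ` end in `∂_*Γ`, a single point, so all conditions on boundary measures are
conditions on one number. -/
theorem IsEquilibriumCapped.boundaryMeasure_eq (hE : IsEquilibriumCapped γ T E) :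
    E.boundaryMeasure
      = (ENNReal.ofReal E.κ * E.Q {p | p.2 = p.1.θ}) • Measure.dirac 0 := by
  have hm : MeasurableSet {p : HalfLinePath × ℝ≥0 | p.2 = p.1.θ} :=
    measurableSet_eq_fun measurable_snd (measurable_θ.comp measurable_fst)
  have h : (fun p : HalfLinePath × ℝ≥0 => p.1 p.1.θ) =ᵐ[E.Q.restrict {p | p.2 = p.1.θ}]
      fun _ => 0 := by
    refine (ae_restrict_iff' hm).2 ?_
    filter_upwards [hE.boundary] with p hp h
    have := hp h
    rwa [measureTheoreticBoundary_Iic_zero] at this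
  rw [Triplet.boundaryMeasure, Measure.map_congr h, Measure.map_const, Measure.restrict_apply_univ,
    smul_smul]

/-! ### Construction of equilibria by monotone coupling. -/

section Quantile

/-- The decreasing rearrangement of a measure on `[0, b]`. -/
def quantile (b : ℝ) (μ : Measure ℝ) (q : ℝ) : ℝ :=
  sSup {x | x ∈ Icc 0 b ∧ ENNReal.ofReal q ≤ μ (Ici x)}

theorem quantile_nonneg (b : ℝ) (μ : Measure ℝ) (q : ℝ) : 0 ≤ quantile b μ q :=
  Real.sSup_nonneg fun _ hx => hx.1.1

theorem quantile_le {b : ℝ} (hb : 0 ≤ b) (μ : Measure ℝ) (q : ℝ) : quantile b μ q ≤ b :=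
  Real.sSup_le (fun _ hx => hx.1.2) hb

theorem quantile_le_quantile {b : ℝ} {μ ν : Measure ℝ} (h : ∀ x, ν (Ici x) ≤ μ (Ici x))
    {q q' : ℝ} (hq : q ≤ q') : quantile b ν q' ≤ quantile b μ q := by
  refine Real.sSup_le (fun x hx => le_csSup ⟨b, fun z hz => hz.1.2⟩ ⟨hx.1, ?_⟩)
    (quantile_nonneg b μ q)
  exact (ENNReal.ofReal_le_ofReal hq).trans (hx.2.trans (h x))

theorem measurable_quantile (b : ℝ) (μ : Measure ℝ) : Measurable (quantile b μ) :=
  Antitone.measurable fun _ _ h => quantile_le_quantile (fun _ => le_rfl) h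

/-- The supremum is attained because `x ↦ μ [x,∞)` is left-continuous; the bound on `q` keeps the
set non-empty, so that the default supremum of the empty set plays no role. -/
theorem le_quantile_iff {b : ℝ} {μ : Measure ℝ} [IsFiniteMeasure μ] {q x : ℝ} (hx : x ∈ Icc 0 b)
    (hq : ENNReal.ofReal q ≤ μ (Ici 0)) :
    x ≤ quantile b μ q ↔ ENNReal.ofReal q ≤ μ (Ici x) := by
  obtain ⟨S, hS⟩ : ∃ S : Set ℝ, S = {x | x ∈ Icc 0 b ∧ ENNReal.ofReal q ≤ μ (Ici x)} := ⟨_, rfl⟩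
  have hbdd : BddAbove S := ⟨b, fun z hz => by rw [hS] at hz; exact hz.1.2⟩
  have hne : S.Nonempty := ⟨0, hS ▸ ⟨⟨le_rfl, hx.1.trans hx.2⟩, hq⟩⟩
  rw [quantile, ← hS]
  constructor
  · intro h
    obtain ⟨s, hs, -, hlim, hmem⟩ := (isLUB_csSup hne hbdd).exists_seq_monotone_tendsto hne
    have h1 : ⋂ n, Ici (s n) = Ici (sSup S) := by
      ext z
      simp only [mem_iInter, mem_Ici]
      exact ⟨fun h => le_of_tendsto' hlim h, fun h n => (le_csSup hbdd (hmem n)).trans h⟩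
    have h2 := tendsto_measure_iInter_atTop (μ := μ) (s := fun n => Ici (s n))
      (fun n => measurableSet_Ici.nullMeasurableSet) (fun m n hmn => Ici_subset_Ici.2 (hs hmn))
      ⟨0, measure_ne_top _ _⟩
    rw [h1] at h2
    have h3 : ENNReal.ofReal q ≤ μ (Ici (sSup S)) := ge_of_tendsto' h2 fun n => by
      have := hmem n
      rw [hS] at this
      exact this.2
    exact h3.trans (measure_mono (Ici_subset_Ici.2 h))
  · intro h
    exact le_csSup hbdd (hS ▸ ⟨hx, h⟩)

/-- The levels `q` at which the quantile is at least `x` form the interval `(0, μ [x,∞)]`, of the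
correct length. -/
theorem map_quantile {b : ℝ} (hb : 0 ≤ b) {μ : Measure ℝ} [IsFiniteMeasure μ]
    (hμ : μ (Icc 0 b)ᶜ = 0) :
    (volume.restrict (Ioc 0 (μ.real univ))).map (quantile b μ) = μ := by
  have huniv : μ (Ici 0) = μ univ := by
    refine measure_congr (eventuallyEq_univ.2 ?_)
    rw [mem_ae_iff]
    exact measure_mono_null (compl_subset_compl.2 fun x hx => hx.1) hμ
  refine Measure.ext_of_Ici _ _ fun x => ?_
  rw [Measure.map_apply (measurable_quantile b μ) measurableSet_Ici,
    Measure.restrict_apply (measurable_quantile b μ measurableSet_Ici)]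
  have hq : ∀ q ∈ Ioc 0 (μ.real univ), ENNReal.ofReal q ≤ μ (Ici 0) := fun q hq => by
    rw [huniv, ← ofReal_measureReal]
    exact ENNReal.ofReal_le_ofReal hq.2
  rcases lt_or_ge x 0 with hx | hx
  · have h1 : quantile b μ ⁻¹' Ici x = univ :=
      eq_univ_of_forall fun q => hx.le.trans (quantile_nonneg b μ q)
    have h2 : μ (Ici x) = μ univ :=
      le_antisymm (measure_mono (subset_univ _)) (huniv ▸ measure_mono (Ici_subset_Ici.2 hx.le))
    rw [h1, univ_inter, h2, Real.volume_Ioc, sub_zero, ofReal_measureReal]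
  rcases le_or_gt x b with hxb | hxb
  · have h1 : quantile b μ ⁻¹' Ici x ∩ Ioc 0 (μ.real univ) = Ioc 0 (μ.real (Ici x)) := by
      ext q
      simp only [mem_inter_iff, mem_preimage, mem_Ici]
      constructor
      · rintro ⟨h1, h2⟩
        rw [le_quantile_iff ⟨hx, hxb⟩ (hq q h2)] at h1
        exact ⟨h2.1, (ENNReal.ofReal_le_iff_le_toReal (measure_ne_top _ _)).1 h1⟩
      · intro h1
        have h2 : q ∈ Ioc 0 (μ.real univ) := ⟨h1.1, h1.2.trans (measureReal_mono (subset_univ _))⟩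
        refine ⟨?_, h2⟩
        rw [le_quantile_iff ⟨hx, hxb⟩ (hq q h2)]
        exact (ENNReal.ofReal_le_iff_le_toReal (measure_ne_top _ _)).2 h1.2
    rw [h1, Real.volume_Ioc, sub_zero, ofReal_measureReal]
  · have h1 : quantile b μ ⁻¹' Ici x = ∅ :=
      eq_empty_of_forall_notMem fun q h => absurd (quantile_le hb μ q) (not_le.2 (hxb.trans_le h))
    rw [h1, empty_inter, measure_empty]
    exact (measure_mono_null (fun z hz h => absurd h.2 (not_le.2 (hxb.trans_le hz))) hμ).symm

end Quantile

/-- Straight particles that start according to `μ` and are killed according to `ν`, matched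
monotonically. -/
def quantilePath (b : ℝ) (μ ν : Measure ℝ) (q : ℝ) : HalfLinePath × ℝ≥0 :=
  (straight (quantile b μ q), (quantile b μ q - quantile b ν q).toNNReal)

theorem measurable_quantilePath (b : ℝ) (μ ν : Measure ℝ) : Measurable (quantilePath b μ ν) :=
  (measurable_straight.comp (measurable_quantile b μ)).prodMk
    ((measurable_quantile b μ).sub (measurable_quantile b ν)).real_toNNReal

theorem quantilePath_start (b : ℝ) (μ ν : Measure ℝ) (q : ℝ) :
    (quantilePath b μ ν q).1 0 = quantile b μ q := straight_zero _

theorem quantilePath_killing {b : ℝ} {μ ν : Measure ℝ} (h : ∀ x, ν (Ici x) ≤ μ (Ici x)) (q : ℝ) :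
    ((quantilePath b μ ν q).2 : ℝ) = quantile b μ q - quantile b ν q :=
  Real.coe_toNNReal _ (sub_nonneg.2 (quantile_le_quantile h le_rfl))

theorem quantilePath_end {b : ℝ} {μ ν : Measure ℝ} (h : ∀ x, ν (Ici x) ≤ μ (Ici x)) (q : ℝ) :
    (quantilePath b μ ν q).1 (quantilePath b μ ν q).2 = quantile b ν q := by
  change straight (quantile b μ q) (quantilePath b μ ν q).2 = _
  rw [straight_apply, quantilePath_killing h, max_eq_left (quantile_nonneg b μ q), min_eq_left]
  · ring
  · linarith [quantile_nonneg b ν q]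

/-- The triplet in which particles move straight, start according to `μ` and are killed according
to `ν`. -/
def quantileTriplet (b : ℝ) (μ ν : Measure ℝ) (L : ℝ → ℝ) : HalfLineTriplet where
  κ := μ.real univ
  Q := (ENNReal.ofReal (μ.real univ))⁻¹ •
    (volume.restrict (Ioc 0 (μ.real univ))).map (quantilePath b μ ν)
  L := L

theorem quantileTriplet_Q_apply {b : ℝ} {μ ν : Measure ℝ} {L : ℝ → ℝ}
    {S : Set (HalfLinePath × ℝ≥0)} (hS : MeasurableSet S) :
    (quantileTriplet b μ ν L).Q S = (ENNReal.ofReal (μ.real univ))⁻¹ *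
      volume.restrict (Ioc 0 (μ.real univ)) (quantilePath b μ ν ⁻¹' S) := by
  rw [← Measure.map_apply (measurable_quantilePath b μ ν) hS]
  rfl

theorem ae_quantileTriplet {b : ℝ} {μ ν : Measure ℝ} {L : ℝ → ℝ}
    {P : HalfLinePath × ℝ≥0 → Prop} (hm : MeasurableSet {p | P p})
    (h : ∀ q, P (quantilePath b μ ν q)) : ∀ᵐ p ∂(quantileTriplet b μ ν L).Q, P p := by
  refine Measure.ae_smul_measure ?_ _
  rw [ae_map_iff (measurable_quantilePath b μ ν).aemeasurable hm]
  exact ae_of_all _ h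

theorem isProbabilityMeasure_quantileTriplet {b : ℝ} {μ ν : Measure ℝ} {L : ℝ → ℝ}
    (h0 : 0 < μ.real univ) : IsProbabilityMeasure (quantileTriplet b μ ν L).Q := by
  refine ⟨?_⟩
  rw [quantileTriplet_Q_apply MeasurableSet.univ, preimage_univ,
    Measure.restrict_apply_univ, Real.volume_Ioc, sub_zero]
  exact ENNReal.inv_mul_cancel (by simpa using h0) ENNReal.ofReal_ne_top

theorem mul_real_quantileTriplet {b : ℝ} {μ ν ρ : Measure ℝ} {L : ℝ → ℝ} (h0 : 0 < μ.real univ)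
    {f : HalfLinePath × ℝ≥0 → ℝ} (hf : Measurable f)
    (hρ : (volume.restrict (Ioc 0 (μ.real univ))).map (fun q => f (quantilePath b μ ν q)) = ρ)
    {A : Set ℝ} (hA : MeasurableSet A) :
    (quantileTriplet b μ ν L).κ * (quantileTriplet b μ ν L).Q.real {p | f p ∈ A} = ρ.real A := by
  have h1 : (quantileTriplet b μ ν L).Q {p | f p ∈ A}
      = (ENNReal.ofReal (μ.real univ))⁻¹ * ρ A := by
    have hcomp : Measurable fun q => f (quantilePath b μ ν q) :=
      hf.comp (measurable_quantilePath b μ ν)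
    rw [← hρ, quantileTriplet_Q_apply (S := {p | f p ∈ A}) (hf hA),
      Measure.map_apply hcomp hA]
    rfl
  rw [measureReal_def, h1, ENNReal.toReal_mul, ENNReal.toReal_inv, ENNReal.toReal_ofReal h0.le,
    measureReal_def ρ]
  change μ.real univ * _ = _
  rw [← mul_assoc, mul_inv_cancel₀ h0.ne', one_mul]

/-- The measure with density `f⁺` on `(0, b]` and an atom of mass `c` at `a`. -/
def atomMeasure (f : ℝ → ℝ) (b c a : ℝ) : Measure ℝ :=
  ((volume.restrict (Ioc 0 b)).withDensity fun x => ENNReal.ofReal (f x))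
    + ENNReal.ofReal c • Measure.dirac a

theorem isFiniteMeasure_atomMeasure {f : ℝ → ℝ} {b : ℝ} (hf : IntegrableOn f (Ioc 0 b))
    (c a : ℝ) : IsFiniteMeasure (atomMeasure f b c a) := by
  have := isFiniteMeasure_withDensity_ofReal hf.2
  have : IsFiniteMeasure (ENNReal.ofReal c • Measure.dirac a) :=
    Measure.smul_finite _ ENNReal.ofReal_ne_top
  rw [atomMeasure]
  infer_instance

theorem atomMeasure_apply (f : ℝ → ℝ) (b c a : ℝ) {A : Set ℝ} (hA : MeasurableSet A) :
    atomMeasure f b c a A = (∫⁻ x in A ∩ Ioc 0 b, ENNReal.ofReal (f x))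
      + ENNReal.ofReal c * A.indicator 1 a := by
  rw [atomMeasure, Measure.add_apply, withDensity_apply _ hA, Measure.restrict_restrict hA,
    Measure.smul_apply, Measure.dirac_apply' a hA, smul_eq_mul]

theorem atomMeasure_real {f : ℝ → ℝ} {b c : ℝ} (hf : IntegrableOn f (Ioc 0 b)) (hc : 0 ≤ c)
    (a : ℝ) {A : Set ℝ} (hA : MeasurableSet A) :
    (atomMeasure f b c a).real A = (∫⁻ x in A ∩ Ioc 0 b, ENNReal.ofReal (f x)).toReal
      + c * A.indicator 1 a := by
  have hfin : ∫⁻ x in A ∩ Ioc 0 b, ENNReal.ofReal (f x) ≠ ⊤ :=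
    (hf.mono_set inter_subset_right).lintegral_lt_top.ne
  rw [measureReal_def, atomMeasure_apply f b c a hA, ENNReal.toReal_add hfin, ENNReal.toReal_mul,
    ENNReal.toReal_ofReal hc]
  · by_cases h : a ∈ A <;> simp [h]
  · by_cases h : a ∈ A <;> simp [h]

theorem atomMeasure_real_sub {f : ℝ → ℝ} {b c c' : ℝ} (hf : IntegrableOn f (Ioc 0 b))
    (hc : 0 ≤ c) (hc' : 0 ≤ c') (a a' : ℝ) {A : Set ℝ} (hA : MeasurableSet A) :
    (atomMeasure f b c a).real A - (atomMeasure (fun x => -f x) b c' a').real A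
      = (∫ x in A ∩ Ioc 0 b, f x) + (c * A.indicator 1 a - c' * A.indicator 1 a') := by
  rw [atomMeasure_real hf hc a hA, atomMeasure_real (f := fun x => -f x) hf.neg hc' a' hA,
    integral_eq_lintegral_pos_part_sub_lintegral_neg_part (hf.mono_set inter_subset_right)]
  ring

theorem atomMeasure_compl_Icc (f : ℝ → ℝ) {b a : ℝ} (c : ℝ) (ha : a ∈ Icc 0 b) :
    atomMeasure f b c a (Icc 0 b)ᶜ = 0 := by
  have h : (Icc 0 b)ᶜ ∩ Ioc 0 b = ∅ := by
    ext x
    simp only [mem_inter_iff, mem_compl_iff, mem_empty_iff_false, iff_false]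
    exact fun h => h.1 (Ioc_subset_Icc_self h.2)
  rw [atomMeasure_apply f b c a measurableSet_Icc.compl, h]
  simp [ha.1, ha.2]

/-- The running cost under which straight particles advance the front with velocity `V`. -/
def frontCost (γ : ℝ) (V : ℝ → ℝ) (b : ℝ) (x : ℝ) : ℝ :=
  open Classical in if x ∈ Icc 0 b then 1 / V x else -1 / γ

section FrontCost

variable {V : ℝ → ℝ} {b : ℝ}

theorem frontCost_of_mem {x : ℝ} (hx : x ∈ Icc 0 b) : frontCost γ V b x = 1 / V x := if_pos hx

theorem frontCost_of_notMem {x : ℝ} (hx : x ∉ Icc 0 b) : frontCost γ V b x = -1 / γ := if_neg hx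

/-- The cost is positive and continuous on a closed interval and negative outside, so it only jumps
down on leaving the interval. -/
theorem upperSemicontinuous_frontCost (hγ : 0 < γ) (hV : Continuous V)
    (hpos : ∀ x ∈ Icc 0 b, 0 < V x) : UpperSemicontinuous (frontCost γ V b) := by
  intro x c hc
  by_cases hx : x ∈ Icc 0 b
  · rw [frontCost_of_mem hx] at hc
    have hVx := hpos x hx
    have hc0 : 0 < c := (one_div_pos.2 hVx).trans hc
    have hcont : ContinuousAt (fun z => 1 / V z) x :=
      continuousAt_const.div hV.continuousAt hVx.ne'
    filter_upwards [hcont.eventually (gt_mem_nhds hc)] with z hz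
    by_cases hzb : z ∈ Icc 0 b
    · rwa [frontCost_of_mem hzb]
    · rw [frontCost_of_notMem hzb]
      exact (div_neg_of_neg_of_pos (by norm_num) hγ).trans hc0
  · rw [frontCost_of_notMem hx] at hc
    filter_upwards [isClosed_Icc.isOpen_compl.mem_nhds hx] with z hz
    rwa [frontCost_of_notMem hz]

theorem locallyIntegrable_frontCost (hγ : 0 < γ) (hV : Continuous V)
    (hpos : ∀ x ∈ Icc 0 b, 0 < V x) : LocallyIntegrable (frontCost γ V b) := by
  obtain ⟨C, hC⟩ := (isCompact_Icc (a := 0) (b := b)).exists_bound_of_continuousOn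
    (f := fun z => 1 / V z)
    (continuousOn_const.div hV.continuousOn fun x hx => (hpos x hx).ne')
  have h := (locallyIntegrable_const (max C ‖-1 / γ‖) : LocallyIntegrable (fun _ : ℝ => _) volume)
  refine h.mono (upperSemicontinuous_frontCost hγ hV hpos).measurable.aestronglyMeasurable
    (ae_of_all _ fun x => ?_)
  refine le_trans ?_ (le_abs_self _)
  by_cases hx : x ∈ Icc 0 b
  · rw [frontCost_of_mem hx]
    exact (hC x hx).trans (le_max_left _ _)
  · rw [frontCost_of_notMem hx]
    exact le_max_right _ _

theorem frontCost_ne_zero (hγ : 0 < γ) (hpos : ∀ x ∈ Icc 0 b, 0 < V x) (x : ℝ) :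
    frontCost γ V b x ≠ 0 := by
  by_cases hx : x ∈ Icc 0 b
  · rw [frontCost_of_mem hx]
    exact (one_div_pos.2 (hpos x hx)).ne'
  · rw [frontCost_of_notMem hx]
    exact (div_neg_of_neg_of_pos (by norm_num) hγ).ne

end FrontCost

/-- If starts and ends are matched by straight particles, and if the flux through `x ∈ (0, b]` is
`V x + γ`, then the running cost `1 / V` on `[0, b]` makes the triplet an equilibrium. -/
theorem isEquilibrium_quantileTriplet (hγ : 0 < γ) {V : ℝ → ℝ} (hV : Continuous V) {b : ℝ}
    (hb : 0 ≤ b) (hpos : ∀ x ∈ Icc 0 b, 0 < V x) {μ ν : Measure ℝ} [IsFiniteMeasure μ]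
    [IsFiniteMeasure ν] (h0 : 0 < μ.real univ) (hdom : ∀ x, ν (Ici x) ≤ μ (Ici x))
    (hflux : ∀ x ∈ Ioc 0 b, flux (quantileTriplet b μ ν (frontCost γ V b)) x = V x + γ) :
    IsEquilibrium γ (quantileTriplet b μ ν (frontCost γ V b)) := by
  obtain ⟨E, hE⟩ : ∃ E, E = quantileTriplet b μ ν (frontCost γ V b) := ⟨_, rfl⟩
  have hEL : E.L = frontCost γ V b := by rw [hE]; rfl
  have hprob : IsProbabilityMeasure E.Q := hE ▸ isProbabilityMeasure_quantileTriplet h0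
  have hae : ∀ {P : HalfLinePath × ℝ≥0 → Prop}, MeasurableSet {p | P p} →
      (∀ q, P (quantilePath b μ ν q)) → ∀ᵐ p ∂E.Q, P p := fun hm h =>
    hE ▸ ae_quantileTriplet hm h
  have husc : UpperSemicontinuous E.L := hEL ▸ upperSemicontinuous_frontCost hγ hV hpos
  have hL : Measurable E.L := husc.measurable
  have hloc : LocallyIntegrable E.L := hEL ▸ locallyIntegrable_frontCost hγ hV hpos
  have htfin : travel E.L b ≠ ⊤ :=
    ((hloc.integrableOn_isCompact (isCompact_Icc (a := 0) (b := b))).mono_set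
      Ioc_subset_Icc_self).lintegral_lt_top.ne
  have hcm : Measurable fun p : HalfLinePath × ℝ≥0 => p.1.cost E.L :=
    (measurable_cost hL).comp measurable_fst
  have htm : Measurable fun p : HalfLinePath × ℝ≥0 => travel E.L (p.1 0) :=
    (measurable_travel E.L).comp measurable_start
  have hcost : ∀ᵐ p ∂E.Q, p.1.cost E.L = travel E.L (p.1 0) :=
    hae (measurableSet_eq_fun hcm htm) fun q => by
      rw [quantilePath_start]
      exact cost_straight E.L _
  have hstart : ∀ᵐ p ∂E.Q, p.1 0 ≤ b := hae (measurableSet_le measurable_start measurable_const)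
    fun q => by rw [quantilePath_start]; exact quantile_le hb μ q
  have hend0 : ∀ᵐ p ∂E.Q, 0 ≤ p.1 p.2 := hae (measurableSet_le measurable_const measurable_end)
    fun q => by rw [quantilePath_end hdom]; exact quantile_nonneg b ν q
  have hend : ∀ᵐ p ∂E.Q, p.1 p.2 = p.1 0 - (p.2 : ℝ) :=
    hae (measurableSet_eq_fun measurable_end
      (measurable_start.sub measurable_snd.coe_nnreal_real)) fun q => by
      rw [quantilePath_end hdom, quantilePath_start, quantilePath_killing hdom]
      ring
  -- The displacement at the killing time equals the elapsed time, so the Lipschitz bound leaves no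
  -- freedom in between.
  have hstraight : ∀ᵐ p : HalfLinePath × ℝ≥0 ∂E.Q, ∀ r : ℝ≥0, r ≤ p.2 →
      p.1 r = p.1 0 - (r : ℝ) := by
    filter_upwards [hend] with p hp r hr
    have hr' : (r : ℝ) ≤ p.2 := hr
    have h1 := p.1.lipschitz.dist_le_mul 0 r
    have h2 := p.1.lipschitz.dist_le_mul r p.2
    simp only [NNReal.coe_one, one_mul, Real.dist_eq, NNReal.dist_eq, NNReal.coe_zero] at h1 h2
    rw [abs_of_nonpos (a := (r : ℝ) - p.2) (by linarith)] at h2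
    rw [zero_sub, abs_neg, abs_of_nonneg r.coe_nonneg] at h1
    have h3 := le_abs_self (p.1 0 - p.1 r)
    have h4 := le_abs_self (p.1 r - p.1 p.2)
    linarith
  rw [← hE]
  -- All starts are at most `b`, so the travel cost of `b` is a cap; the added 1 makes it positive.
  refine ⟨(travel E.L b).toNNReal + 1, by positivity, ?_⟩
  refine ⟨?_, hprob, ?_, husc, ?_, ?_, ?_, ?_, hloc, ?_, ?_⟩
  · rw [hE]
    exact h0
  · rw [hEL]
    exact frontCost_ne_zero hγ hpos
  · intro Q' hQ' hmap
    calc ∫⁻ p, p.1.cost E.L ∂E.Q = ∫⁻ p, travel E.L (p.1 0) ∂E.Q := lintegral_congr_ae hcost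
      _ = ∫⁻ x, travel E.L x ∂(E.Q.map fun p => p.1 0) :=
          (lintegral_map (measurable_travel E.L) measurable_start).symm
      _ = ∫⁻ p, travel E.L (p.1 0) ∂Q' := by
          rw [← hmap, lintegral_map (measurable_travel E.L) measurable_start]
      _ ≤ _ := lintegral_mono fun p => travel_le_cost hL p.1
  · filter_upwards [hcost, hstart] with p h1 h2
    rw [h1, ENNReal.coe_add, ENNReal.coe_toNNReal htfin]
    exact (travel_mono E.L h2).trans le_self_add
  · refine hae (measurableSet_le measurable_snd (measurable_θ.comp measurable_fst)) fun q => ?_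
    change (quantile b μ q - quantile b ν q).toNNReal ≤ (straight (quantile b μ q)).θ
    rw [straight_θ]
    exact Real.toNNReal_le_toNNReal (by linarith [quantile_nonneg b ν q])
  · have h1 : ∀ᵐ p ∂E.Q, p.1 p.1.θ = 0 :=
      hae (measurableSet_eq_fun measurable_apply_θ measurable_const) fun q => by
        change straight (quantile b μ q) (straight (quantile b μ q)).θ = 0
        have h := quantile_nonneg b μ q
        rw [straight_θ, straight_apply, Real.coe_toNNReal _ h, max_eq_left h, min_self, sub_self]
    filter_upwards [h1] with p hp _
    rw [measureTheoreticBoundary_Iic_zero]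
    exact hp
  · intro φ hφ hφc
    have hint : Integrable fun x => φ x * max (E.L x) 0 := by
      have hLp : LocallyIntegrable fun x => max (E.L x) 0 := by
        intro x
        obtain ⟨s, hs, hi⟩ := hloc x
        exact ⟨s, hs, hi.pos_part⟩
      exact hLp.integrable_smul_left_of_hasCompactSupport hφ.continuous hφc
    calc _ = E.κ * ∫ p, (∫ z in Ioc (p.1 p.2) (p.1 0), φ z * max (E.L z) 0) ∂E.Q := by
          congr 1
          refine integral_congr_ae ?_
          filter_upwards [hstraight] with p hp
          exact intervalIntegral_ext hp fun z => φ z * max (E.L z) 0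
      _ = ∫ x, flux E x * (φ x * max (E.L x) 0) := integral_crossing hint
      _ = _ := by
          refine integral_congr_ae ?_
          -- The flux is prescribed on `(0, b]` only, whereas the cost is positive on `[0, b]`; the
          -- origin is a null set.
          have hne : ∀ᵐ x : ℝ, x ≠ 0 := by simp [ae_iff]
          filter_upwards [hne] with x hx0
          rw [hEL]
          by_cases hx : x ∈ Icc 0 b
          · have hVx := hpos x hx
            rw [hE, hflux x ⟨lt_of_le_of_ne hx.1 hx0.symm, hx.2⟩, frontCost_of_mem hx,
              max_eq_left (one_div_pos.2 hVx).le]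
            field_simp
          -- Outside `[0, b]` the value `-1 / γ` makes `1 + γ L` vanish, and `L⁺` vanishes as well,
          -- so the flux is irrelevant.
          · rw [frontCost_of_notMem hx,
              max_eq_right (div_neg_of_neg_of_pos (by norm_num) hγ).le]
            field_simp
            ring
  · intro φ hφ hφc hφ0
    rw [lintegral_congr_ae (g := fun _ => 0), lintegral_zero]
    filter_upwards [hstraight, hend0, hstart, hend] with p h1 h2 h3 h4
    rw [setLIntegral_congr_fun (g := fun _ => 0) measurableSet_Icc, lintegral_zero]
    intro t ht
    have h5 := h1 t.toNNReal (Real.toNNReal_le_iff_le_coe.2 ht.2)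
    rw [Real.coe_toNNReal _ ht.1] at h5
    have h6 : p.1 t.toNNReal ∈ Icc 0 b := by
      rw [h5]
      constructor <;> linarith [ht.1, ht.2]
    have h7 : 0 ≤ E.L (p.1 t.toNNReal) := by
      rw [hEL, frontCost_of_mem h6]
      exact (one_div_pos.2 (hpos _ h6)).le
    simp only [ENNReal.ofReal_of_nonpos (neg_nonpos.2 h7), mul_zero]

/-- For every initial velocity `v > 0` there is an equilibrium whose front advances without excess
energy loss until after a given time. -/
theorem exists_equilibrium (hγ : 0 < γ) (hu : LocallyIntegrable u)
    (hbd : ∃ C : ℝ, ∀ x, |u x| ≤ C) {v : ℝ} (hv : 0 < v) (N : ℝ≥0) :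
    ∃ E : HalfLineTriplet, IsEquilibrium γ E ∧ E.ExcessNonneg u ∧
      ENNReal.ofReal E.κ * E.Q {p | p.2 = p.1.θ} = ENNReal.ofReal (v + γ) ∧
      ∀ t ≤ N, E.cumulativeExcess u t = 0 := by
  obtain ⟨b, hb0, hpos, hN⟩ := exists_lt_frontTime hu hbd hv N
  obtain ⟨V, hVdef⟩ : ∃ V : ℝ → ℝ, V = fun z => v - ∫ r in (0 : ℝ)..z, (u r + 1) := ⟨_, rfl⟩
  have hVz : ∀ z, V z = v - ∫ r in (0 : ℝ)..z, (u r + 1) := fun z => by rw [hVdef]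
  have hV : Continuous V := hVdef ▸ continuous_velocity hu v
  have hpos' : ∀ z ∈ Icc 0 b, 0 < V z := fun z hz => (hVz z).symm ▸ hpos z hz
  have hVb := hpos' b ⟨hb0.le, le_rfl⟩
  have hloc : LocallyIntegrable fun x => u x + 1 := hu.add (locallyIntegrable_const 1)
  have hii := intervalIntegrable_of_locallyIntegrable hloc
  have hf : IntegrableOn (fun x => u x + 1) (Ioc 0 b) :=
    (intervalIntegrable_iff_integrableOn_Ioc_of_le hb0.le).1 (hii 0 b)
  -- Starts have density `(u + 1)⁺` and killing points `(u + 1)⁻`, so no excess arises on `(0, b)`.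
  -- The atom of `μ` at `b` supplies the flux that remains there, and the atom of `ν` at the origin
  -- is the prescribed boundary mass.
  obtain ⟨μ, hμ⟩ : ∃ μ, μ = atomMeasure (fun x => u x + 1) b (V b + γ) b := ⟨_, rfl⟩
  obtain ⟨ν, hν⟩ : ∃ ν, ν = atomMeasure (fun x => -(u x + 1)) b (v + γ) 0 := ⟨_, rfl⟩
  have : IsFiniteMeasure μ := hμ ▸ isFiniteMeasure_atomMeasure hf _ _
  have : IsFiniteMeasure ν := hν ▸ isFiniteMeasure_atomMeasure (f := fun x => -(u x + 1)) hf.neg _ _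
  have hsub : ∀ A : Set ℝ, MeasurableSet A → μ.real A - ν.real A
      = (∫ x in A ∩ Ioc 0 b, (u x + 1)) + ((V b + γ) * A.indicator 1 b
        - (v + γ) * A.indicator 1 0) := fun A hA => by
    rw [hμ, hν]
    exact atomMeasure_real_sub hf (by linarith) (by linarith) b 0 hA
  have hint0 : ∫ x in Ioc 0 b, (u x + 1) = v - V b := by
    rw [hVz, ← intervalIntegral.integral_of_le hb0.le]
    ring
  -- Equal masses let the two quantile functions be matched on the same parameter interval.
  have huniv : μ.real univ = ν.real univ := by
    have h := hsub univ MeasurableSet.univ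
    rw [univ_inter, hint0] at h
    simp only [indicator_univ, Pi.one_apply] at h
    linarith
  have hν0 : ν.real (Iic 0) = v + γ := by
    have h : Iic 0 ∩ Ioc 0 b = ∅ := by
      ext x
      simp only [mem_inter_iff, mem_Iic, mem_Ioc, mem_empty_iff_false, iff_false]
      exact fun h => absurd h.1 (not_le.2 h.2.1)
    rw [hν, atomMeasure_real (f := fun x => -(u x + 1)) hf.neg (by linarith) 0 measurableSet_Iic, h]
    simp
  have hμ0 : μ.real (Iic 0) = 0 := by
    have h : Iic 0 ∩ Ioc 0 b = ∅ := by
      ext x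
      simp only [mem_inter_iff, mem_Iic, mem_Ioc, mem_empty_iff_false, iff_false]
      exact fun h => absurd h.1 (not_le.2 h.2.1)
    rw [hμ, atomMeasure_real hf (by linarith) b measurableSet_Iic, h]
    simp [hb0]
  have h0 : 0 < μ.real univ := by
    have h : ν.real (Iic 0) ≤ ν.real univ := measureReal_mono (subset_univ _)
    linarith
  have hIci : ∀ x ∈ Ioc 0 b, μ.real (Ici x) - ν.real (Ici x) = V x + γ := by
    intro x hx
    have h1 : Ici x ∩ Ioc 0 b = Icc x b := by
      ext z
      simp only [mem_inter_iff, mem_Ici, mem_Ioc, mem_Icc]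
      exact ⟨fun h => ⟨h.1, h.2.2⟩, fun h => ⟨h.1, hx.1.trans_le h.1, h.2⟩⟩
    have h2 := intervalIntegral.integral_add_adjacent_intervals (hii 0 x) (hii x b)
    rw [intervalIntegral.integral_of_le hx.2, ← setIntegral_congr_set Ioc_ae_eq_Icc.symm] at h2
    rw [hsub _ measurableSet_Ici, h1, hVz x, hVz b]
    simp only [indicator, mem_Ici, hx.2, if_true, not_le.2 hx.1, if_false, Pi.one_apply]
    linarith
  have hIci0 : ∀ x ∉ Ioc 0 b, μ.real (Ici x) - ν.real (Ici x) = 0 := by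
    intro x hx
    rcases le_or_gt x 0 with h | h
    · have h1 : Ici x ∩ Ioc 0 b = Ioc 0 b := inter_eq_right.2 fun z hz => h.trans hz.1.le
      rw [hsub _ measurableSet_Ici, h1, hint0]
      simp [h, h.trans hb0.le]
    · have hbx : b < x := not_le.1 fun h' => hx ⟨h, h'⟩
      have h1 : Ici x ∩ Ioc 0 b = ∅ := by
        ext z
        simp only [mem_inter_iff, mem_Ici, mem_Ioc, mem_empty_iff_false, iff_false]
        exact fun h => absurd (hbx.trans_le h.1) (not_lt.2 h.2.2)
      rw [hsub _ measurableSet_Ici, h1]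
      simp [hbx, h]
  have hdom : ∀ x, ν (Ici x) ≤ μ (Ici x) := by
    intro x
    rw [← ofReal_measureReal, ← ofReal_measureReal (μ := μ)]
    refine ENNReal.ofReal_le_ofReal ?_
    by_cases hx : x ∈ Ioc 0 b
    · linarith [hIci x hx, hpos' x ⟨hx.1.le, hx.2⟩]
    · linarith [hIci0 x hx]
  obtain ⟨E, hE⟩ : ∃ E, E = quantileTriplet b μ ν (frontCost γ V b) := ⟨_, rfl⟩
  have hEL : E.L = frontCost γ V b := by rw [hE]; rfl
  have hprob : IsProbabilityMeasure E.Q := hE ▸ isProbabilityMeasure_quantileTriplet h0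
  have hstart : ∀ A : Set ℝ, MeasurableSet A → E.κ * E.Q.real {p | p.1 0 ∈ A} = μ.real A := by
    intro A hA
    rw [hE]
    refine mul_real_quantileTriplet h0 measurable_start ?_ hA
    simp_rw [quantilePath_start]
    exact map_quantile hb0.le (hμ ▸ atomMeasure_compl_Icc _ _ ⟨hb0.le, le_rfl⟩)
  have hend : ∀ A : Set ℝ, MeasurableSet A → E.κ * E.Q.real {p | p.1 p.2 ∈ A} = ν.real A := by
    intro A hA
    rw [hE]
    refine mul_real_quantileTriplet h0 measurable_end ?_ hA
    simp_rw [quantilePath_end hdom]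
    rw [huniv]
    exact map_quantile hb0.le (hν ▸ atomMeasure_compl_Icc _ _ ⟨le_rfl, hb0.le⟩)
  have hle : ∀ᵐ p ∂E.Q, p.1 p.2 ≤ p.1 0 := by
    rw [hE]
    refine ae_quantileTriplet (measurableSet_le measurable_end measurable_start) fun q => ?_
    rw [quantilePath_end hdom, quantilePath_start]
    exact quantile_le_quantile hdom le_rfl
  have hfl : ∀ x, flux E x = μ.real (Ici x) - ν.real (Ici x) := fun x => by
    rw [flux_eq_sub hle, ← hstart _ measurableSet_Ici, ← hend _ measurableSet_Ici]
    rfl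
  have heq : IsEquilibrium γ E := by
    rw [hE]
    refine isEquilibrium_quantileTriplet hγ hV hb0.le hpos' h0 hdom fun x hx => ?_
    rw [← hE, hfl, hIci x hx]
  obtain ⟨T, hT, hEq⟩ := heq
  have hfpos : ∀ x ∈ Ioc 0 b, 0 < flux E x := fun x hx => by
    rw [hfl, hIci x hx]
    linarith [hpos' x ⟨hx.1.le, hx.2⟩]
  have hfzero : ∀ x, b < x → flux E x = 0 := fun x hx => by
    rw [hfl, hIci0 x fun h => absurd hx (not_lt.2 h.2)]
  have hinv := hEq.invaded_eq hb0.le hfpos hfzero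
  have harr : ∀ x ∈ Ioc 0 b, E.arrivalTime x = frontTime u v x := by
    intro x hx
    rw [hEq.arrivalTime_eq_travel hfpos hx, hEq.travel_eq_lintegral_flux hfpos hx.2]
    refine setLIntegral_congr_fun measurableSet_Ioc fun z hz => ?_
    have hz' : z ∈ Ioc 0 b := ⟨hz.1, hz.2.trans hx.2⟩
    simp only [hfl z, hIci z hz', hVz z, add_sub_cancel_right]
  -- The only excess is the atom at `b`, which by the choice of `b` is invaded after time `N`.
  have hexc : ∀ A : Set ℝ, MeasurableSet A → E.excess u A = (V b + γ) * A.indicator 1 b := by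
    intro A hA
    have h1 : E.κ * E.Q.real {p | p.1 0 ∈ A ∧ p.1.θ = 0} = 0 := by
      have h2 : E.Q.real {p | p.1 0 ∈ A ∧ p.1.θ = 0} ≤ E.Q.real {p | p.1 0 ∈ Iic (0 : ℝ)} :=
        measureReal_mono fun p hp => (θ_eq_zero_iff p.1).1 hp.2
      have h3 := mul_le_mul_of_nonneg_left h2 hEq.κ_pos.le
      rw [hstart _ measurableSet_Iic, hμ0] at h3
      exact le_antisymm h3 (mul_nonneg hEq.κ_pos.le measureReal_nonneg)
    have hm := hA.inter (measurableSet_Ioc (a := (0 : ℝ)) (b := b))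
    have h4 := hsub _ hm
    have h5 : A ∩ Ioc 0 b ∩ Ioc 0 b = A ∩ Ioc 0 b := by rw [inter_assoc, inter_self]
    have h6 : (A ∩ Ioc 0 b).indicator (1 : ℝ → ℝ) 0 = 0 := indicator_of_notMem (by simp) _
    have h7 : (A ∩ Ioc 0 b).indicator (1 : ℝ → ℝ) b = A.indicator 1 b := by
      by_cases h : b ∈ A <;> simp [h, hb0]
    rw [h5, h6, h7] at h4
    rw [Triplet.excess, h1, hinv, hstart _ hm, hend _ hm, h4]
    simp_rw [add_comm (1 : ℝ)]
    ring
  refine ⟨E, ⟨T, hT, hEq⟩, fun A hA => ?_, ?_, fun t ht => ?_⟩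
  · rw [hexc A hA]
    exact mul_nonneg (by linarith) (indicator_nonneg (fun _ _ => zero_le_one) _)
  · rw [← ofReal_measureReal, ← ENNReal.ofReal_mul hEq.κ_pos.le, hEq.real_killing_eq, ← hν0,
      ← hend _ measurableSet_Iic]
    rfl
  · have hbt : b ∉ {x | E.arrivalTime x ≤ t} := by
      change ¬ E.arrivalTime b ≤ t
      rw [harr b ⟨hb0, le_rfl⟩, not_le]
      exact lt_of_le_of_lt (by exact_mod_cast ht) hN
    rw [Triplet.cumulativeExcess, hexc _ (measurableSet_le
      (hEq.monotone_arrivalTime hb0.le hfpos hfzero).measurable measurable_const),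
      indicator_of_notMem hbt, mul_zero]

/-! ### Convergence of arrival times, existence and uniqueness. -/

theorem IsEquilibrium.measurable_arrivalTime (hE : IsEquilibrium γ E) (hγ : 0 < γ)
    (hex : E.ExcessNonneg u) : Measurable E.arrivalTime := by
  obtain ⟨T, -, hE⟩ := hE
  obtain ⟨b, hb, hpos, hzero⟩ := hE.exists_front hγ hex
  exact (hE.monotone_arrivalTime hb hpos hzero).measurable

theorem IsEquilibrium.cumulativeExcess_nonneg (hE : IsEquilibrium γ E) (hγ : 0 < γ)
    (hex : E.ExcessNonneg u) (t : ℝ≥0) : 0 ≤ E.cumulativeExcess u t :=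
  hex _ (measurableSet_le (hE.measurable_arrivalTime hγ hex) measurable_const)

theorem IsEquilibrium.ofReal_killing (hE : IsEquilibrium γ E) :
    ENNReal.ofReal E.κ * E.Q {p | p.2 = p.1.θ}
      = ENNReal.ofReal (E.κ * E.Q.real {p | p.2 = p.1.θ}) := by
  obtain ⟨T, -, hE⟩ := hE
  have := hE.isProbabilityMeasure
  rw [ENNReal.ofReal_mul hE.κ_pos.le, ofReal_measureReal]

theorem IsEquilibrium.boundaryMeasure_eq (hE : IsEquilibrium γ E) :
    E.boundaryMeasure
      = ENNReal.ofReal (E.κ * E.Q.real {p | p.2 = p.1.θ}) • Measure.dirac 0 := by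
  rw [← hE.ofReal_killing]
  obtain ⟨T, -, hE⟩ := hE
  exact hE.boundaryMeasure_eq

/-- The lower bound for the arrival time needs only `p → γ + V₀`; the upper bound is trivial where
the limit is infinite and otherwise uses the vanishing excess up to a time beyond the limit. -/
theorem tendsto_arrivalTime (hγ : 0 < γ) {V₀ : ℝ} (hV₀ : 0 ≤ V₀) (hu : LocallyIntegrable u)
    (hb : ∃ C : ℝ, ∀ x, |u x| ≤ C) {E : ℕ → HalfLineTriplet}
    (hE : ∀ n, IsEquilibrium γ (E n)) (hex : ∀ n, (E n).ExcessNonneg u)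
    (hp : Tendsto (fun n => (E n).κ * (E n).Q.real {p | p.2 = p.1.θ}) atTop (𝓝 (γ + V₀)))
    (hr : ∀ r : ℝ≥0, Tendsto (fun n => (E n).cumulativeExcess u r) atTop (𝓝 0)) (x : ℝ) :
    Tendsto (fun n => (E n).arrivalTime x) atTop (𝓝 (frontTime u V₀ x)) := by
  have hlow : frontTime u V₀ x ≤ liminf (fun n => (E n).arrivalTime x) atTop := by
    have h1 : Tendsto (fun n => (E n).κ * (E n).Q.real {p | p.2 = p.1.θ} - γ) atTop (𝓝 V₀) := by
      simpa using hp.sub_const γ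
    refine (le_liminf_frontTime hu h1 x).trans (liminf_le_liminf (Eventually.of_forall fun n => ?_))
    obtain ⟨T, -, hn⟩ := hE n
    exact hn.frontTime_le_arrivalTime hγ (hex n) x
  refine tendsto_of_le_liminf_of_limsup_le hlow ?_
  rcases eq_or_ne (frontTime u V₀ x) ⊤ with htop | htop
  · rw [htop]
    exact le_top
  -- Any `r` beyond the limiting time works: for large `n` the cumulative excess at time `r` serves
  -- as the velocity defect `η`, being below both `γ` and `p`.
  obtain ⟨r, hxr, -⟩ := ENNReal.lt_iff_exists_nnreal_btwn.1 htop.lt_top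
  have hr0 := hr r
  have h1 : Tendsto (fun n => (E n).κ * (E n).Q.real {p | p.2 = p.1.θ} - γ
      - (E n).cumulativeExcess u r) atTop (𝓝 V₀) := by
    simpa using (hp.sub_const γ).sub hr0
  have h2 := tendsto_frontTime hu hb h1 htop
  rw [← h2.limsup_eq]
  refine limsup_le_limsup ?_
  filter_upwards [h2.eventually (gt_mem_nhds hxr), hr0.eventually (gt_mem_nhds hγ),
    (hp.sub hr0).eventually (lt_mem_nhds (show 0 < γ + V₀ - 0 by linarith))] with n h3 h4 h5
  obtain ⟨T, -, hn⟩ := hE n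
  exact hn.arrivalTime_le_frontTime hγ hu (hex n) le_rfl h4 (by linarith) h3

theorem min_toReal_le (T : ℝ≥0) (a : ℝ≥0∞) : (min a T).toReal ≤ T := by
  have := ENNReal.toReal_mono ENNReal.coe_ne_top (min_le_right a T)
  rwa [ENNReal.coe_toReal] at this

theorem enorm_capped_sub_le (T : ℝ≥0) (a b : ℝ≥0∞) :
    ‖(min a T).toReal - (min b T).toReal‖ₑ ≤ T := by
  have h1 := min_toReal_le T a
  have h2 := min_toReal_le T b
  have h3 : 0 ≤ (min a (T : ℝ≥0∞)).toReal := ENNReal.toReal_nonneg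
  have h4 : 0 ≤ (min b (T : ℝ≥0∞)).toReal := ENNReal.toReal_nonneg
  rw [← ofReal_norm, Real.norm_eq_abs]
  exact (ENNReal.ofReal_le_ofReal (abs_le.2 ⟨by linarith, by linarith⟩)).trans_eq
    ENNReal.ofReal_coe_nnreal

theorem tendsto_capped (T : ℝ≥0) {a : ℕ → ℝ≥0∞} {b : ℝ≥0∞} (h : Tendsto a atTop (𝓝 b)) :
    Tendsto (fun n => (min (a n) T).toReal) atTop (𝓝 (min b T).toReal) :=
  (ENNReal.tendsto_toReal (ne_top_of_le_ne_top ENNReal.coe_ne_top (min_le_right _ _))).comp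
    (h.min tendsto_const_nhds)

theorem tendstoCappedL1Loc_of_tendsto (T : ℝ≥0) {wn : ℕ → ℝ → ℝ≥0∞} {w : ℝ → ℝ≥0∞}
    (hwn : ∀ n, Measurable (wn n)) (hw : Measurable w)
    (h : ∀ x, Tendsto (fun n => wn n x) atTop (𝓝 (w x))) : TendstoCappedL1Loc T wn w := by
  intro K hK
  have h0 : ∫⁻ _ in K, (0 : ℝ≥0∞) = 0 := lintegral_zero
  rw [← h0]
  refine tendsto_lintegral_of_dominated_convergence (fun _ => (T : ℝ≥0∞)) (fun n => ?_)
    (fun n => ae_of_all _ fun x => enorm_capped_sub_le T _ _) ?_ (ae_of_all _ fun x => ?_)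
  · exact (((hwn n).min measurable_const).ennreal_toReal.sub
      (hw.min measurable_const).ennreal_toReal).enorm
  · rw [lintegral_const, Measure.restrict_apply_univ]
    exact ENNReal.mul_ne_top ENNReal.coe_ne_top hK.measure_lt_top.ne
  · have h1 := ((tendsto_capped T (h x)).sub_const (min (w x) T).toReal).enorm
    simpa using h1

/-- Fatou's lemma identifies the two limits at countably many caps and on countably many intervals;
letting the cap tend to infinity removes it. -/
theorem ae_eq_of_tendstoCappedL1Loc {wn : ℕ → ℝ → ℝ≥0∞} {w f : ℝ → ℝ≥0∞}
    (hwn : ∀ n, Measurable (wn n)) (hw : AEMeasurable w)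
    (h : ∀ T : ℝ≥0, 0 < T → TendstoCappedL1Loc T wn w)
    (hf : ∀ x, Tendsto (fun n => wn n x) atTop (𝓝 (f x))) : w =ᵐ[volume] f := by
  have key : ∀ T k : ℕ, ∀ᵐ x, x ∈ Icc (-(k : ℝ)) k →
      min (f x) ((T + 1 : ℝ≥0) : ℝ≥0∞) = min (w x) ((T + 1 : ℝ≥0) : ℝ≥0∞) := by
    intro T k
    rw [← ae_restrict_iff' measurableSet_Icc]
    obtain ⟨c, hc⟩ : ∃ c : ℝ≥0, c = T + 1 := ⟨_, rfl⟩
    rw [← hc]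
    have hm : ∀ n, AEMeasurable (fun x => ‖(min (wn n x) c).toReal - (min (w x) c).toReal‖ₑ)
        (volume.restrict (Icc (-(k : ℝ)) k)) := fun n =>
      (((hwn n).min measurable_const).ennreal_toReal.aemeasurable.sub
        (hw.restrict.min aemeasurable_const).ennreal_toReal).enorm
    have hlim : ∀ x, Tendsto (fun n => ‖(min (wn n x) c).toReal - (min (w x) c).toReal‖ₑ) atTop
        (𝓝 ‖(min (f x) c).toReal - (min (w x) c).toReal‖ₑ) := fun x =>
      ((tendsto_capped c (hf x)).sub_const _).enorm
    have hfat := lintegral_liminf_le' (u := atTop) hm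
    rw [(h c (by rw [hc]; positivity) _ isCompact_Icc).liminf_eq] at hfat
    simp_rw [fun x => (hlim x).liminf_eq] at hfat
    have hm' : AEMeasurable (fun x => ‖(min (f x) c).toReal - (min (w x) c).toReal‖ₑ)
        (volume.restrict (Icc (-(k : ℝ)) k)) :=
      aemeasurable_of_tendsto_metrizable_ae atTop hm (ae_of_all _ hlim)
    filter_upwards [(lintegral_eq_zero_iff' hm').1 (le_antisymm hfat zero_le)] with x hx
    have hx' : (min (f x) c).toReal - (min (w x) c).toReal = 0 := by simpa using hx
    exact (ENNReal.toReal_eq_toReal_iff'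
      (ne_top_of_le_ne_top ENNReal.coe_ne_top (min_le_right _ _))
      (ne_top_of_le_ne_top ENNReal.coe_ne_top (min_le_right _ _))).1 (sub_eq_zero.1 hx')
  have key' := ae_all_iff.2 fun T => ae_all_iff.2 fun k => key T k
  filter_upwards [key'] with x hx
  obtain ⟨k, hk⟩ := exists_nat_ge |x|
  have hxk := abs_le.1 hk
  have hlim : ∀ a : ℝ≥0∞, Tendsto (fun T : ℕ => min a ((T + 1 : ℝ≥0) : ℝ≥0∞)) atTop (𝓝 a) := by
    intro a
    have h1 : Tendsto (fun T : ℕ => ((T + 1 : ℝ≥0) : ℝ≥0∞)) atTop (𝓝 ⊤) := by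
      have := (tendsto_add_atTop_iff_nat 1).2 ENNReal.tendsto_nat_nhds_top
      simpa using this
    simpa using (tendsto_const_nhds (x := a)).min h1
  refine tendsto_nhds_unique (hlim (w x)) ((hlim (f x)).congr fun T => hx T k hxk)

/-- Initial velocities `V₀ + 1/(n+1)` give strict domination at the origin. The `n`-th equilibrium
has no excess up to time `n`, so minimality reduces to the non-negativity of the competitors'
excess. -/
theorem isMinimalSolution_frontTime (hγ : 0 < γ) {V₀ : ℝ} (hV₀ : 0 ≤ V₀)
    (hu : LocallyIntegrable u) (hb : ∃ C : ℝ, ∀ x, |u x| ≤ C) :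
    IsMinimalSolution γ u (Iic 0) (fun _ => V₀) (frontTime u V₀) := by
  have hwm : Measurable (frontTime u V₀) := (frontTime_mono u V₀).measurable
  have hvs : ∀ n : ℕ, 0 < V₀ + 1 / ((n : ℝ) + 1) := fun n => by positivity
  choose E hE hex hkill hcum using fun n : ℕ => exists_equilibrium hγ hu hb (hvs n) (n : ℝ≥0)
  have hvlim : Tendsto (fun n : ℕ => V₀ + 1 / ((n : ℝ) + 1) + γ) atTop (𝓝 (γ + V₀)) := by
    have := (tendsto_one_div_add_atTop_nhds_zero_nat (𝕜 := ℝ)).const_add V₀ |>.add_const γ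
    rwa [add_zero, add_comm V₀ γ] at this
  have hp : ∀ n, (E n).κ * (E n).Q.real {p | p.2 = p.1.θ} = V₀ + 1 / ((n : ℝ) + 1) + γ := by
    intro n
    have h := hkill n
    rw [(hE n).ofReal_killing] at h
    have hκ : 0 ≤ (E n).κ * (E n).Q.real {p | p.2 = p.1.θ} := by
      obtain ⟨T, -, hn⟩ := hE n
      exact mul_nonneg hn.κ_pos.le measureReal_nonneg
    exact (ENNReal.ofReal_eq_ofReal_iff hκ (by linarith [hvs n])).1 h
  have hzero : ∀ r : ℝ≥0, ∀ᶠ n in atTop, (E n).cumulativeExcess u r = 0 := by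
    intro r
    obtain ⟨m, hm⟩ := exists_nat_ge r
    filter_upwards [eventually_ge_atTop m] with n hn
    exact hcum n r (hm.trans (by exact_mod_cast hn))
  refine ⟨hwm.aemeasurable, E, hE, fun T _ => ⟨⟨fun n A hA hpos => ?_, hex, ?_, ?_⟩, ?_⟩⟩
  · rw [(hE n).boundaryMeasure_eq, hp n, Measure.smul_apply, Measure.dirac_apply' _ hA,
      smul_eq_mul] at hpos
    rw [(hE n).boundaryMeasure_eq, hp n, initialEnergy_eq, Measure.smul_apply,
      Measure.smul_apply, Measure.dirac_apply' _ hA, smul_eq_mul, smul_eq_mul]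
    by_cases h0 : (0 : ℝ) ∈ A
    · rw [indicator_of_mem h0, Pi.one_apply, mul_one, mul_one]
      have h1 : 0 < 1 / ((n : ℝ) + 1) := by positivity
      exact (ENNReal.ofReal_lt_ofReal_iff (by linarith)).2 (by linarith)
    · rw [indicator_of_notMem h0, mul_zero] at hpos
      exact absurd hpos (lt_irrefl _)
  · refine tendstoCappedL1Loc_of_tendsto T
      (fun n => (hE n).measurable_arrivalTime hγ (hex n)) hwm fun x => ?_
    refine tendsto_arrivalTime hγ hV₀ hu hb hE hex ?_ (fun r => ?_) x
    · simp_rw [hp]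
      exact hvlim
    · exact tendsto_const_nhds.congr' ((hzero r).mono fun n hn => hn.symm)
  · rw [lintegral_initialEnergy]
    simp_rw [hkill]
    exact ENNReal.tendsto_ofReal hvlim
  · intro E' hE' _ hex' _ r t _ _
    refine le_liminf_of_le (by isBoundedDefault) ?_
    filter_upwards [hzero r] with n hn
    rw [hn, sub_zero]
    exact_mod_cast (hE' n).cumulativeExcess_nonneg hγ (hex' n) t

/-- Minimality is tested against constructed equilibria with the same boundary mass and no excess up
to a late time. This forces the excess of the given sequence to vanish in the limit, and then the
arrival times converge to the front time. -/
theorem ae_eq_of_isMinimalSolution (hγ : 0 < γ) {V₀ : ℝ} (hV₀ : 0 ≤ V₀)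
    (hu : LocallyIntegrable u) (hb : ∃ C : ℝ, ∀ x, |u x| ≤ C) {w : ℝ → ℝ≥0∞}
    (hw : IsMinimalSolution γ u (Iic 0) (fun _ => V₀) w) : w =ᵐ[volume] frontTime u V₀ := by
  obtain ⟨hwm, E, hE, hT⟩ := hw
  obtain ⟨⟨hdom, hex, -, hkill⟩, -⟩ := hT 1 one_pos
  have hp0 : ∀ n, 0 ≤ (E n).κ * (E n).Q.real {p | p.2 = p.1.θ} := fun n => by
    obtain ⟨T, -, hn⟩ := hE n
    exact mul_nonneg hn.κ_pos.le measureReal_nonneg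
  have hp : Tendsto (fun n => (E n).κ * (E n).Q.real {p | p.2 = p.1.θ}) atTop (𝓝 (γ + V₀)) := by
    rw [lintegral_initialEnergy] at hkill
    have h1 := (ENNReal.tendsto_toReal ENNReal.ofReal_ne_top).comp hkill
    rw [ENNReal.toReal_ofReal (by linarith)] at h1
    refine h1.congr fun n => ?_
    rw [Function.comp_apply, (hE n).ofReal_killing, ENNReal.toReal_ofReal (hp0 n)]
  have hgt : ∀ n, 0 < (E n).κ * (E n).Q.real {p | p.2 = p.1.θ} →
      γ + V₀ < (E n).κ * (E n).Q.real {p | p.2 = p.1.θ} := by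
    intro n hn
    have h := hdom n univ MeasurableSet.univ
    rw [(hE n).boundaryMeasure_eq, initialEnergy_eq] at h
    simp only [Measure.smul_apply, measure_univ, smul_eq_mul, mul_one] at h
    exact (ENNReal.ofReal_lt_ofReal_iff hn).1 (h (ENNReal.ofReal_pos.2 hn))
  -- Strict domination says nothing about a vanishing boundary measure, but the masses converge to
  -- `γ + V₀ > 0`.
  have hpos : ∀ᶠ n in atTop, γ + V₀ < (E n).κ * (E n).Q.real {p | p.2 = p.1.θ} :=
    (hp.eventually (lt_mem_nhds (show 0 < γ + V₀ by linarith))).mono hgt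
  have hr : ∀ r : ℝ≥0, Tendsto (fun n => (E n).cumulativeExcess u r) atTop (𝓝 0) := by
    intro r
    -- The times `r < r + 1 < r + 2` leave room for the strict inequalities in the minimality
    -- condition with horizon `r + 2`. For an index without strict domination of masses, the
    -- equilibrium serves as its own competitor.
    have hcomp : ∀ n, ∃ E' : HalfLineTriplet, IsEquilibrium γ E' ∧
        E'.boundaryMeasure = (E n).boundaryMeasure ∧ E'.ExcessNonneg u ∧
        (∀ t ≤ r + 2, E'.cumulativeExcess u t ≤ (E n).cumulativeExcess u t) ∧
        (γ + V₀ < (E n).κ * (E n).Q.real {p | p.2 = p.1.θ} →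
          E'.cumulativeExcess u (r + 1) = 0) := by
      intro n
      by_cases h : γ + V₀ < (E n).κ * (E n).Q.real {p | p.2 = p.1.θ}
      · obtain ⟨E', h1, h2, h3, h4⟩ := exists_equilibrium hγ hu hb
          (v := (E n).κ * (E n).Q.real {p | p.2 = p.1.θ} - γ) (by linarith) (r + 2)
        refine ⟨E', h1, ?_, h2, fun t ht => ?_, fun _ => h4 _ (by gcongr; norm_num)⟩
        · rw [h1.boundaryMeasure_eq, (hE n).boundaryMeasure_eq, ← h1.ofReal_killing, h3,
            sub_add_cancel]
        · rw [h4 t ht]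
          exact (hE n).cumulativeExcess_nonneg hγ (hex n) t
      · exact ⟨E n, hE n, rfl, hex n, fun _ _ => le_rfl, fun h' => absurd h' h⟩
    choose E' h1 h2 h3 h4 h5 using hcomp
    have hlim := (hT (r + 2) (by positivity)).2 E' h1 h2 h3 h4 r (r + 1)
      (lt_add_of_pos_right r one_pos) (by gcongr; norm_num)
    refine tendsto_order.2 ⟨fun a ha => Eventually.of_forall fun n =>
      ha.trans_le ((hE n).cumulativeExcess_nonneg hγ (hex n) r), fun a ha => ?_⟩
    have hlt : ((-a : ℝ) : EReal) < (0 : EReal) := by exact_mod_cast neg_lt_zero.2 ha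
    filter_upwards [eventually_lt_of_lt_liminf (hlt.trans_le hlim), hpos] with n h6 h7
    rw [h5 n h7, zero_sub, EReal.coe_lt_coe_iff] at h6
    linarith
  exact ae_eq_of_tendstoCappedL1Loc (fun n => (hE n).measurable_arrivalTime hγ (hex n)) hwm
    (fun T hT0 => (hT T hT0).1.2.2.1)
    (tendsto_arrivalTime hγ hV₀ hu hb hE hex hp hr)

end

end Cascade

theorem proposition5p1 (γ V₀ : ℝ) (hγ : 0 < γ) (hV₀ : 0 ≤ V₀) (u : ℝ → ℝ)
    (hu : AEMeasurable u) (hb : ∃ C : ℝ, ∀ x, |u x| ≤ C) :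
    Cascade.IsMinimalSolution γ u (Iic 0) (fun _ => V₀) (Cascade.explicitArrivalTime u V₀) ∧
      ∀ w : ℝ → ℝ≥0∞, Cascade.IsMinimalSolution γ u (Iic 0) (fun _ => V₀) w →
        w =ᵐ[volume] Cascade.explicitArrivalTime u V₀ := by
  have hul := Cascade.locallyIntegrable_of_bounded hu hb
  have heq : Cascade.explicitArrivalTime u V₀ = Cascade.frontTime u V₀ :=
    funext fun x => Cascade.explicitArrivalTime_eq hul hb V₀ x
  rw [heq]
  exact ⟨Cascade.isMinimalSolution_frontTime hγ hV₀ hul hb,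
    fun w hw => Cascade.ae_eq_of_isMinimalSolution hγ hV₀ hul hb hw⟩
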